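/- **Setting.** A sequence of RMQ commands reads an array $A$ over a linearly ordered set: $\mathtt{Value}\,v$ appends $v$ as the next entry $A[j]$ ($j$ is then the current position, counted from $1$); $\mathtt{Mark}$ makes the current position active; $\mathtt{Close}\,i$ makes $i$ inactive; $\mathtt{Query}\,i$ asks for $\min\{A[k] : i\le k\le j\}$. A sequence is valid if every $\mathtt{Mark}$ concerns an existing position that was not marked before, and every $\mathtt{Query}\,i$ and $\mathtt{Close}\,i$ concerns an active position $i$. Let $\ell$ be the maximum number of active positions over all instants. A *structure of size $a$* supports $a$ elements (marked positions). It consists of a stack of increasing values above the sentinel $-\infty$, a hash table with separate chaining and $2a+1$ buckets whose keys are positions (closed positions are flagged as inactive, not removed), and a union-find forest (union by rank, path compression) whose sets are labelled with stack levels. The hash functions of the structures are random, and in every structure two different keys fall into the same of $m$ buckets with probability at most $1/m$. $\mathtt{Value}\,v$ pops the stack items that are superseded by $v$ and unites their sets of positions; $\mathtt{Mark}$ inserts the current position into the set of the top item, pushing a new item first if needed; $\mathtt{Query}$ is a hash lookup and a find. Time counts the nodes examined in hash chains, the parent pointers followed in the forest, the rounds of the popping loop, the instructions executed, and, when a structure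 of size $a$ is requested, $2a+2$ units for clearing its memory. *Procedure.* At first there is one empty active structure of size $a$, where $1\le a\le 2\ell$. $\mathtt{Value}$ and $\mathtt{Mark}$ modify only the active structure; $\mathtt{Query}$ is answered by the minimum of the answers of all structures except the destination described below, where a structure all of whose positions are larger than $i$ answers with its minimum value; $\mathtt{Close}$ is applied to all structures. When the active structure is full it becomes static, and a new active structure is requested: of the same size if there is no other static structure. If there is another one, of size $a_1$, and the newly filled one has size $a_2$, then the new active structure gets size $\lceil (a_1+a_2)/2\rceil$, a destination structure of size $c_1+c_2$ is requested, where $c_1,c_2$ are the current numbers of active positions in the two static structures, and a *merging program* is started. The merging program is a fixed finite program that acts on the two static structures and the destination through elementary operations (reading a hash node, hash lookup, find, union, access to a stack item or to a label, insertion, push, pop) with finitely many registers for natural numbers, which it can only load, copy, increment and compare, and for stack values, which it can only load, compare and push. After each command at most $K$ further instructions of it are executed. When it ends, the two static structures are discarded and the destination becomes a full static structure. **Lemma.** There are a merging program and constants $K$ and $C$ such that, for every linearly ordered set of values, every valid sequence of $n$ commands, with $\ell$ as above, every initial size $a$ with $1\le a\le 2\ell$, and all random hash functions as above: 1. for every outcome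 of the hash functions the procedure runs without failure (no structure overflows, every merge has ended when the active structure is full), and it answers every $\mathtt{Query}\,i$ correctly; 2. for every outcome, after each command there are at most four structures in memory, none of size larger than $2\ell$; each holds at most as many elements as its size (and its stack at most two items more, for the sentinels); and every merge of structures of sizes $a_1$ and $a_2$ has ended when $\lceil (a_1+a_2)/2\rceil$ commands have been processed since its start; 3. the expected total time that is spent on the transfer (requests for new structures and instructions of the merging program) is at most $C\,\alpha(\ell)\,n$, and so is the expected total time that is spent on the commands themselves in all structures in memory. That is, the overhead is $O(\alpha(\ell))$ expected amortized time per command. Here $\alpha(\ell)=\min\{k\ge 1 : A(k,k)\ge \ell\}$ is the inverse of the Ackermann function. -/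

import Mathlib

/-! ## Range-minimum commands and their meaning -/

namespace RMQ

/-- The four commands. Positions are numbered from `1`; `query i` asks for the minimum between
position `i` and the current position. -/
inductive Cmd (V : Type*) where
  | value (v : V)
  | mark
  | query (i : ℕ)
  | close (i : ℕ)

/-- What has happened so far: the values read (the array `A`, with `A[i]` in place `i - 1`), the
positions that were marked at some time, and the active ones (marked and not yet closed). -/
structure Hist (V : Type*) where
  vals : List V
  marked : Finset ℕ
  act : Finset ℕ

/-- The history before the first command. -/
def Hist.init (V : Type*) : Hist V := ⟨[], ∅, ∅⟩

/-- The effect of a command on the history. The current position is the number of values read. -/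
def Hist.step {V : Type*} (h : Hist V) : Cmd V → Hist V
  | .value v => { h with vals := h.vals ++ [v] }
  | .mark => { h with marked := insert h.vals.length h.marked, act := insert h.vals.length h.act }
  | .query _ => h
  | .close i => { h with act := h.act.erase i }

/-- When a command may be issued: there is a current position to mark and it has not been marked
before; only active positions are queried and closed. -/
def Hist.Allowed {V : Type*} (h : Hist V) : Cmd V → Prop
  | .value _ => True
  | .mark => 0 < h.vals.length ∧ h.vals.length ∉ h.marked
  | .query i => i ∈ h.act
  | .close i => i ∈ h.act

/-- Every command of the sequence is allowed at the time when it is issued. -/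
def Hist.Valid {V : Type*} : Hist V → List (Cmd V) → Prop
  | _, [] => True
  | h, c :: cs => h.Allowed c ∧ (h.step c).Valid cs

/-- The maximum number of active positions over all instants. -/
def Hist.maxActive {V : Type*} : Hist V → List (Cmd V) → ℕ
  | h, [] => h.act.card
  | h, c :: cs => max h.act.card ((h.step c).maxActive cs)

/-- Values with the two sentinels: `⊥` is `-∞` and `⊤` is `+∞`. -/
abbrev Val (V : Type*) := WithBot (WithTop V)

/-- An element of `V` as a value. -/
def Val.of {V : Type*} (v : V) : Val V := ((v : WithTop V) : WithBot (WithTop V))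

/-- `min {A[k] | i ≤ k ≤ j}`, where `j` is the current position. -/
def Hist.rmq {V : Type*} [LinearOrder V] (h : Hist V) (i : ℕ) : Val V :=
  (h.vals.drop (i - 1)).foldr (fun v m => min (Val.of v) m) ⊤

/-- The correct answers to the queries of a sequence, in order. -/
def Hist.answers {V : Type*} [LinearOrder V] : Hist V → List (Cmd V) → List (Val V)
  | _, [] => []
  | h, .query i :: cs => h.rmq i :: h.answers cs
  | h, .value v :: cs => (h.step (.value v)).answers cs
  | h, .mark :: cs => (h.step .mark).answers cs
  | h, .close i :: cs => (h.step (.close i)).answers cs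

/-- The inverse Ackermann function: the least `k ≥ 1` such that `A(k, k) ≥ n`. -/
noncomputable def invAck (n : ℕ) : ℕ := sInf {k : ℕ | 1 ≤ k ∧ n ≤ ack k k}

/-! ## The data structure: a stack, a chained hash table and a union-find forest

Every operation returns its result together with the time that it takes. -/

/-- The number of parent pointers between a node of a union-find forest and its root. -/
def ufDepth (uf : Batteries.UnionFind) (x : ℕ) : ℕ :=
  if h : uf.parent x = x then 0
  else
    have := Nat.sub_lt_sub_left (uf.lt_rankMax x) (uf.rank_lt h)
    ufDepth uf (uf.parent x) + 1
termination_by uf.rankMax - uf.rank x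

/-- A stack item: a value and a pointer. In an active structure the pointer is a position (a key
of the hash table) that belongs to the set of positions of the item; `0` is the null pointer. -/
structure Item (V : Type*) where
  val : Val V
  ptr : ℕ

/-- A structure that supports `cap` elements. Elements are numbered in the order of insertion.
Element `t` is at once the node `t` of the hash table, with key `key t` and the flag `live t`
(false once the position has been closed), and the node `t` of the union-find forest. The hash
table uses separate chaining: `chain b` lists the nodes in bucket `b`. If `r` is the root of a set
of the forest then `label r` is the stack level of that set. The stack occupies the levels
`1, …, top`. `count` is the number of elements that are not closed and `minPos` the least key. -/
structure Struct (V : Type*) where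
  cap : ℕ
  hash : ℕ → ℕ
  stack : ℕ → Item V
  top : ℕ
  chain : ℕ → List ℕ
  key : ℕ → ℕ
  live : ℕ → Bool
  uf : Batteries.UnionFind
  label : ℕ → ℕ
  count : ℕ
  minPos : WithTop ℕ

/-- The number of buckets of a table for `a` elements: the load stays below one half. -/
def buckets (a : ℕ) : ℕ := 2 * a + 1

/-- A hash function for every structure (numbered in the order of creation) and every number of
buckets. -/
abbrev Hashing := ℕ → ℕ → ℕ → ℕ

namespace Struct

variable {V : Type*}

/-- The number of elements. -/
def size (T : Struct V) : ℕ := T.uf.size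

/-- A new structure, the `s`-th one, for `a` elements. Its stack holds `-∞` and `+∞`. -/
def fresh (H : Hashing) (s a : ℕ) : Struct V where
  cap := a
  hash := H s (buckets a)
  stack := fun k => if k = 2 then ⟨⊤, 0⟩ else ⟨⊥, 0⟩
  top := 2
  chain := fun _ => []
  key := fun _ => 0
  live := fun _ => false
  uf := Batteries.UnionFind.empty
  label := fun _ => 0
  count := 0
  minPos := ⊤

/-- The time to obtain clean memory for a structure for `a` elements. -/
def freshTime (a : ℕ) : ℕ := buckets a + 1

/-- Walk along a chain until the key `x` is met; one step for each node that is examined. -/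
def scan (key : ℕ → ℕ) (x : ℕ) : List ℕ → Option ℕ × ℕ
  | [] => (none, 1)
  | t :: ts => if key t = x then (some t, 1) else ((scan key x ts).1, (scan key x ts).2 + 1)

/-- Search for a key in the hash table. -/
def lookup (T : Struct V) (x : ℕ) : Option ℕ × ℕ := scan T.key x (T.chain (T.hash x))

/-- The root of the set of an element, with path compression. -/
def find (T : Struct V) (t : ℕ) : Struct V × ℕ × ℕ :=
  ({ T with uf := (T.uf.findD t).1 }, (T.uf.findD t).2, ufDepth T.uf t + 1)

/-- Unite two sets (two finds with path compression, then linking by rank) and give the new set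
the stack level `k`. -/
def unite (T : Struct V) (t u k : ℕ) : Struct V × ℕ :=
  if h : t < T.uf.size ∧ u < T.uf.size then
    let uf' := T.uf.union ⟨t, h.1⟩ ⟨u, h.2⟩
    ({ T with uf := uf', label := Function.update T.label (uf'.rootD t) k },
      (ufDepth T.uf t + 1) + (ufDepth (T.uf.findD t).1 u + 1) + 1)
  else (T, 1)

/-- Insert the position `x` as a new element: a new node at the head of its chain, and a new
singleton set with stack level `k`. -/
def insert (T : Struct V) (x k : ℕ) : Struct V :=
  { T with
    chain := Function.update T.chain (T.hash x) (T.size :: T.chain (T.hash x))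
    key := Function.update T.key T.size x
    live := Function.update T.live T.size true
    uf := T.uf.push
    label := Function.update T.label T.size k
    count := T.count + 1
    minPos := min T.minPos x }

/-- `Close`: the element is not removed but flagged. -/
def close (T : Struct V) (x : ℕ) : Struct V × ℕ :=
  match T.lookup x with
  | (none, c) => (T, c)
  | (some t, c) =>
    if T.live t then
      ({ T with live := Function.update T.live t false, count := T.count - 1 }, c)
    else (T, c)

/-- Unite the set of the top item with the set of the item below it. A null pointer stands for
an item without positions. -/
def uniteTop (T : Struct V) : Struct V × ℕ :=
  let p := (T.stack T.top).ptr
  let q := (T.stack (T.top - 1)).ptr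
  if p = 0 then (T, 1)
  else
    match T.lookup p with
    | (none, c) => (T, c)
    | (some t, c) =>
      if q = 0 then
        let r := T.find t
        ({ r.1 with
            label := Function.update r.1.label r.2.1 (T.top - 1)
            stack := Function.update T.stack (T.top - 1)
              { T.stack (T.top - 1) with ptr := p } }, c + r.2.2)
      else
        match T.lookup q with
        | (none, c') => (T, c + c')
        | (some u, c') =>
          let r := T.unite t u (T.top - 1)
          (r.1, c + c' + r.2)

variable [LinearOrder V]

/-- The loop of `Value`: while the item below the top is at least `v`, unite and pop. The first
argument bounds the number of rounds. -/
def popLoop (v : Val V) : ℕ → Struct V → Struct V × ℕ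
  | 0, T => (T, 1)
  | n + 1, T =>
    if v ≤ (T.stack (T.top - 1)).val then
      let r := T.uniteTop
      let r' := popLoop v n { r.1 with top := r.1.top - 1 }
      (r'.1, r.2 + r'.2 + 1)
    else (T, 1)

/-- `Value v`. -/
def value (T : Struct V) (v : Val V) : Struct V × ℕ :=
  if v < (T.stack T.top).val then
    let r := popLoop v T.top T
    ({ r.1 with
        stack := Function.update r.1.stack r.1.top { r.1.stack r.1.top with val := v } },
      r.2 + 1)
  else (T, 1)

/-- `Mark`, when `j` is the current position and `v` its value. -/
def mark (T : Struct V) (j : ℕ) (v : Val V) : Struct V × ℕ :=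
  if (T.stack T.top).val < v then
    let T' : Struct V :=
      { T with top := T.top + 1, stack := Function.update T.stack (T.top + 1) ⟨v, j⟩ }
    (T'.insert j (T.top + 1), 1)
  else
    let T' := T.insert j T.top
    let p := (T.stack T.top).ptr
    if p = 0 then
      ({ T' with
          stack := Function.update T.stack T.top { T.stack T.top with ptr := j } }, 1)
    else
      match T'.lookup p with
      | (none, c) => (T', c)
      | (some u, c) =>
        let r := T'.unite u T.size T.top
        (r.1, c + r.2)

/-- The answer of one structure to `Query i`: the stack value of the set of `i` if the structure
contains `i`; the value above the sentinel `-∞` if `i` is smaller than all positions in the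
structure; `+∞` otherwise. -/
def query (T : Struct V) (i : ℕ) : Struct V × Val V × ℕ :=
  match T.lookup i with
  | (some t, c) =>
    let r := T.find t
    (r.1, (T.stack (T.label r.2.1)).val, c + r.2.2)
  | (none, c) =>
    if (i : WithTop ℕ) < T.minPos ∧ 2 ≤ T.top then (T, (T.stack 2).val, c) else (T, ⊤, c)

end Struct

/-! ## Programs for merging two full structures -/

/-- The structures that a merge works on: the two full ones and the destination. -/
inductive Slot where
  | old
  | young
  | dest

/-- The instructions. Apart from stack values, a program computes with a fixed number of
registers for natural numbers, which it can only load, copy, increase by one and compare. The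
numbers `l` are the places of instructions in the program (jump targets). -/
inductive Instr where
  /-- `r := n` -/
  | const (r n : ℕ)
  /-- `r := r'` -/
  | move (r r' : ℕ)
  /-- `r := r + 1` -/
  | succ (r : ℕ)
  /-- if `r < r'` go to `l` -/
  | jumpLt (r r' l : ℕ)
  /-- if `r = r'` go to `l` -/
  | jumpEq (r r' l : ℕ)
  /-- `r :=` number of elements -/
  | size (s : Slot) (r : ℕ)
  /-- `r :=` top level of the stack -/
  | top (s : Slot) (r : ℕ)
  /-- `r :=` key of the hash node `r'` -/
  | key (s : Slot) (r r' : ℕ)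
  /-- if the hash node `r` is flagged as closed go to `l` -/
  | jumpClosed (s : Slot) (r l : ℕ)
  /-- `r :=` element with key `r'`; if there is none go to `l` -/
  | lookup (s : Slot) (r r' l : ℕ)
  /-- `r := Find(r')` -/
  | find (s : Slot) (r r' : ℕ)
  /-- `r :=` label of the root `r'` -/
  | label (s : Slot) (r r' : ℕ)
  /-- label of the root `r` `:= r'` -/
  | setLabel (s : Slot) (r r' : ℕ)
  /-- `r :=` pointer of the stack item at level `r'` -/
  | ptr (s : Slot) (r r' : ℕ)
  /-- pointer of the stack item at level `r` `:= r'` -/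
  | setPtr (s : Slot) (r r' : ℕ)
  /-- value register `x :=` value of the stack item at level `r` -/
  | val (s : Slot) (x r : ℕ)
  /-- if value register `x` `<` value register `y` go to `l` -/
  | jumpValLt (x y l : ℕ)
  /-- push value register `x`, with a null pointer, on the destination's stack -/
  | push (x : ℕ)
  /-- pop the destination's stack -/
  | pop
  /-- insert the position `r`, as not closed, into the destination, with label `0` -/
  | insert (r : ℕ)
  /-- flag the position `r` as closed in the destination -/
  | close (r : ℕ)
  /-- unite the sets of the elements `r` and `r'` of the destination, with label `r''` -/
  | unite (r r' r'' : ℕ)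

/-- The state of a merge in progress. `age` is the number of commands processed since it began. -/
structure Merge (V : Type*) where
  old : Struct V
  young : Struct V
  dest : Struct V
  pc : ℕ
  reg : ℕ → ℕ
  vreg : ℕ → Val V
  age : ℕ

namespace Merge

variable {V : Type*}

/-- The structure in a slot. -/
def get (m : Merge V) : Slot → Struct V
  | .old => m.old
  | .young => m.young
  | .dest => m.dest

/-- Replace the structure in a slot. -/
def set (m : Merge V) (T : Struct V) : Slot → Merge V
  | .old => { m with old := T }
  | .young => { m with young := T }
  | .dest => { m with dest := T }

/-- Go to the next instruction. -/
def next (m : Merge V) : Merge V := { m with pc := m.pc + 1 }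

/-- Load a register and go to the next instruction. -/
def load (m : Merge V) (r n : ℕ) : Merge V := { m.next with reg := Function.update m.reg r n }

/-- Go to `l` if `p` holds, and to the next instruction otherwise. -/
def jump (m : Merge V) (p : Prop) [Decidable p] (l : ℕ) : Merge V :=
  if p then { m with pc := l } else m.next

variable [LinearOrder V]

/-- Execute one instruction; the result is the new state and the time of the operations on the
structures. Access beyond the memory of a structure fails. -/
def exec (m : Merge V) : Instr → Option (Merge V × ℕ)
  | .const r n => some (m.load r n, 0)
  | .move r r' => some (m.load r (m.reg r'), 0)
  | .succ r => some (m.load r (m.reg r + 1), 0)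
  | .jumpLt r r' l => some (m.jump (m.reg r < m.reg r') l, 0)
  | .jumpEq r r' l => some (m.jump (m.reg r = m.reg r') l, 0)
  | .size s r => some (m.load r (m.get s).size, 0)
  | .top s r => some (m.load r (m.get s).top, 0)
  | .key s r r' =>
    if m.reg r' < (m.get s).size then some (m.load r ((m.get s).key (m.reg r')), 0) else none
  | .jumpClosed s r l =>
    if m.reg r < (m.get s).size then
      some (m.jump ((m.get s).live (m.reg r) = false) l, 0)
    else none
  | .lookup s r r' l =>
    match (m.get s).lookup (m.reg r') with
    | (none, c) => some ({ m with pc := l }, c)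
    | (some t, c) => some (m.load r t, c)
  | .find s r r' =>
    if m.reg r' < (m.get s).size then
      let f := (m.get s).find (m.reg r')
      some ((m.set f.1 s).load r f.2.1, f.2.2)
    else none
  | .label s r r' =>
    if m.reg r' < (m.get s).size then some (m.load r ((m.get s).label (m.reg r')), 0) else none
  | .setLabel s r r' =>
    if m.reg r < (m.get s).size then
      some ((m.set { m.get s with
        label := Function.update (m.get s).label (m.reg r) (m.reg r') } s).next, 0)
    else none
  | .ptr s r r' =>
    if m.reg r' ≤ (m.get s).top then
      some (m.load r ((m.get s).stack (m.reg r')).ptr, 0)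
    else none
  | .setPtr s r r' =>
    if m.reg r ≤ (m.get s).top then
      some ((m.set { m.get s with
        stack := Function.update (m.get s).stack (m.reg r)
          { (m.get s).stack (m.reg r) with ptr := m.reg r' } } s).next, 0)
    else none
  | .val s x r =>
    if m.reg r ≤ (m.get s).top then
      some ({ m.next with
        vreg := Function.update m.vreg x ((m.get s).stack (m.reg r)).val }, 0)
    else none
  | .jumpValLt x y l => some (m.jump (m.vreg x < m.vreg y) l, 0)
  | .push x =>
    if m.dest.top < m.dest.cap + 2 then
      some ({ m.next with dest := { m.dest with
        top := m.dest.top + 1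
        stack := Function.update m.dest.stack (m.dest.top + 1) ⟨m.vreg x, 0⟩ } }, 0)
    else none
  | .pop => some ({ m.next with dest := { m.dest with top := m.dest.top - 1 } }, 0)
  | .insert r =>
    if m.dest.size < m.dest.cap then
      some ({ m.next with dest := m.dest.insert (m.reg r) 0 }, 0)
    else none
  | .close r =>
    let f := m.dest.close (m.reg r)
    some ({ m.next with dest := f.1 }, f.2)
  | .unite r r' r'' =>
    if m.reg r < m.dest.size ∧ m.reg r' < m.dest.size then
      let f := m.dest.unite (m.reg r) (m.reg r') (m.reg r'')
      some ({ m.next with dest := f.1 }, f.2)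
    else none

/-- Execute up to `n` instructions; the program ends when there is no instruction at the place
`pc`. Every instruction takes one unit of time, besides the time of its operation. -/
def steps (prog : List Instr) : ℕ → Merge V → Option (Merge V × ℕ)
  | 0, m => some (m, 0)
  | n + 1, m =>
    match prog[m.pc]? with
    | none => some (m, 0)
    | some i => do
      let r ← m.exec i
      let r' ← steps prog n r.1
      return (r'.1, r.2 + 1 + r'.2)

/-- The start of a merge. -/
def start (old young dest : Struct V) : Merge V where
  old := old
  young := young
  dest := dest
  pc := 0
  reg := fun _ => 0
  vreg := fun _ => ⊤
  age := 0

end Merge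

/-! ## The complete procedure -/

/-- The structures in memory besides the active one: none, one full structure, or two full
structures that are being merged into a destination. -/
inductive Phase (V : Type*) where
  | single
  | waiting (old : Struct V)
  | merging (m : Merge V)

/-- The state of the procedure: the structures, the current position and its value, the number of
structures created so far, and the time spent so far, on the commands themselves and on the
transfer (requests for new structures and merge instructions). -/
structure State (V : Type*) where
  active : Struct V
  phase : Phase V
  pos : ℕ
  cur : Val V
  created : ℕ
  cmdTime : ℕ
  transferTime : ℕ

namespace Phase

variable {V : Type*}

/-- The structures of a phase. -/
def structs : Phase V → List (Struct V)
  | .single => []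
  | .waiting T => [T]
  | .merging m => [m.old, m.young, m.dest]

/-- `Close` is applied to all structures, including the destination. -/
def close (i : ℕ) : Phase V → Phase V × ℕ
  | .single => (.single, 0)
  | .waiting T => (.waiting (T.close i).1, (T.close i).2)
  | .merging m =>
    (.merging { m with
      old := (m.old.close i).1, young := (m.young.close i).1, dest := (m.dest.close i).1 },
      (m.old.close i).2 + (m.young.close i).2 + (m.dest.close i).2)

/-- `Query` is answered by all structures except the destination. -/
def query [LinearOrder V] (i : ℕ) : Phase V → Phase V × Val V × ℕ
  | .single => (.single, ⊤, 0)
  | .waiting T =>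
    let r := T.query i
    (.waiting r.1, r.2.1, r.2.2)
  | .merging m =>
    let r := m.old.query i
    let r' := m.young.query i
    (.merging { m with old := r.1, young := r'.1 }, min r.2.1 r'.2.1, r.2.2 + r'.2.2)

end Phase

namespace State

variable {V : Type*} [LinearOrder V]

/-- All structures in memory. -/
def structs (S : State V) : List (Struct V) := S.active :: S.phase.structs

/-- Initially there is one empty structure for `a` elements. -/
def init (H : Hashing) (a : ℕ) : State V where
  active := Struct.fresh H 0 a
  phase := .single
  pos := 0
  cur := ⊤
  created := 1
  cmdTime := 0
  transferTime := Struct.freshTime a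

/-- Process a command proper; a query has an answer. -/
def process (S : State V) : Cmd V → State V × Option (Val V)
  | .value v =>
    let r := S.active.value (Val.of v)
    ({ S with
        active := r.1, pos := S.pos + 1, cur := Val.of v, cmdTime := S.cmdTime + r.2 }, none)
  | .mark =>
    let r := S.active.mark S.pos S.cur
    ({ S with active := r.1, cmdTime := S.cmdTime + r.2 }, none)
  | .query i =>
    let r := S.active.query i
    let r' := S.phase.query i
    ({ S with active := r.1, phase := r'.1, cmdTime := S.cmdTime + r.2.2 + r'.2.2 },
      some (min r.2.1 r'.2.1))
  | .close i =>
    let r := S.active.close i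
    let r' := S.phase.close i
    ({ S with active := r.1, phase := r'.1, cmdTime := S.cmdTime + r.2 + r'.2 }, none)

/-- Contribute at most `K` instructions to the merge in progress, if any. When the program has
ended, the two full structures are discarded and the destination takes their place. -/
def contribute (prog : List Instr) (K : ℕ) (S : State V) : Option (State V) :=
  match S.phase with
  | .merging m => do
    let r ← m.steps prog K
    let S' := { S with transferTime := S.transferTime + r.2 }
    if prog.length ≤ r.1.pc then
      return { S' with phase := .waiting r.1.dest }
    else
      return { S' with phase := .merging { r.1 with age := r.1.age + 1 } }
  | _ => some S

/-- When the active structure is full it becomes static and a new active structure is requested.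
If it is the second full structure, a merge begins: the destination supports exactly as many
elements as there are active positions in the two full structures, and the new active structure
supports half as many elements as the full ones together, rounded up. If a merge is still in
progress the procedure fails. -/
def rollover (H : Hashing) (S : State V) : Option (State V) :=
  if S.active.size < S.active.cap then some S
  else
    match S.phase with
    | .single =>
      some { S with
        active := Struct.fresh H S.created S.active.cap
        phase := .waiting S.active
        created := S.created + 1
        transferTime := S.transferTime + Struct.freshTime S.active.cap }
    | .waiting T =>
      let d := T.count + S.active.count
      let a := (T.cap + S.active.cap + 1) / 2
      some { S with
        active := Struct.fresh H (S.created + 1) a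
        phase := .merging (Merge.start T S.active (Struct.fresh H S.created d))
        created := S.created + 2
        transferTime := S.transferTime + Struct.freshTime d + Struct.freshTime a }
    | .merging _ => none

/-- Process a command, contribute to the merge, and replace the active structure if it is full. -/
def step (prog : List Instr) (K : ℕ) (H : Hashing) (S : State V) (c : Cmd V) :
    Option (State V × Option (Val V)) := do
  let r := S.process c
  let S₁ ← r.1.contribute prog K
  let S₂ ← S₁.rollover H
  return (S₂, r.2)

/-- Process a sequence of commands; the result is the final state and the list of answers. -/
def runFrom (prog : List Instr) (K : ℕ) (H : Hashing) :
    State V → List (Cmd V) → Option (State V × List (Val V))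
  | S, [] => some (S, [])
  | S, c :: cs => do
    let r ← S.step prog K H c
    let r' ← runFrom prog K H r.1 cs
    return (r'.1, r.2.toList ++ r'.2)

end State

section

variable {V : Type*} [LinearOrder V]

/-- The run of the procedure on a sequence of commands; `none` if it fails. -/
def run (prog : List Instr) (K : ℕ) (H : Hashing) (a : ℕ) (cs : List (Cmd V)) :
    Option (State V × List (Val V)) :=
  State.runFrom prog K H (State.init H a) cs

/-- The time that a run spends on the transfer. -/
def transferTime (prog : List Instr) (K : ℕ) (H : Hashing) (a : ℕ) (cs : List (Cmd V)) : ℕ :=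
  match run prog K H a cs with
  | some r => r.1.transferTime
  | none => 0

/-- The time that a run spends on the commands themselves, in all structures in memory. -/
def commandTime (prog : List Instr) (K : ℕ) (H : Hashing) (a : ℕ) (cs : List (Cmd V)) : ℕ :=
  match run prog K H a cs with
  | some r => r.1.cmdTime
  | none => 0

end

open MeasureTheory in
/-- Random hash functions such that, in every structure, two different keys fall into the same of
`m` buckets with probability at most `1 / m`. -/
structure IsUniversal {Ω : Type*} [MeasurableSpace Ω] (P : Measure Ω) (H : Ω → Hashing) :
    Prop where
  lt : ∀ ω s m x, 0 < m → H ω s m x < m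
  measurable : ∀ s m x, Measurable fun ω => H ω s m x
  collision : ∀ s m x y, 0 < m → x ≠ y →
    P {ω | H ω s m x = H ω s m y} ≤ (m : ENNReal)⁻¹

/-- The bounds on the memory: at most four structures; none supports more than `2 * l` elements,
and their contents do not exceed what they support (the stack holds up to two sentinels besides). A
merge in progress is younger, in commands, than the number of elements that the current active
structure supports, that is half of what the two full structures support together. -/
structure State.Within {V : Type*} (S : State V) (l : ℕ) : Prop where
  four : (S.active :: S.phase.structs).length ≤ 4
  cap : ∀ T ∈ S.active :: S.phase.structs, T.cap ≤ 2 * l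
  size : ∀ T ∈ S.active :: S.phase.structs, T.size ≤ T.cap ∧ T.top ≤ T.cap + 2
  age : ∀ m, S.phase = .merging m →
    m.age < S.active.cap ∧ S.active.cap = (m.old.cap + m.young.cap + 1) / 2

end RMQ

namespace RMQ

open Batteries Finset

/-! ## The potential of a union-find forest -/

/-! The commands alone determine the contents of all structures; a hash function decides only how
the nodes are spread over the chains, that is, the time of a search. A run is therefore described by
one deterministic state, to which `Struct.rehash` attaches the hash functions afterwards. Every
operation commutes with `rehash`. Correctness and the memory bounds then hold for every outcome, and
the expected time of a search is at most `3` because the contents do not depend on the outcome.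

Correctness. Let `e` be the position at which the present active structure was opened and `j` the
current position. In the active structure an element `x` has the stack value `min A[x..j]`, and
level `2` of the stack holds `min A[e+1..j]`. The full structures are frozen at `e`. A query for a
position in an older structure is completed by the level `2` values of the later ones. In a merge,
an old element gets the minimum of its own value and level `2` of the young structure, and a young
element keeps its value. The final values `min A[x..e]` are nondecreasing in `x`, and the elements
are copied in increasing order. So each copied value either equals the top of the destination's
stack or is pushed above it.

Deadlines and sizes. Every round of the merging program takes exactly `23` instructions, and
structures with `n₁` and `n₂` elements need `n₁ + n₂ + 3` rounds. This is at most `5 b` for `b =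
⌈(a₁ + a₂) / 2⌉`, so five rounds per command finish within `b` commands. A command inserts at most
one element, hence the active structure of size `b` cannot be full earlier. The destination is as
large as the number of active positions, at most `l`, and the rounded mean of two sizes up to `2 l`
is again at most `2 l`.

Time. The forests carry a potential with `A` levels (`rankPot`), for which a find costs `A` and a
union `3 A` (`findD_ufPot`, `ufPot_union`), up to constants. Each level of the active stack carries
`3 A + 10` units for its later removal, and each active element `14` units for clearing the memory
at the next replacement. One command then costs at most `35 A + 160` on average
(`State.Ready.step`). Structures of size `2 l` are covered by `A = α(l) + 4` (`lt_ack_invAck`). -/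

theorem ack_succ_eq_iterate (k r : ℕ) : ack (k + 1) r = (ack k)^[r + 1] 1 := by
  induction r with
  | zero => simp [ack_succ_zero]
  | succ r ih => rw [ack_succ_succ, ih, ← Function.iterate_succ_apply' (ack k)]

/-- The potential of a node of rank `r` whose parent has rank `p`, with `A` levels. -/
def rankPot (A r p : ℕ) : ℕ :=
  ∑ k ∈ range A, #{i ∈ range (r + 2) | p + 1 < (ack k)^[i + 1] (r + 1)}

theorem rankPot_anti (A r : ℕ) {p q : ℕ} (h : p ≤ q) : rankPot A r q ≤ rankPot A r p := by
  refine sum_le_sum fun k _ => card_le_card fun i hi => ?_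
  simp only [mem_filter] at hi ⊢
  exact ⟨hi.1, by omega⟩

theorem lt_iterate_ack (k n i : ℕ) : n < (ack k)^[i + 1] n := by
  induction i with
  | zero => exact lt_ack_right k n
  | succ i ih =>
    rw [Function.iterate_succ_apply']
    exact ih.trans (lt_ack_right k _)

theorem rankPot_self (A r : ℕ) : rankPot A r r = A * (r + 2) := by
  rw [rankPot, sum_congr rfl (g := fun _ => r + 2)]
  · simp
  · intro k _
    rw [filter_true_of_mem, card_range]
    exact fun i _ => lt_iterate_ack k _ i

/-- On level `k`, let `i` be the first index whose iterate exceeds `p + 1`. The iterate before it is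
at most `p + 1`, so one more application of `ack k` stays below `ack k (p + 1) ≤ q + 1`. Index `i`
is counted for `p` but not for `q`. -/
theorem rankPot_drop {A k r p q : ℕ} (hk : k < A) (hrp : r ≤ p)
    (h : p + 1 < (ack k)^[r + 2] (r + 1)) (hq : ack k (p + 1) ≤ q + 1) :
    rankPot A r q < rankPot A r p := by
  have hpq : p ≤ q := by have := lt_ack_right k (p + 1); omega
  refine sum_lt_sum (fun k _ => card_le_card fun i hi => ?_) ⟨k, by simpa using hk, ?_⟩
  · simp only [mem_filter] at hi ⊢
    exact ⟨hi.1, by omega⟩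
  · have hex : ∃ i, p + 1 < (ack k)^[i + 1] (r + 1) := ⟨r + 1, h⟩
    classical
    set i := Nat.find hex with hi
    have hi1 : p + 1 < (ack k)^[i + 1] (r + 1) := Nat.find_spec hex
    have hi2 : i ≤ r + 1 := Nat.find_min' hex h
    have hi3 : (ack k)^[i] (r + 1) ≤ p + 1 := by
      rcases Nat.eq_zero_or_pos i with h0 | h0
      · rw [h0]; simpa using hrp
      · obtain ⟨j, hj⟩ : ∃ j, i = j + 1 := ⟨i - 1, by omega⟩
        rw [hj]
        exact not_lt.1 (Nat.find_min hex (m := j) (by omega))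
    refine card_lt_card ⟨fun j hj => ?_, fun hsub => ?_⟩
    · simp only [mem_filter] at hj ⊢
      exact ⟨hj.1, by omega⟩
    · have : i ∈ ({i ∈ range (r + 2) | q + 1 < (ack k)^[i + 1] (r + 1)} : Finset ℕ) :=
        hsub (by simp only [mem_filter, mem_range]; exact ⟨by omega, hi1⟩)
      have h2 := (mem_filter.1 this).2
      rw [Function.iterate_succ_apply'] at h2
      have h3 := ack_mono_right k hi3
      omega

/-- The level of a node that is not a root. -/
theorem exists_level {A r p : ℕ} (hrp : r < p) (hA : p + 1 < ack (A - 1) 1) :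
    ∃ k < A, p + 1 < (ack k)^[r + 2] (r + 1) ∧ ack k (r + 1) ≤ p + 1 := by
  -- For `A = 0` truncated subtraction turns the bound into `ack 0 1 = 2`, which contradicts `r <
  -- p`.
  have hA0 : 0 < A := by
    rcases Nat.eq_zero_or_pos A with h | h
    · subst h; simp at hA; omega
    · exact h
  have hmono : ∀ k n, Monotone ((ack k)^[n]) := fun k n => (ack_mono_right k).iterate n
  have hex : ∃ k, p + 1 < (ack k)^[r + 2] (r + 1) := by
    refine ⟨A - 1, hA.trans_le ?_⟩
    calc ack (A - 1) 1 = (ack (A - 1))^[0 + 1] 1 := rfl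
      _ ≤ (ack (A - 1))^[r + 1 + 1] 1 := by
        rw [Function.iterate_add_apply _ (r + 1) 1]
        exact Function.id_le_iterate_of_id_le (fun n => (lt_ack_right _ n).le) (r + 1) _
      _ ≤ _ := hmono _ _ (by omega)
  classical
  -- The level is the least admissible `k`. It is below `A` because `A - 1` is admissible.
  refine ⟨Nat.find hex, ?_, Nat.find_spec hex, ?_⟩
  · have : Nat.find hex ≤ A - 1 := by
      refine Nat.find_min' hex (hA.trans_le ?_)
      calc ack (A - 1) 1 = (ack (A - 1))^[0 + 1] 1 := rfl
        _ ≤ (ack (A - 1))^[r + 1 + 1] 1 := by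
          rw [Function.iterate_add_apply _ (r + 1) 1]
          exact Function.id_le_iterate_of_id_le (fun n => (lt_ack_right _ n).le) (r + 1) _
        _ ≤ _ := hmono _ _ (by omega)
    omega
  · rcases hk : Nat.find hex with _ | k
    · rw [ack_zero]; omega
    -- Minimality of the level `k + 1` bounds the iterate of `ack k` from `r + 1` by `p + 1`; the
    -- number `ack (k + 1) (r + 1)` is the same iterate started at `1`.
    · have := Nat.find_min hex (m := k) (by omega)
      rw [not_lt] at this
      refine le_trans ?_ this
      rw [ack_succ_eq_iterate]
      exact hmono _ _ (by omega)

/-- The potential of a forest. -/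
def ufPot (A : ℕ) (uf : UnionFind) : ℕ :=
  ∑ x ∈ range uf.size, rankPot A (uf.rank x) (uf.rank (uf.parent x))

theorem findD_of_not_lt {uf : UnionFind} {x : ℕ} (h : ¬ x < uf.size) : uf.findD x = (uf, x) := by
  simp [UnionFind.findD, h]

theorem findD_fst_of_lt {uf : UnionFind} {x : ℕ} (h : x < uf.size) :
    (uf.findD x).1 = (uf.find ⟨x, h⟩).1 := by
  simp [UnionFind.findD, h]

@[simp] theorem findD_snd (uf : UnionFind) (x : ℕ) : (uf.findD x).2 = uf.rootD x := by
  by_cases h : x < uf.size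
  · simp only [UnionFind.findD, h, dite_true]
    exact UnionFind.find_root_2 uf ⟨x, h⟩
  · simp [UnionFind.findD, UnionFind.rootD, h]

@[simp] theorem findD_size (uf : UnionFind) (x : ℕ) : (uf.findD x).1.arr.size = uf.arr.size := by
  by_cases h : x < uf.size
  · rw [findD_fst_of_lt h]; exact UnionFind.find_size uf ⟨x, h⟩
  · rw [findD_of_not_lt h]

@[simp] theorem findD_rootD (uf : UnionFind) (x i : ℕ) :
    (uf.findD x).1.rootD i = uf.rootD i := by
  by_cases h : x < uf.size
  · rw [findD_fst_of_lt h]; exact UnionFind.find_root_1 uf ⟨x, h⟩ i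
  · rw [findD_of_not_lt h]

theorem findD_rank (uf : UnionFind) (x i : ℕ) :
    (uf.findD x).1.rank i = uf.rank i := by
  by_cases h : x < uf.size
  · rw [findD_fst_of_lt h]; exact UnionFind.rankD_findAux
  · rw [findD_of_not_lt h]

theorem findD_parent_root {uf : UnionFind} {x : ℕ} (h : uf.parent x = x) (i : ℕ) :
    (uf.findD x).1.parent i = uf.parent i := by
  by_cases hx : x < uf.size
  · rw [findD_fst_of_lt hx]
    show UnionFind.parentD (uf.findAux ⟨x, hx⟩).s i = _
    rw [UnionFind.findAux_s, if_pos]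
    rwa [UnionFind.parent, UnionFind.parentD_eq hx] at h
  · rw [findD_of_not_lt hx]

/-- The recursion behind path compression: compress from the parent of `x`, then attach `x` to the
root. The amortized analysis follows this recursion. -/
theorem findD_parent {uf : UnionFind} {x : ℕ} (hx : x < uf.size) (i : ℕ) :
    (uf.findD x).1.parent i =
      if i = x then uf.rootD x else (uf.findD (uf.parent x)).1.parent i := by
  have hp : uf.parent x < uf.size := (uf.parent_lt x).2 hx
  rw [findD_fst_of_lt hx, findD_fst_of_lt hp]
  show UnionFind.parentD (uf.findAux ⟨x, hx⟩).s i = _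
  rw [UnionFind.parentD_findAux]
  have : (⟨_, uf.parent'_lt x hx⟩ : Fin uf.size) = ⟨uf.parent x, hp⟩ :=
    Fin.ext (UnionFind.parentD_eq hx).symm
  simp only [this]
  rfl

theorem ufDepth_root {uf : UnionFind} {x : ℕ} (h : uf.parent x = x) : ufDepth uf x = 0 := by
  rw [ufDepth]; simp [h]

theorem ufDepth_of_ne {uf : UnionFind} {x : ℕ} (h : uf.parent x ≠ x) :
    ufDepth uf x = ufDepth uf (uf.parent x) + 1 := by
  rw [ufDepth]; simp [h]

theorem parent_of_not_lt {uf : UnionFind} {x : ℕ} (h : ¬ x < uf.size) : uf.parent x = x :=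
  UnionFind.parentD_of_not_lt h

/-- Compression changes parents only on the path from `x` upwards, where no rank is below that of
`x`. -/
theorem findD_parent_of_rank_lt {uf : UnionFind} {i : ℕ} (x : ℕ) (h : uf.rank i < uf.rank x) :
    (uf.findD x).1.parent i = uf.parent i := by
  by_cases hr : uf.parent x = x
  · exact findD_parent_root hr i
  · have hx : x < uf.size := by by_contra hx; exact hr (parent_of_not_lt hx)
    have := Nat.sub_lt_sub_left (uf.lt_rankMax x) (uf.rank_lt hr)
    rw [findD_parent hx, if_neg (by rintro rfl; omega)]
    exact findD_parent_of_rank_lt (uf.parent x) (h.trans (uf.rank_lt hr))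
termination_by uf.rankMax - uf.rank x

/-- Induction along the path to the root. The set `S` collects the levels met from `x` upwards. A
node whose level occurs again higher up loses potential and so pays for its own parent pointer; the
others are at most as many as there are levels. The witness `y` is a higher node of level `k`,
recorded by the rank inequalities needed to prove this loss. -/
theorem findD_ufPot_aux (A : ℕ) (uf : UnionFind) (hA : ∀ x, uf.rank x + 1 < ack (A - 1) 1)
    (x : ℕ) : ∃ S : Finset ℕ, S ⊆ range A ∧
      ufDepth uf x + ufPot A (uf.findD x).1 ≤ ufPot A uf + #S ∧
      ∀ k ∈ S, ∃ y, uf.rank x ≤ uf.rank y ∧ ack k (uf.rank y + 1) ≤ uf.rank (uf.parent y) + 1 ∧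
        uf.rank (uf.parent y) ≤ uf.rank (uf.rootD x) := by
  have hpot : ∀ z, ufPot A (uf.findD z).1 =
      ∑ i ∈ range uf.size, rankPot A (uf.rank i) (uf.rank ((uf.findD z).1.parent i)) := by
    intro z
    simp only [ufPot, findD_rank, UnionFind.size, findD_size]
  by_cases hr : uf.parent x = x
  · refine ⟨∅, by simp, ?_, by simp⟩
    rw [hpot, ufDepth_root hr]
    simp [ufPot, findD_parent_root hr]
  · have hx : x < uf.size := by by_contra hx; exact hr (parent_of_not_lt hx)
    have hlt := uf.rank_lt hr
    have := Nat.sub_lt_sub_left (uf.lt_rankMax x) hlt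
    obtain ⟨S, hS, hle, hy⟩ := findD_ufPot_aux A uf hA (uf.parent x)
    rw [UnionFind.rootD_parent] at hy
    obtain ⟨k, hkA, hk1, hk2⟩ := exists_level hlt (hA _)
    have hroot : uf.rank (uf.parent x) ≤ uf.rank (uf.rootD x) := by
      rw [← UnionFind.rootD_parent]; exact UnionFind.le_rank_root
    have hmem : x ∈ range uf.size := mem_range.2 hx
    have e1 : ufPot A (uf.findD (uf.parent x)).1 =
        rankPot A (uf.rank x) (uf.rank (uf.parent x)) + ∑ i ∈ (range uf.size).erase x,
          rankPot A (uf.rank i) (uf.rank ((uf.findD (uf.parent x)).1.parent i)) := by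
      have h := add_sum_erase (range uf.size) (fun i => rankPot A (uf.rank i)
        (uf.rank ((uf.findD (uf.parent x)).1.parent i))) hmem
      beta_reduce at h
      rw [findD_parent_of_rank_lt _ hlt] at h
      exact (hpot _).trans h.symm
    have e2 : ufPot A (uf.findD x).1 =
        rankPot A (uf.rank x) (uf.rank (uf.rootD x)) + ∑ i ∈ (range uf.size).erase x,
          rankPot A (uf.rank i) (uf.rank ((uf.findD (uf.parent x)).1.parent i)) := by
      have h := add_sum_erase (range uf.size) (fun i => rankPot A (uf.rank i)
        (uf.rank ((uf.findD x).1.parent i))) hmem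
      beta_reduce at h
      rw [findD_parent hx, if_pos rfl] at h
      refine (hpot _).trans (h.symm.trans ?_)
      refine congrArg (rankPot A (uf.rank x) (uf.rank (uf.rootD x)) + ·)
        (sum_congr rfl fun i hi => ?_)
      rw [findD_parent hx, if_neg (ne_of_mem_erase hi)]
    have hanti := rankPot_anti A (uf.rank x) hroot
    rw [ufDepth_of_ne hr]
    by_cases hkS : k ∈ S
    · refine ⟨S, hS, ?_, fun k' hk' => ?_⟩
      -- The rank of `y` is at least that of the parent of `x`, so `ack k` of the parent's rank plus
      -- one is at most the root's rank plus one. Moving `x` to the root therefore lowers its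
      -- potential, which pays for the step.
      · obtain ⟨y, h1, h2, h3⟩ := hy k hkS
        have hd := rankPot_drop hkA hlt.le hk1 (q := uf.rank (uf.rootD x))
          ((ack_mono_right k (by omega)).trans (h2.trans (by omega)))
        omega
      · obtain ⟨y, h1, h2⟩ := hy k' hk'
        exact ⟨y, by omega, h2⟩
    · refine ⟨insert k S, ?_, ?_, fun k' hk' => ?_⟩
      · exact insert_subset (mem_range.2 hkA) hS
      · rw [card_insert_of_notMem hkS]; omega
      · rcases mem_insert.1 hk' with rfl | hk'
        · exact ⟨x, le_rfl, hk2, hroot⟩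
        · obtain ⟨y, h1, h2⟩ := hy k' hk'
          exact ⟨y, by omega, h2⟩
termination_by uf.rankMax - uf.rank x

/-- The amortized cost of `Find`. -/
theorem findD_ufPot (A : ℕ) (uf : UnionFind) (hA : ∀ x, uf.rank x + 1 < ack (A - 1) 1) (x : ℕ) :
    ufDepth uf x + ufPot A (uf.findD x).1 ≤ ufPot A uf + A := by
  obtain ⟨S, hS, h, -⟩ := findD_ufPot_aux A uf hA x
  have := card_le_card hS
  rw [card_range] at this
  omega

/-- The sum of `rank + 1` over the roots does not exceed the number of nodes. -/
def RankInv (uf : UnionFind) : Prop :=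
  ∑ x ∈ range uf.size, (if uf.parent x = x then uf.rank x + 1 else 0) ≤ uf.size

/-- The root above `x` alone contributes its rank plus one to the sum. This linear bound can take
the place of the logarithmic one, since the ranks are only compared with values of the Ackermann
function. -/
theorem RankInv.rank_lt {uf : UnionFind} (h : RankInv uf) {x : ℕ} (hx : x < uf.size) :
    uf.rank x + 1 ≤ uf.size := by
  have h1 : uf.rank x ≤ uf.rank (uf.rootD x) := UnionFind.le_rank_root
  have h2 : uf.rootD x ∈ range uf.size := mem_range.2 (UnionFind.rootD_lt.2 hx)
  have h3 := single_le_sum (f := fun x => if uf.parent x = x then uf.rank x + 1 else 0)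
    (fun _ _ => Nat.zero_le _) h2
  simp only [UnionFind.parent_rootD, if_true] at h3
  have h4 : _ ≤ _ := h
  omega

theorem rank_of_not_lt {uf : UnionFind} {x : ℕ} (h : ¬ x < uf.size) : uf.rank x = 0 := by
  simp only [UnionFind.rank, UnionFind.rankD]
  rw [dif_neg h]

theorem RankInv.rank_le {uf : UnionFind} (h : RankInv uf) (x : ℕ) : uf.rank x ≤ uf.size := by
  by_cases hx : x < uf.size
  · have := h.rank_lt hx; omega
  · rw [rank_of_not_lt hx]; omega

theorem RankInv.empty : RankInv UnionFind.empty := by simp [RankInv, UnionFind.size]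

theorem parent_findD_eq_self (uf : UnionFind) (x i : ℕ) :
    (uf.findD x).1.parent i = i ↔ uf.parent i = i := by
  rw [← UnionFind.rootD_eq_self, findD_rootD, UnionFind.rootD_eq_self]

theorem RankInv.findD {uf : UnionFind} (h : RankInv uf) (x : ℕ) : RankInv (uf.findD x).1 := by
  simp only [RankInv, UnionFind.size, findD_size, findD_rank, parent_findD_eq_self]
  exact h

theorem push_size (uf : UnionFind) : uf.push.arr.size = uf.arr.size + 1 := by simp

theorem RankInv.push {uf : UnionFind} (h : RankInv uf) : RankInv uf.push := by
  have h1 : uf.parent uf.arr.size = uf.arr.size := parent_of_not_lt (by simp)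
  have h2 : uf.rank uf.arr.size = 0 := rank_of_not_lt (by simp)
  simp only [RankInv, UnionFind.size, push_size, UnionFind.parent_push, UnionFind.rank_push,
    sum_range_succ, h1, h2, if_true] at h ⊢
  omega

theorem ufPot_push (A : ℕ) (uf : UnionFind) : ufPot A uf.push = ufPot A uf + A * 2 := by
  have h1 : uf.parent uf.arr.size = uf.arr.size := parent_of_not_lt (by simp)
  have h2 : uf.rank uf.arr.size = 0 := rank_of_not_lt (by simp)
  simp only [ufPot, UnionFind.size, push_size, UnionFind.parent_push, UnionFind.rank_push,
    sum_range_succ, h1, h2, rankPot_self]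

theorem ufPot_empty (A : ℕ) : ufPot A UnionFind.empty = 0 := by simp [ufPot, UnionFind.size]

end RMQ

/-! ### Linking and uniting sets -/

namespace RMQ

open Batteries Finset

theorem rank_link {uf : UnionFind} {x y : Fin uf.size} (yroot : uf.parent y = y) (i : ℕ) :
    (uf.link x y yroot).rank i =
      if x.1 ≠ y ∧ uf.rank x = uf.rank y ∧ i = y then uf.rank y + 1 else uf.rank i := by
  show UnionFind.rankD (UnionFind.linkAux uf.arr x y) i = _
  have hx : uf.rank x = uf.arr[x.1].rank := UnionFind.rankD_eq x.2
  have hy : uf.rank y = uf.arr[y.1].rank := UnionFind.rankD_eq y.2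
  dsimp only [UnionFind.linkAux]
  by_cases h1 : x.1 = y
  · simp [h1]
  · rw [if_neg h1]
    by_cases h2 : uf.arr[y.1].rank < uf.arr[x.1].rank
    · have h3 : ¬ (x.1 ≠ y ∧ uf.rank x = uf.rank y ∧ i = y) := by
        rintro ⟨-, h, -⟩; omega
      rw [if_pos h2, if_neg h3, UnionFind.rankD_set]
      split
      · next h => rw [← h, hy]
      · rfl
    · rw [if_neg h2]
      by_cases h3 : uf.arr[x.1].rank = uf.arr[y.1].rank
      · rw [if_pos h3, UnionFind.rankD_set]
        by_cases h4 : y.1 = i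
        · rw [if_pos h4, if_pos ⟨h1, by omega, h4.symm⟩, hy]
        · rw [if_neg h4, if_neg (fun h => h4 h.2.2.symm), UnionFind.rankD_set]
          split
          · next h => rw [← h, hx]
          · rfl
      · rw [if_neg h3, if_neg (by rintro ⟨-, h, -⟩; omega), UnionFind.rankD_set]
        split
        · next h => rw [← h, hx]
        · rfl

/-- Nodes that keep their rank can only see the rank of their parent grow, which does not raise
their potential. The rank of `y` alone may change, by one, while `y` stays a root; the potential `A
* (rank + 2)` of a root then grows by `A`. -/
theorem ufPot_link {uf : UnionFind} {x y : Fin uf.size} (A : ℕ) (xroot : uf.parent x = x)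
    (yroot : uf.parent y = y) : ufPot A (uf.link x y yroot) ≤ ufPot A uf + A := by
  have hsize : (uf.link x y yroot).size = uf.size := UnionFind.linkAux_size
  have key : ∀ i, rankPot A ((uf.link x y yroot).rank i)
      ((uf.link x y yroot).rank ((uf.link x y yroot).parent i)) ≤
      rankPot A (uf.rank i) (uf.rank (uf.parent i)) + if y.1 = i then A else 0 := by
    intro i
    by_cases h1 : x.1 = y
    · rw [rank_link, rank_link, UnionFind.parent_link]
      simp [h1]
    by_cases h2 : uf.rank y < uf.rank x
    · have hr : ∀ j, (uf.link x y yroot).rank j = uf.rank j := fun j => by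
        rw [rank_link, if_neg (by rintro ⟨-, h, -⟩; omega)]
      rw [hr, hr, UnionFind.parent_link, if_neg h1, if_pos h2]
      split
      · next h =>
        refine (rankPot_anti A _ ?_).trans (Nat.le_add_right _ _)
        rw [← h, yroot]; exact h2.le
      · exact Nat.le_add_right _ _
    · by_cases h3 : i = y
      · subst h3
        rw [UnionFind.parent_link, if_neg h1, if_neg h2, if_neg h1, yroot, rankPot_self,
          rankPot_self, if_pos rfl, rank_link]
        split <;> ring_nf <;> omega
      · have hr : (uf.link x y yroot).rank i = uf.rank i := by
          rw [rank_link, if_neg (fun h => h3 h.2.2)]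
        have hge : ∀ j, uf.rank j ≤ (uf.link x y yroot).rank j := fun j => by
          rw [rank_link]; split
          · next h => rw [h.2.2]; omega
          · exact le_rfl
        rw [hr, UnionFind.parent_link, if_neg h1, if_neg h2]
        refine (rankPot_anti A _ ?_).trans (Nat.le_add_right _ _)
        refine le_trans ?_ (hge _)
        split
        · next h => rw [← h, xroot]; omega
        · exact le_rfl
  calc ufPot A (uf.link x y yroot) ≤ ∑ i ∈ range uf.size,
        (rankPot A (uf.rank i) (uf.rank (uf.parent i)) + if y.1 = i then A else 0) := by
        rw [ufPot, hsize]; exact sum_le_sum fun i _ => key i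
    _ = _ := by
        rw [sum_add_distrib, sum_ite_eq, if_pos (mem_range.2 y.2)]; rfl

/-- When the rank of `y` grows by one, `x` ceases to be a root and gives up at least as much. -/
theorem RankInv.link {uf : UnionFind} (h : RankInv uf) {x y : Fin uf.size}
    (xroot : uf.parent x = x) (yroot : uf.parent y = y) : RankInv (uf.link x y yroot) := by
  have hsize : (uf.link x y yroot).size = uf.size := UnionFind.linkAux_size
  have h' : _ ≤ _ := h
  show ∑ i ∈ range (uf.link x y yroot).size, _ ≤ (uf.link x y yroot).size
  rw [hsize]
  by_cases h2 : uf.rank y < uf.rank x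
  · refine (sum_le_sum fun i _ => ?_).trans h'
    rw [rank_link, UnionFind.parent_link, if_pos h2,
      if_neg (show ¬ (x.1 ≠ y ∧ uf.rank x = uf.rank y ∧ i = y) by rintro ⟨-, h, -⟩; omega)]
    by_cases h1 : x.1 = y
    · rw [if_pos h1]
    · rw [if_neg h1]
      by_cases h3 : y.1 = i
      · rw [if_pos h3, ← h3, if_neg h1]; omega
      · rw [if_neg h3]
  -- The extra unit at `x` and the extra unit at `y` cancel after summation over all nodes.
  have key : ∀ i, (if (uf.link x y yroot).parent i = i then (uf.link x y yroot).rank i + 1 else 0) +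
      (if x.1 = i then 1 else 0) ≤
      (if uf.parent i = i then uf.rank i + 1 else 0) + if y.1 = i then 1 else 0 := by
    intro i
    rw [rank_link, UnionFind.parent_link, if_neg h2]
    by_cases h1 : x.1 = y
    · simp [h1]
    · rw [if_neg h1]
      by_cases h3 : x.1 = i
      · subst h3
        simp [Ne.symm h1, xroot]
      · rw [if_neg h3, if_neg h3]
        by_cases h4 : y.1 = i
        · subst h4
          simp only [yroot, if_true]
          split
          · next h => have := h.2.1; omega
          · omega
        · rw [if_neg (show ¬ (x.1 ≠ y ∧ uf.rank x = uf.rank y ∧ i = y) from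
            fun h => h4 h.2.2.symm), if_neg h4]
  have hs := sum_le_sum fun i (_ : i ∈ range uf.size) => key i
  rw [sum_add_distrib, sum_add_distrib, sum_ite_eq, sum_ite_eq, if_pos (mem_range.2 x.2),
    if_pos (mem_range.2 y.2)] at hs
  omega

/-- Uniting two sets is path compression from both elements followed by linking the roots. -/
theorem union_eq_link (uf : UnionFind) {t u : ℕ} (ht : t < uf.size) (hu : u < uf.size) :
    ∃ (hx : uf.rootD t < ((uf.findD t).1.findD u).1.size)
      (hy : uf.rootD u < ((uf.findD t).1.findD u).1.size)
      (hr : ((uf.findD t).1.findD u).1.parent (uf.rootD u) = uf.rootD u),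
      uf.union ⟨t, ht⟩ ⟨u, hu⟩ = ((uf.findD t).1.findD u).1.link ⟨_, hx⟩ ⟨_, hy⟩ hr := by
  have hx : uf.rootD t < ((uf.findD t).1.findD u).1.size := by
    simpa [UnionFind.size] using UnionFind.rootD_lt.2 ht
  have hy : uf.rootD u < ((uf.findD t).1.findD u).1.size := by
    simpa [UnionFind.size] using UnionFind.rootD_lt.2 hu
  have hr : ((uf.findD t).1.findD u).1.parent (uf.rootD u) = uf.rootD u := by
    rw [parent_findD_eq_self, parent_findD_eq_self, UnionFind.parent_rootD]
  refine ⟨hx, hy, hr, ?_⟩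
  have hu' : u < (uf.find ⟨t, ht⟩).1.size := by rw [UnionFind.find_size]; exact hu
  have e1 : ((uf.findD t).1.findD u).1 = ((uf.find ⟨t, ht⟩).1.find ⟨u, hu'⟩).1 := by
    rw [findD_fst_of_lt ht, findD_fst_of_lt hu']
  have e2 : (uf.find ⟨t, ht⟩).2.1.1 = uf.rootD t := UnionFind.find_root_2 uf ⟨t, ht⟩
  have e3 : ((uf.find ⟨t, ht⟩).1.find ⟨u, hu'⟩).2.1.1 = uf.rootD u := by
    rw [UnionFind.find_root_2, UnionFind.find_root_1]
  -- The forest becomes a variable so that the proofs on which `link` depends survive the rewriting.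
  have : ∀ (g : UnionFind) (hg : g = ((uf.find ⟨t, ht⟩).1.find ⟨u, hu'⟩).1)
      (hx : uf.rootD t < g.size) (hy : uf.rootD u < g.size)
      (hr : g.parent (uf.rootD u) = uf.rootD u),
      uf.union ⟨t, ht⟩ ⟨u, hu⟩ = g.link ⟨_, hx⟩ ⟨_, hy⟩ hr := by
    intro g hg
    subst hg
    rw [← e2]
    intro hx hy hr
    simp only [← e3]
    rfl
  exact this _ e1 hx hy hr

@[simp] theorem union_size (uf : UnionFind) (t u : Fin uf.size) :
    (uf.union t u).arr.size = uf.arr.size := by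
  obtain ⟨hx, hy, hr, h⟩ := union_eq_link uf t.2 u.2
  rw [show uf.union t u = _ from h]
  simp

theorem RankInv.union {uf : UnionFind} (h : RankInv uf) (t u : Fin uf.size) :
    RankInv (uf.union t u) := by
  obtain ⟨hx, hy, hr, e⟩ := union_eq_link uf t.2 u.2
  rw [show uf.union t u = _ from e]
  refine RankInv.link ((h.findD _).findD _) ?_ hr
  rw [parent_findD_eq_self, parent_findD_eq_self, UnionFind.parent_rootD]

/-- The amortized cost of uniting two sets. -/
theorem ufPot_union (A : ℕ) (uf : UnionFind) (hA : ∀ x, uf.rank x + 1 < ack (A - 1) 1)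
    (t u : Fin uf.size) :
    ufDepth uf t + ufDepth (uf.findD t).1 u + ufPot A (uf.union t u) ≤ ufPot A uf + 3 * A := by
  obtain ⟨hx, hy, hr, e⟩ := union_eq_link uf t.2 u.2
  rw [show uf.union t u = _ from e]
  have h1 := findD_ufPot A uf hA t
  have h2 := findD_ufPot A (uf.findD t).1 (by simpa only [findD_rank] using hA) u
  have h3 := ufPot_link (uf := ((uf.findD t).1.findD u).1) (x := ⟨_, hx⟩) (y := ⟨_, hy⟩) A
    (by rw [parent_findD_eq_self, parent_findD_eq_self, UnionFind.parent_rootD]) hr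
  omega

/-- Which of the two roots survives depends on the ranks; the sequel needs only that it is one of
them. -/
theorem union_rootD (uf : UnionFind) (t u : Fin uf.size) :
    ∃ r, (r = uf.rootD t ∨ r = uf.rootD u) ∧ ∀ i, (uf.union t u).rootD i =
      if uf.rootD i = uf.rootD t ∨ uf.rootD i = uf.rootD u then r else uf.rootD i := by
  obtain ⟨hx, hy, hr, e⟩ := union_eq_link uf t.2 u.2
  rw [show uf.union t u = _ from e]
  obtain ⟨r, h1, h2⟩ := UnionFind.root_link (self := ((uf.findD t).1.findD u).1)
    (x := ⟨_, hx⟩) (y := ⟨_, hy⟩)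
    (by rw [parent_findD_eq_self, parent_findD_eq_self, UnionFind.parent_rootD]) hr
  refine ⟨r, ?_, fun i => ?_⟩
  · rcases h1 with rfl | rfl
    · exact .inl rfl
    · exact .inr rfl
  · rw [h2 i]; simp only [findD_rootD]

end RMQ

namespace RMQ

open Batteries Finset MeasureTheory

/-! ## Expected values of random times -/

section Avg

variable {Ω : Type*} [MeasurableSpace Ω] {P : Measure Ω}

/-- The random number `f` has a measurable upper bound whose expectation is at most `b`. -/
def Avg (P : Measure Ω) (f : Ω → ℕ) (b : ℕ) : Prop :=
  ∃ g : Ω → ENNReal, Measurable g ∧ (∀ ω, (f ω : ENNReal) ≤ g ω) ∧ ∫⁻ ω, g ω ∂P ≤ b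

theorem Avg.mono {f f' : Ω → ℕ} {b b' : ℕ} (h : Avg P f b) (hf : ∀ ω, f' ω ≤ f ω) (hb : b ≤ b') :
    Avg P f' b' := by
  obtain ⟨g, hg, hfg, hgb⟩ := h
  exact ⟨g, hg, fun ω => (Nat.cast_le.2 (hf ω)).trans (hfg ω), hgb.trans (Nat.cast_le.2 hb)⟩

/-- The integral of a sum is split by means of the measurable bounds. This is the reason for `g` in
`Avg`: no measurability of the running times themselves has to be shown. -/
theorem Avg.add {f f' : Ω → ℕ} {b b' : ℕ} (h : Avg P f b) (h' : Avg P f' b') :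
    Avg P (fun ω => f ω + f' ω) (b + b') := by
  obtain ⟨g, hg, hfg, hgb⟩ := h
  obtain ⟨g', hg', hfg', hgb'⟩ := h'
  refine ⟨fun ω => g ω + g' ω, hg.add hg', fun ω => ?_, ?_⟩
  · push_cast; exact add_le_add (hfg ω) (hfg' ω)
  · rw [lintegral_add_left hg]; push_cast; exact add_le_add hgb hgb'

theorem Avg.const [IsProbabilityMeasure P] (b : ℕ) : Avg P (fun _ => b) b :=
  ⟨fun _ => b, measurable_const, fun _ => le_rfl, by simp⟩

theorem Avg.add_const [IsProbabilityMeasure P] {f : Ω → ℕ} {b : ℕ} (h : Avg P f b) (c : ℕ) :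
    Avg P (fun ω => f ω + c) (b + c) :=
  h.add (Avg.const c)

/-- Cancels the potential of an intermediate state when the bounds of consecutive operations are
added. The bound `g` is at least `c` everywhere, so nothing is lost by truncated subtraction. -/
theorem Avg.of_add_const [IsProbabilityMeasure P] {f : Ω → ℕ} {b c : ℕ}
    (h : Avg P (fun ω => f ω + c) (b + c)) : Avg P f b := by
  obtain ⟨g, hg, hfg, hgb⟩ := h
  have hc : ∀ ω, (f ω : ENNReal) + c ≤ g ω := fun ω => by simpa using hfg ω
  refine ⟨fun ω => g ω - c, hg.sub_const _,
    fun ω => ENNReal.le_sub_of_add_le_right (by simp) (hc ω), ?_⟩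
  have h1 : ∫⁻ ω, g ω ∂P = ∫⁻ ω, (g ω - c) ∂P + c := by
    calc ∫⁻ ω, g ω ∂P = ∫⁻ ω, (g ω - c + c) ∂P := lintegral_congr fun ω =>
          (tsub_add_cancel_of_le (le_add_self.trans (hc ω))).symm
      _ = _ := by rw [lintegral_add_right _ measurable_const]; simp
  rw [h1] at hgb
  push_cast at hgb
  exact (ENNReal.add_le_add_iff_right (by simp)).1 hgb

theorem Avg.lintegral_le {f : Ω → ℕ} {b : ℕ} (h : Avg P f b) :
    ∫⁻ ω, (f ω : ENNReal) ∂P ≤ b := by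
  obtain ⟨g, -, hfg, hgb⟩ := h
  exact (lintegral_mono hfg).trans hgb

/-- Random hash functions for a table for `a` elements. -/
structure UnivHash (P : Measure Ω) (h : Ω → ℕ → ℕ) (a : ℕ) : Prop where
  measurable : ∀ x, Measurable fun ω => h ω x
  collision : ∀ x y, x ≠ y → P {ω | h ω x = h ω y} ≤ (buckets a : ENNReal)⁻¹

theorem IsUniversal.univHash {H : Ω → Hashing} (hH : IsUniversal P H) (s a : ℕ) :
    UnivHash P (fun ω => H ω s (buckets a)) a :=
  ⟨fun x => hH.measurable s _ x, fun x y h => hH.collision s _ x y (by simp [buckets]) h⟩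

/-- The expected number of keys, other than `x`, in the bucket of `x`. -/
theorem UnivHash.avg_card {h : Ω → ℕ → ℕ} {a : ℕ} (hh : UnivHash P h a) (S : Finset ℕ)
    (hS : #S ≤ a) (x : ℕ) (hx : x ∉ S) : Avg P (fun ω => #{y ∈ S | h ω y = h ω x}) 1 := by
  have hm : ∀ y, MeasurableSet {ω | h ω y = h ω x} := fun y =>
    measurableSet_eq_fun (hh.measurable y) (hh.measurable x)
  refine ⟨fun ω => ∑ y ∈ S, Set.indicator {ω | h ω y = h ω x} 1 ω, ?_, fun ω => ?_, ?_⟩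
  · exact Finset.measurable_sum _ fun y _ => measurable_one.indicator (hm y)
  · show ((#{y ∈ S | h ω y = h ω x} : ℕ) : ENNReal) ≤ _
    rw [card_filter]
    push_cast
    exact sum_le_sum fun y _ => by simp [Set.indicator]
  · rw [lintegral_finsetSum _ fun y _ => measurable_one.indicator (hm y)]
    calc ∑ y ∈ S, ∫⁻ ω, Set.indicator {ω | h ω y = h ω x} 1 ω ∂P
        ≤ ∑ y ∈ S, (buckets a : ENNReal)⁻¹ := sum_le_sum fun y hy => by
          rw [lintegral_indicator_one (hm y)]
          exact hh.collision y x (by rintro rfl; exact hx hy)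
      _ = #S * (buckets a : ENNReal)⁻¹ := by simp
      -- The load `a / (2 * a + 1)` is estimated by `1`.
      _ ≤ buckets a * (buckets a : ENNReal)⁻¹ := by
          gcongr
          have : #S ≤ buckets a := by simp only [buckets]; omega
          exact_mod_cast this
      _ = 1 := ENNReal.mul_inv_cancel (by simp [buckets]) (by simp)
      _ = _ := by simp

end Avg

namespace Struct

variable {V : Type*}

/-! ## Structures up to the choice of the hash function -/

/-- The structure with the same contents, hashed by `h`. -/
def rehash (T : Struct V) (h : ℕ → ℕ) : Struct V :=
  { T with
    hash := h
    chain := fun b => (List.range T.size).reverse.filter fun t => h (T.key t) = b }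

theorem scan_snd_le (key : ℕ → ℕ) (x : ℕ) (l : List ℕ) : (scan key x l).2 ≤ l.length + 1 := by
  induction l with
  | nil => simp [scan]
  | cons t l ih => rw [scan]; split <;> simp; omega

theorem scan_fst_of_forall {key : ℕ → ℕ} {x : ℕ} {l : List ℕ} (h : ∀ t ∈ l, key t ≠ x) :
    (scan key x l).1 = none := by
  induction l with
  | nil => simp [scan]
  | cons t l ih =>
    rw [scan, if_neg (h t (by simp))]
    exact ih fun u hu => h u (by simp [hu])

theorem scan_fst_of_mem {key : ℕ → ℕ} {x t : ℕ} {l : List ℕ} (ht : t ∈ l) (hx : key t = x)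
    (h : ∀ u ∈ l, key u = x → u = t) : (scan key x l).1 = some t := by
  induction l with
  | nil => simp at ht
  | cons u l ih =>
    rw [scan]
    split
    · next hu => rw [h u (by simp) hu]
    · next hu =>
      refine ih ?_ fun w hw => h w (by simp [hw])
      rcases List.mem_cons.1 ht with rfl | ht
      · exact absurd hx hu
      · exact ht

/-- The elements are consistent: the keys increase, and the counters are correct. -/
structure Wf (T : Struct V) : Prop where
  key_lt : ∀ t u, t < u → u < T.size → T.key t < T.key u
  key_pos : ∀ t < T.size, 0 < T.key t
  count_eq : T.count = #{t ∈ range T.size | T.live t = true}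
  lt_minPos : ∀ i : ℕ, (i : WithTop ℕ) < T.minPos ↔ ∀ t < T.size, i < T.key t
  rankInv : RankInv T.uf

theorem Wf.key_inj {T : Struct V} (hT : T.Wf) {t u : ℕ} (ht : t < T.size) (hu : u < T.size)
    (h : T.key t = T.key u) : t = u := by
  rcases lt_trichotomy t u with h1 | h1 | h1
  · have := hT.key_lt t u h1 hu; omega
  · exact h1
  · have := hT.key_lt u t h1 ht; omega

theorem lookup_of_mem {T : Struct V} (hT : T.Wf) {t : ℕ} (ht : t < T.size) (h : ℕ → ℕ) :
    ((T.rehash h).lookup (T.key t)).1 = some t := by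
  refine scan_fst_of_mem ?_ rfl fun u hu h' => ?_
  · simp [rehash, ht]
  · simp [rehash] at hu
    exact hT.key_inj hu.1 ht h'

theorem lookup_of_forall {T : Struct V} {x : ℕ} (hx : ∀ t < T.size, T.key t ≠ x) (h : ℕ → ℕ) :
    ((T.rehash h).lookup x).1 = none := by
  refine scan_fst_of_forall fun t ht => ?_
  simp [rehash] at ht
  exact hx t ht.1

/-- The expected time of a search. -/
theorem avg_lookup {Ω : Type*} [MeasurableSpace Ω] {P : Measure Ω} [IsProbabilityMeasure P]
    {hs : Ω → ℕ → ℕ} {a : ℕ} (hh : UnivHash P hs a) {T : Struct V} (hT : T.Wf)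
    (hsz : T.size ≤ a) (x : ℕ) : Avg P (fun ω => ((T.rehash (hs ω)).lookup x).2) 3 := by
  have hinj : Set.InjOn T.key (range T.size) := fun t ht u hu h =>
    hT.key_inj (by simpa using ht) (by simpa using hu) h
  -- A search costs at most the length of the chain plus one. The chain contains `x` at most once
  -- and on average at most one other key, whence `1 + 2 = 3`.
  have h1 := (hh.avg_card (((range T.size).image T.key).erase x)
    ((card_erase_le.trans card_image_le).trans (by simpa using hsz)) x (by simp)).add_const 2
  refine h1.mono (fun ω => ?_) le_rfl
  refine (scan_snd_le _ _ _).trans ?_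
  have h2 : ((List.range T.size).reverse.filter fun t => hs ω (T.key t) = hs ω x).length =
      #{t ∈ range T.size | hs ω (T.key t) = hs ω x} := by
    rw [← List.toFinset_card_of_nodup]
    · congr 1; ext t; simp
    · exact (List.nodup_reverse.2 List.nodup_range).filter _
  have h3 : #{t ∈ range T.size | hs ω (T.key t) = hs ω x} =
      #{y ∈ (range T.size).image T.key | hs ω y = hs ω x} := by
    rw [filter_image, card_image_of_injOn]
    exact hinj.mono (by intro t; simp; tauto)
  have h4 : #{y ∈ (range T.size).image T.key | hs ω y = hs ω x} ≤
      #{y ∈ ((range T.size).image T.key).erase x | hs ω y = hs ω x} + 1 := by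
    rw [filter_erase]
    have := pred_card_le_card_erase (a := x)
      (s := {y ∈ (range T.size).image T.key | hs ω y = hs ω x})
    omega
  show ((List.range T.size).reverse.filter fun t => hs ω (T.key t) = hs ω x).length + 1 ≤ _
  omega

/-- The stack level of an element. -/
def lev (T : Struct V) (t : ℕ) : ℕ := T.label (T.uf.rootD t)

/-- The stack value of an element. -/
def elemVal (T : Struct V) (t : ℕ) : Val V := (T.stack (T.lev t)).val

/-- The structure after a search with path compression. -/
def findS (T : Struct V) (t : ℕ) : Struct V := { T with uf := (T.uf.findD t).1 }

@[simp] theorem findS_size (T : Struct V) (t : ℕ) : (T.findS t).size = T.size :=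
  findD_size T.uf t

theorem rehash_find (T : Struct V) (h : ℕ → ℕ) (t : ℕ) :
    (T.rehash h).find t = ((T.findS t).rehash h, T.uf.rootD t, ufDepth T.uf t + 1) := by
  have := findS_size T t
  simp only [find, rehash, findD_snd]
  rw [this]
  rfl

theorem Wf.rank_lt_ack {T : Struct V} (hT : T.Wf) {A a : ℕ} (hsz : T.size ≤ a)
    (hA : a + 1 < ack (A - 1) 1) (x : ℕ) : T.uf.rank x + 1 < ack (A - 1) 1 := by
  have h1 : T.uf.rank x ≤ T.size := hT.rankInv.rank_le x
  omega

/-- The elements of `T'` are those of `T`. -/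
structure Keeps (T T' : Struct V) : Prop where
  cap : T'.cap = T.cap
  size : T'.size = T.size
  key : T'.key = T.key
  live : T'.live = T.live
  count : T'.count = T.count
  minPos : T'.minPos = T.minPos

theorem Keeps.refl (T : Struct V) : Keeps T T := ⟨rfl, rfl, rfl, rfl, rfl, rfl⟩

theorem Keeps.trans {T T' T'' : Struct V} (h : Keeps T T') (h' : Keeps T' T'') : Keeps T T'' :=
  ⟨h'.cap.trans h.cap, h'.size.trans h.size, h'.key.trans h.key, h'.live.trans h.live,
    h'.count.trans h.count, h'.minPos.trans h.minPos⟩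

theorem Keeps.wf {T T' : Struct V} (h : Keeps T T') (hT : T.Wf) (hr : RankInv T'.uf) : T'.Wf where
  key_lt := by rw [h.key, h.size]; exact hT.key_lt
  key_pos := by rw [h.key, h.size]; exact hT.key_pos
  count_eq := by rw [h.count, h.live, h.size]; exact hT.count_eq
  lt_minPos := by rw [h.key, h.minPos, h.size]; exact hT.lt_minPos
  rankInv := hr

theorem findS_keeps (T : Struct V) (t : ℕ) : Keeps T (T.findS t) :=
  ⟨rfl, findS_size T t, rfl, rfl, rfl, rfl⟩

theorem Wf.findS {T : Struct V} (hT : T.Wf) (t : ℕ) : (T.findS t).Wf :=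
  (findS_keeps T t).wf hT (hT.rankInv.findD t)

/-- The structure after uniting two sets. -/
def uniteS (T : Struct V) (t u k : ℕ) : Struct V := (T.unite t u k).1

/-- The new label is written at the surviving root `r`, so the levels are known without knowing
which root survives; the label at the other one is never read again. -/
theorem unite_spec {T : Struct V} {t u : ℕ} (ht : t < T.size) (hu : u < T.size) (k : ℕ) :
    ∃ r, (r = T.uf.rootD t ∨ r = T.uf.rootD u) ∧
      (T.uniteS t u k) = { T with
        uf := T.uf.union ⟨t, ht⟩ ⟨u, hu⟩, label := Function.update T.label r k } ∧
      (∀ i, (T.uniteS t u k).uf.rootD i =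
        if T.uf.rootD i = T.uf.rootD t ∨ T.uf.rootD i = T.uf.rootD u then r else T.uf.rootD i) ∧
      (∀ i, (T.uniteS t u k).lev i =
        if T.uf.rootD i = T.uf.rootD t ∨ T.uf.rootD i = T.uf.rootD u then k else T.lev i) := by
  obtain ⟨r, hr, hi⟩ := union_rootD T.uf ⟨t, ht⟩ ⟨u, hu⟩
  have hrt : (T.uf.union ⟨t, ht⟩ ⟨u, hu⟩).rootD t = r := by rw [hi t, if_pos (.inl rfl)]
  have e : (T.uniteS t u k) = { T with
        uf := T.uf.union ⟨t, ht⟩ ⟨u, hu⟩, label := Function.update T.label r k } := by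
    rw [uniteS, unite, dif_pos ⟨ht, hu⟩, ← hrt]
  refine ⟨r, hr, e, fun i => by rw [e]; exact hi i, fun i => ?_⟩
  rw [lev, e]
  simp only [hi i, lev]
  by_cases hc : T.uf.rootD i = T.uf.rootD t ∨ T.uf.rootD i = T.uf.rootD u
  · simp [hc]
  · rw [if_neg hc, if_neg hc, Function.update_of_ne]
    rintro rfl
    exact hc hr

theorem uniteS_keeps {T : Struct V} {t u : ℕ} (ht : t < T.size) (hu : u < T.size) (k : ℕ) :
    Keeps T (T.uniteS t u k) := by
  obtain ⟨r, -, e, -⟩ := unite_spec ht hu k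
  rw [e]
  exact ⟨rfl, union_size _ _ _, rfl, rfl, rfl, rfl⟩

theorem uniteS_wf {T : Struct V} (hT : T.Wf) {t u : ℕ} (ht : t < T.size) (hu : u < T.size) (k : ℕ) :
    (T.uniteS t u k).Wf := by
  refine (uniteS_keeps ht hu k).wf hT ?_
  obtain ⟨r, -, e, -⟩ := unite_spec ht hu k
  rw [e]
  exact hT.rankInv.union _ _

theorem uniteS_stack {T : Struct V} {t u : ℕ} (ht : t < T.size) (hu : u < T.size) (k : ℕ) :
    (T.uniteS t u k).stack = T.stack ∧ (T.uniteS t u k).top = T.top := by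
  obtain ⟨r, -, e, -⟩ := unite_spec ht hu k
  rw [e]
  exact ⟨rfl, rfl⟩

theorem rehash_unite {T : Struct V} {t u : ℕ} (ht : t < T.size) (hu : u < T.size) (k : ℕ)
    (h : ℕ → ℕ) : (T.rehash h).unite t u k =
      ((T.uniteS t u k).rehash h, ufDepth T.uf t + ufDepth (T.uf.findD t).1 u + 3) := by
  rw [unite, uniteS, unite, dif_pos ⟨ht, hu⟩, dif_pos ⟨ht, hu⟩]
  have hsz : (T.uf.union ⟨t, ht⟩ ⟨u, hu⟩).arr.size = T.uf.arr.size := union_size _ _ _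
  refine Prod.ext ?_ ?_
  · simp only [rehash, size, UnionFind.size, hsz]
  · simp only [rehash]; omega

theorem uniteS_cost {T : Struct V} (hT : T.Wf) {A a : ℕ} (hsz : T.size ≤ a)
    (hA : a + 1 < ack (A - 1) 1) {t u : ℕ} (ht : t < T.size) (hu : u < T.size) (k : ℕ) :
    ufDepth T.uf t + ufDepth (T.uf.findD t).1 u + ufPot A (T.uniteS t u k).uf ≤
      ufPot A T.uf + 3 * A := by
  obtain ⟨r, -, e, -⟩ := unite_spec ht hu k
  rw [e]
  exact ufPot_union A T.uf (hT.rank_lt_ack hsz hA) ⟨t, ht⟩ ⟨u, hu⟩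

theorem findS_cost {T : Struct V} (hT : T.Wf) {A a : ℕ} (hsz : T.size ≤ a)
    (hA : a + 1 < ack (A - 1) 1) (t : ℕ) :
    ufDepth T.uf t + ufPot A (T.findS t).uf ≤ ufPot A T.uf + A :=
  findD_ufPot A T.uf (hT.rank_lt_ack hsz hA) t

theorem insert_size (T : Struct V) (x k : ℕ) : (T.insert x k).size = T.size + 1 :=
  push_size T.uf

theorem rootD_size (T : Struct V) : T.uf.rootD T.size = T.size :=
  UnionFind.rootD_eq_self.2 (parent_of_not_lt (by simp [size]))

/-- The new node has the largest number and goes to the head of its chain. For this reason `rehash`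
lists the nodes in decreasing order. -/
theorem rehash_insert (T : Struct V) (x k : ℕ) (h : ℕ → ℕ) :
    (T.rehash h).insert x k = (T.insert x k).rehash h := by
  have hsz := insert_size T x k
  have hk1 : (T.insert x k).key T.size = x := Function.update_self ..
  have hk2 : ∀ t < T.size, (T.insert x k).key t = T.key t := fun t ht =>
    Function.update_of_ne (by omega) ..
  have hc : Function.update (T.rehash h).chain (h x) (T.size :: (T.rehash h).chain (h x)) =
      ((T.insert x k).rehash h).chain := by
    funext b
    have e : ((T.insert x k).rehash h).chain b = (List.range (T.insert x k).size).reverse.filter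
      fun t => h ((T.insert x k).key t) = b := rfl
    have hf : (List.range T.size).reverse.filter (fun t => h ((T.insert x k).key t) = b) =
        (T.rehash h).chain b := by
      refine List.filter_congr fun t ht => ?_
      rw [List.mem_reverse, List.mem_range] at ht
      rw [hk2 t ht]
    rw [e, hsz, List.range_succ, List.reverse_append, List.reverse_singleton,
      List.singleton_append, List.filter_cons, hf, hk1]
    by_cases hb : h x = b
    · subst hb; simp
    · simp [hb, Function.update_of_ne (Ne.symm hb)]
  show ({ T.insert x k with
    hash := h
    chain := Function.update (T.rehash h).chain (h x) (T.size :: (T.rehash h).chain (h x)) } :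
      Struct V) = _
  rw [hc]
  rfl

theorem insert_lev (T : Struct V) (x k t : ℕ) :
    (T.insert x k).lev t = if T.uf.rootD t = T.size then k else T.lev t := by
  simp only [lev, insert, UnionFind.root_push, Function.update_apply]

theorem insert_lev_of_lt (T : Struct V) (x k : ℕ) {t : ℕ} (ht : t < T.size) :
    (T.insert x k).lev t = T.lev t := by
  rw [insert_lev, if_neg]
  have : T.uf.rootD t < T.size := UnionFind.rootD_lt.2 ht
  omega

theorem insert_lev_size (T : Struct V) (x k : ℕ) : (T.insert x k).lev T.size = k := by
  rw [insert_lev, if_pos (rootD_size T)]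

theorem Wf.insert {T : Struct V} (hT : T.Wf) {x : ℕ} (k : ℕ) (hx : 0 < x)
    (hlt : ∀ t < T.size, T.key t < x) : (T.insert x k).Wf where
  key_lt t u htu hu := by
    rw [insert_size] at hu
    simp only [Struct.insert]
    rw [Function.update_of_ne (by omega)]
    rcases Nat.lt_succ_iff_lt_or_eq.1 hu with h | rfl
    · rw [Function.update_of_ne (by omega)]; exact hT.key_lt t u htu h
    · rw [Function.update_self]; exact hlt t htu
  key_pos t ht := by
    rw [insert_size] at ht
    simp only [Struct.insert]
    rcases Nat.lt_succ_iff_lt_or_eq.1 ht with h | rfl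
    · rw [Function.update_of_ne (by omega)]; exact hT.key_pos t h
    · rw [Function.update_self]; exact hx
  count_eq := by
    have h1 : (T.insert x k).live T.size = true := Function.update_self ..
    have h2 : {t ∈ range T.size | (T.insert x k).live t = true} =
        {t ∈ range T.size | T.live t = true} := filter_congr fun t ht => by
      rw [show (T.insert x k).live t = T.live t from
        Function.update_of_ne (by have := mem_range.1 ht; omega) ..]
    rw [insert_size, range_add_one, filter_insert, if_pos h1, h2,
      card_insert_of_notMem (by simp), ← hT.count_eq]
    rfl
  lt_minPos i := by
    rw [insert_size]
    simp only [Struct.insert, lt_min_iff, hT.lt_minPos]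
    constructor
    · rintro ⟨h1, h2⟩ t ht
      rcases Nat.lt_succ_iff_lt_or_eq.1 ht with h | rfl
      · rw [Function.update_of_ne (by omega)]; exact h1 t h
      · rw [Function.update_self]; exact_mod_cast h2
    · intro h
      refine ⟨fun t ht => ?_, ?_⟩
      · have := h t (by omega)
        rwa [Function.update_of_ne (by omega)] at this
      · have := h T.size (by omega)
        rw [Function.update_self] at this
        exact_mod_cast this
  rankInv := hT.rankInv.push

end Struct

end RMQ

/-! ### The stack of an active structure and one round of popping -/

namespace RMQ

open Batteries Finset MeasureTheory

namespace Struct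

variable {V : Type*}

theorem lookup_eq_some {T : Struct V} (hT : T.Wf) {t x : ℕ} (ht : t < T.size) (hx : T.key t = x)
    (h : ℕ → ℕ) : (T.rehash h).lookup x = (some t, ((T.rehash h).lookup x).2) :=
  Prod.ext (by subst hx; exact lookup_of_mem hT ht h) rfl

theorem lookup_eq_none {T : Struct V} {x : ℕ} (hx : ∀ t < T.size, T.key t ≠ x) (h : ℕ → ℕ) :
    (T.rehash h).lookup x = (none, ((T.rehash h).lookup x).2) :=
  Prod.ext (lookup_of_forall hx h) rfl

/-- The stack of an active structure is consistent with the sets of positions. -/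
structure Act (T : Struct V) [LT V] : Prop where
  top_ge : 2 ≤ T.top
  lev_mem : ∀ t < T.size, 2 ≤ T.lev t ∧ T.lev t ≤ T.top
  sep : ∀ t u, t < T.size → u < T.size → T.lev t = T.lev u → T.uf.rootD t = T.uf.rootD u
  ptr : ∀ k, 2 ≤ k → k ≤ T.top → ((T.stack k).ptr = 0 ∧ ∀ t < T.size, T.lev t ≠ k) ∨
    ∃ t < T.size, T.key t = (T.stack k).ptr ∧ T.lev t = k
  bot : (T.stack 1).val = ⊥
  mono : ∀ k, 1 ≤ k → k < T.top → (T.stack k).val < (T.stack (k + 1)).val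

theorem lev_eq_of_rootD_eq {T : Struct V} {t u : ℕ} (h : T.uf.rootD t = T.uf.rootD u) :
    T.lev t = T.lev u := by rw [lev, h, lev]

/-- The part common to all cases of `uniteTop`: the elements of the top level fall to the level
below and nothing else moves. Only the separation of the sets and the pointer of the new top item
depend on the case. -/
theorem Act.of_pop [LT V] {T T' : Struct V} (hA : T.Act) (h3 : 3 ≤ T.top) (hk : Keeps T T')
    (hv : ∀ k, (T'.stack k).val = (T.stack k).val)
    (hl : ∀ t < T.size, T'.lev t = min (T.lev t) (T.top - 1))
    (hs : ∀ t u, t < T.size → u < T.size → T'.lev t = T'.lev u → T'.uf.rootD t = T'.uf.rootD u)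
    (hp : ∀ k < T.top - 1, (T'.stack k).ptr = (T.stack k).ptr)
    (hq : ((T'.stack (T.top - 1)).ptr = 0 ∧ ∀ t < T.size, T'.lev t ≠ T.top - 1) ∨
      ∃ t < T.size, T.key t = (T'.stack (T.top - 1)).ptr ∧ T'.lev t = T.top - 1) :
    ({ T' with top := T.top - 1 } : Struct V).Act where
  top_ge := by show 2 ≤ T.top - 1; omega
  lev_mem t ht := by
    have ht' : t < T.size := hk.size ▸ ht
    show 2 ≤ T'.lev t ∧ T'.lev t ≤ T.top - 1
    have := hA.lev_mem t ht'
    rw [hl t ht']; omega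
  sep t u ht hu := hs t u (hk.size ▸ ht) (hk.size ▸ hu)
  ptr k h2 hkt := by
    show ((T'.stack k).ptr = 0 ∧ ∀ t < T'.size, T'.lev t ≠ k) ∨
      ∃ t < T'.size, T'.key t = (T'.stack k).ptr ∧ T'.lev t = k
    rw [hk.size, hk.key]
    have hkt : k ≤ T.top - 1 := hkt
    rcases hkt.eq_or_lt with rfl | hlt
    · exact hq
    · rw [hp k hlt]
      rcases hA.ptr k h2 (by omega) with ⟨h0, h⟩ | ⟨t, ht, h1, h4⟩
      · refine .inl ⟨h0, fun t ht => ?_⟩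
        have := h t ht
        rw [hl t ht]; omega
      · exact .inr ⟨t, ht, h1, by rw [hl t ht]; omega⟩
  bot := (hv 1).trans hA.bot
  mono k h1 hkt := by
    show (T'.stack k).val < (T'.stack (k + 1)).val
    have hkt : k < T.top - 1 := hkt
    rw [hv, hv]
    exact hA.mono k h1 (by omega)

/-- Three cases. If the top item has no positions, nothing is to be done; if only the item below has
none, the set is relabelled and its pointer handed down; otherwise the two sets are united. The last
case is the most expensive: two searches and a union, `3 + 3 + (3 * A + 3)`. -/
theorem uniteTop_spec [LT V] {T : Struct V} (hT : T.Wf) (hA : T.Act) (h3 : 3 ≤ T.top) :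
    ∃ T' : Struct V, (∀ h, ((T.rehash h).uniteTop).1 = T'.rehash h) ∧ T'.Wf ∧ Keeps T T' ∧
      ({ T' with top := T.top - 1 } : Struct V).Act ∧ T'.top = T.top ∧
      (∀ k, (T'.stack k).val = (T.stack k).val) ∧
      (∀ t < T.size, T'.lev t = min (T.lev t) (T.top - 1)) ∧
      ∀ {Ω : Type*} [MeasurableSpace Ω] (P : Measure Ω) [IsProbabilityMeasure P]
        (hs : Ω → ℕ → ℕ) (a A : ℕ), UnivHash P hs a → T.size ≤ a → a + 1 < ack (A - 1) 1 →
        Avg P (fun ω => ((T.rehash (hs ω)).uniteTop).2 + ufPot A T'.uf)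
          (ufPot A T.uf + (3 * A + 9)) := by
  have e1 : ∀ h, (T.rehash h).stack = T.stack := fun _ => rfl
  have e2 : ∀ h, (T.rehash h).top = T.top := fun _ => rfl
  rcases hA.ptr T.top (by omega) le_rfl with ⟨hp, hno⟩ | ⟨t, ht, htp, htl⟩
  · have e : ∀ h, (T.rehash h).uniteTop = (T.rehash h, 1) := fun h => by
      simp only [uniteTop, e1, e2, hp, if_true]
    have hl : ∀ t < T.size, T.lev t = min (T.lev t) (T.top - 1) := fun t ht => by
      have h1 := hno t ht
      have h2 := hA.lev_mem t ht
      omega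
    refine ⟨T, fun h => by rw [e], hT, Keeps.refl T, ?_, rfl, fun _ => rfl, hl, ?_⟩
    · exact Act.of_pop hA h3 (Keeps.refl T) (fun _ => rfl) hl hA.sep (fun _ _ => rfl)
        (hA.ptr _ (by omega) (by omega))
    · intro Ω _ P _ hs a A _ _ _
      simp only [e]
      exact (Avg.const (1 + ufPot A T.uf)).mono (fun _ => le_rfl) (by omega)
  have hp0 : (T.stack T.top).ptr ≠ 0 := by have := hT.key_pos t ht; omega
  have hroot : ∀ i < T.size, T.uf.rootD i = T.uf.rootD t ↔ T.lev i = T.top := fun i hi =>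
    ⟨fun h => (lev_eq_of_rootD_eq h).trans htl, fun h => hA.sep i t hi ht (h.trans htl.symm)⟩
  rcases hA.ptr (T.top - 1) (by omega) (by omega) with ⟨hq, hno⟩ | ⟨u, hu, huq, hul⟩
  · set T' : Struct V := { T.findS t with
      label := Function.update T.label (T.uf.rootD t) (T.top - 1)
      stack := Function.update T.stack (T.top - 1)
              { T.stack (T.top - 1) with ptr := (T.stack T.top).ptr } } with hT'
    have e : ∀ h, (T.rehash h).uniteTop = (T'.rehash h,
        ((T.rehash h).lookup (T.stack T.top).ptr).2 + (ufDepth T.uf t + 1)) := fun h => by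
      simp only [uniteTop, e1, e2, if_neg hp0]
      rw [lookup_eq_some hT ht htp h]
      simp only [hq, if_true, rehash_find]
      rw [hT', rehash, rehash]
      congr 1
    have hl' : ∀ i, T'.lev i = if T.uf.rootD i = T.uf.rootD t then T.top - 1 else T.lev i := by
      intro i
      simp only [hT', lev, findS, findD_rootD, Function.update_apply]
    have hl : ∀ i < T.size, T'.lev i = min (T.lev i) (T.top - 1) := fun i hi => by
      rw [hl' i]
      have h1 := hA.lev_mem i hi
      have h2 := hno i hi
      have h4 := hroot i hi
      split
      · next h => rw [h4.1 h]; omega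
      · next h => have := mt h4.2 h; omega
    have hk : Keeps T T' := by
      have := findS_keeps T t
      exact ⟨this.cap, this.size, this.key, this.live, this.count, this.minPos⟩
    have hv : ∀ k, (T'.stack k).val = (T.stack k).val := fun k => by
      simp only [hT', Function.update_apply]
      split
      · next h => rw [h]
      · rfl
    refine ⟨T', fun h => by rw [e], hk.wf hT (hT.rankInv.findD t), hk, ?_, rfl, hv, hl, ?_⟩
    · refine Act.of_pop hA h3 hk hv hl (fun i j hi hj hij => ?_) (fun k hlt => ?_)
        (.inr ⟨t, ht, ?_, ?_⟩)
      · have h1 := hA.lev_mem i hi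
        have h2 := hA.lev_mem j hj
        have h4 := hno i hi
        have h5 := hno j hj
        rw [hl i hi, hl j hj] at hij
        simp only [hT', findS, findD_rootD]
        exact hA.sep i j hi hj (by omega)
      · simp only [hT']
        rw [Function.update_of_ne (by omega)]
      · simp only [hT', Function.update_self]; exact htp
      · rw [hl t ht]; omega
    · intro Ω _ P _ hs a A hu hsz hA'
      have h1 := (avg_lookup hu hT hsz (T.stack T.top).ptr).add_const (ufPot A T.uf + A + 1)
      refine h1.mono (fun ω => ?_) (by omega)
      rw [e]
      have := findS_cost hT hsz hA' t
      have : T'.uf = (T.findS t).uf := rfl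
      rw [this]
      dsimp only
      omega
  · have hq0 : (T.stack (T.top - 1)).ptr ≠ 0 := by have := hT.key_pos u hu; omega
    set T' := T.uniteS t u (T.top - 1) with hT'
    have e : ∀ h, (T.rehash h).uniteTop = (T'.rehash h,
        ((T.rehash h).lookup (T.stack T.top).ptr).2 +
        ((T.rehash h).lookup (T.stack (T.top - 1)).ptr).2 +
        (ufDepth T.uf t + ufDepth (T.uf.findD t).1 u + 3)) := fun h => by
      simp only [uniteTop, e1, e2, if_neg hp0, if_neg hq0]
      rw [lookup_eq_some hT ht htp h]
      simp only []
      rw [lookup_eq_some hT hu huq h]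
      simp only [rehash_unite ht hu, hT']
    have hk := uniteS_keeps ht hu (T.top - 1)
    obtain ⟨hst, htop⟩ := uniteS_stack ht hu (T.top - 1)
    obtain ⟨r, hr, -, hroot', hlev'⟩ := unite_spec ht hu (T.top - 1)
    have hrootu : ∀ i < T.size, T.uf.rootD i = T.uf.rootD u ↔ T.lev i = T.top - 1 := fun i hi =>
      ⟨fun h => (lev_eq_of_rootD_eq h).trans hul, fun h => hA.sep i u hi hu (h.trans hul.symm)⟩
    have hl : ∀ i < T.size, T'.lev i = min (T.lev i) (T.top - 1) := fun i hi => by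
      simp only [hT', hlev', hroot i hi, hrootu i hi]
      have h1 := hA.lev_mem i hi
      split <;> omega
    refine ⟨T', fun h => by rw [e], uniteS_wf hT ht hu _, hk, ?_, htop, fun k => by rw [hst], hl, ?_⟩
    · refine Act.of_pop hA h3 hk (fun k => by rw [hst]) hl (fun i j hi hj hij => ?_)
        (fun k hlt => by rw [hst]) (.inr ⟨u, hu, by rw [hst]; exact huq, ?_⟩)
      · have h1 := hA.lev_mem i hi
        have h2 := hA.lev_mem j hj
        rw [hl i hi, hl j hj] at hij
        simp only [hT', hroot', hroot i hi, hroot j hj, hrootu i hi, hrootu j hj]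
        by_cases hc : T.lev i = T.top ∨ T.lev i = T.top - 1
        · rw [if_pos hc, if_pos (by omega)]
        · rw [if_neg hc, if_neg (by omega)]
          exact hA.sep i j hi hj (by omega)
      · rw [hl u hu]; omega
    · intro Ω _ P _ hs a A hu' hsz hA'
      have h1 := ((avg_lookup hu' hT hsz (T.stack T.top).ptr).add
        (avg_lookup hu' hT hsz (T.stack (T.top - 1)).ptr)).add_const (ufPot A T.uf + 3 * A + 3)
      refine h1.mono (fun ω => ?_) (by omega)
      rw [e]
      have := uniteS_cost hT hsz hA' ht hu (T.top - 1)
      rw [← hT'] at this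
      dsimp only
      omega

end Struct
end RMQ

/-! ### The command `Value` -/

namespace RMQ

open Batteries Finset MeasureTheory

namespace Struct

variable {V : Type*} [LinearOrder V]

theorem Act.val_mono {T : Struct V} (hA : T.Act) {k k' : ℕ} (h1 : 1 ≤ k) (h : k ≤ k')
    (h2 : k' ≤ T.top) : (T.stack k).val ≤ (T.stack k').val := by
  induction k', h using Nat.le_induction with
  | base => exact le_rfl
  | succ m hm ih => exact (ih (by omega)).trans (hA.mono m (by omega) (by omega)).le

/-- Each popped level releases `3 * A + 10` units: `3 * A + 9` for `uniteTop` and one for the round.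
The bound `n` on the rounds is never exhausted, because the sentinel stops the loop at level `2` at
the latest. -/
theorem popLoop_spec {v : Val V} (hv : ⊥ < v) (n : ℕ) (T : Struct V) (hT : T.Wf) (hA : T.Act)
    (hn : T.top ≤ n + 1) (hle : v ≤ (T.stack T.top).val) :
    ∃ T' : Struct V, (∀ h, (popLoop v n (T.rehash h)).1 = T'.rehash h) ∧ T'.Wf ∧ Keeps T T' ∧
      T'.Act ∧ T'.top ≤ T.top ∧ (∀ k, (T'.stack k).val = (T.stack k).val) ∧
      (∀ t < T.size, T'.lev t = min (T.lev t) T'.top) ∧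
      (T.stack (T'.top - 1)).val < v ∧ v ≤ (T.stack T'.top).val ∧
      ∀ {Ω : Type*} [MeasurableSpace Ω] (P : Measure Ω) [IsProbabilityMeasure P]
        (hs : Ω → ℕ → ℕ) (a A : ℕ), UnivHash P hs a → T.size ≤ a → a + 1 < ack (A - 1) 1 →
        Avg P (fun ω => (popLoop v n (T.rehash (hs ω))).2 + (ufPot A T'.uf + (3 * A + 10) * T'.top))
          (ufPot A T.uf + (3 * A + 10) * T.top + 1) := by
  induction n generalizing T with
  | zero => have := hA.top_ge; omega
  | succ n ih =>
    by_cases hc : v ≤ (T.stack (T.top - 1)).val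
    · have h3 : 3 ≤ T.top := by
        -- With only two levels left, the item below the top is the sentinel `⊥`, which is below
        -- `v`.
        by_contra h3
        have h2 : T.top - 1 = 1 := by have := hA.top_ge; omega
        rw [h2, hA.bot] at hc
        exact absurd hc (not_le.2 hv)
      obtain ⟨T₁, e₁, hT₁, hk₁, hA₁, ht₁, hv₁, hl₁, hc₁⟩ := uniteTop_spec hT hA h3
      set T₂ : Struct V := { T₁ with top := T.top - 1 } with hT₂
      have hk₂ : Keeps T T₂ := ⟨hk₁.cap, hk₁.size, hk₁.key, hk₁.live, hk₁.count, hk₁.minPos⟩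
      obtain ⟨T', e', hT', hk', hA', ht', hv', hl', hlt', hle', hc'⟩ := ih T₂
        (hk₂.wf hT hT₁.rankInv) hA₁ (by show T.top - 1 ≤ n + 1; omega)
        (by show v ≤ (T₁.stack (T.top - 1)).val; rwa [hv₁])
      have ht'' : T'.top ≤ T.top - 1 := ht'
      have e : ∀ h, popLoop v (n + 1) (T.rehash h) = ((popLoop v n (T₂.rehash h)).1,
          ((T.rehash h).uniteTop).2 + (popLoop v n (T₂.rehash h)).2 + 1) := by
        intro h
        have hc' : v ≤ ((T.rehash h).stack ((T.rehash h).top - 1)).val := hc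
        have e2 : ({ ((T.rehash h).uniteTop).1 with
            top := ((T.rehash h).uniteTop).1.top - 1 } : Struct V) = T₂.rehash h := by
          rw [e₁, hT₂, ← ht₁]; rfl
        rw [popLoop, if_pos hc']
        simp only [e2]
      refine ⟨T', fun h => by rw [e, e'], hT', hk₂.trans hk', hA', by omega,
        fun k => (hv' k).trans (hv₁ k), fun t ht => ?_, ?_, ?_, ?_⟩
      · rw [hl' t (hk₁.size.symm ▸ ht), show T₂.lev t = T₁.lev t from rfl, hl₁ t ht]
        omega
      · have : (T₁.stack (T'.top - 1)).val < v := hlt'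
        rwa [hv₁] at this
      · have : v ≤ (T₁.stack T'.top).val := hle'
        rwa [hv₁] at this
      · intro Ω _ P _ hs a A hu hsz hA'
        have b1 := hc₁ P hs a A hu hsz hA'
        have b2 := hc' P hs a A hu (hk₁.size.trans_le hsz) hA'
        obtain ⟨m, hm⟩ : ∃ m, T.top = m + 1 := ⟨T.top - 1, by omega⟩
        have h2 : T₂.top = m := by show T.top - 1 = m; omega
        rw [h2] at b2
        -- The potential of the forest after the first round occurs on both sides and is cancelled.
        refine Avg.of_add_const (c := ufPot A T₁.uf)
          (((b1.add b2).add_const 1).mono (fun ω => ?_) ?_)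
        · rw [e]; dsimp only; omega
        · rw [hm, show T₂.uf = T₁.uf from rfl, Nat.mul_succ]; omega
    · refine ⟨T, fun h => ?_, hT, Keeps.refl T, hA, le_rfl, fun _ => rfl, fun t ht => ?_,
        not_le.1 hc, hle, ?_⟩
      · have hc' : ¬ v ≤ ((T.rehash h).stack ((T.rehash h).top - 1)).val := hc
        rw [popLoop, if_neg hc']
      · have := hA.lev_mem t ht; omega
      · intro Ω _ P _ hs a A _ _ _
        refine (Avg.const (1 + (ufPot A T.uf + (3 * A + 10) * T.top))).mono (fun ω => ?_) (by omega)
        have hc' : ¬ v ≤ ((T.rehash (hs ω)).stack ((T.rehash (hs ω)).top - 1)).val := hc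
        rw [popLoop, if_neg hc']

/-- The loop stops at the lowest item with value at least `v`, onto which everything above has
collapsed. Overwriting this value by `v` amounts to taking the minimum with `v` for every element,
and for level `2`. -/
theorem value_spec {v : Val V} (hv : ⊥ < v) {T : Struct V} (hT : T.Wf) (hA : T.Act) :
    ∃ T' : Struct V, (∀ h, ((T.rehash h).value v).1 = T'.rehash h) ∧ T'.Wf ∧ Keeps T T' ∧
      T'.Act ∧ T'.top ≤ T.top ∧ (∀ t < T.size, T'.elemVal t = min (T.elemVal t) v) ∧
      (T'.stack 2).val = min (T.stack 2).val v ∧ (T'.stack T'.top).val ≤ v ∧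
      ∀ {Ω : Type*} [MeasurableSpace Ω] (P : Measure Ω) [IsProbabilityMeasure P]
        (hs : Ω → ℕ → ℕ) (a A : ℕ), UnivHash P hs a → T.size ≤ a → a + 1 < ack (A - 1) 1 →
        Avg P (fun ω => ((T.rehash (hs ω)).value v).2 + (ufPot A T'.uf + (3 * A + 10) * T'.top))
          (ufPot A T.uf + (3 * A + 10) * T.top + 2) := by
  by_cases hc : v < (T.stack T.top).val
  · have hc' : ∀ h, v < ((T.rehash h).stack (T.rehash h).top).val := fun _ => hc
    obtain ⟨T₁, e₁, hT₁, hk₁, hA₁, ht₁, hv₁, hl₁, hlt₁, hle₁, hc₁⟩ :=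
      popLoop_spec hv T.top T hT hA (by omega) hc.le
    set T' : Struct V := { T₁ with
      stack := Function.update T₁.stack T₁.top { T₁.stack T₁.top with val := v } } with hT'
    have e : ∀ h, (T.rehash h).value v =
        (T'.rehash h, (popLoop v T.top (T.rehash h)).2 + 1) := fun h => by
      have e0 : (T.rehash h).value v = ({ (popLoop v T.top (T.rehash h)).1 with
          stack := Function.update (popLoop v T.top (T.rehash h)).1.stack
            (popLoop v T.top (T.rehash h)).1.top
            { (popLoop v T.top (T.rehash h)).1.stack (popLoop v T.top (T.rehash h)).1.top with
              val := v } }, (popLoop v T.top (T.rehash h)).2 + 1) := if_pos (hc' h)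
      rw [e0, e₁]
      rfl
    have hk : Keeps T T' := ⟨hk₁.cap, hk₁.size, hk₁.key, hk₁.live, hk₁.count, hk₁.minPos⟩
    have hst : ∀ k, (T'.stack k).val = if k = T₁.top then v else (T.stack k).val := fun k => by
      rw [hT', ← hv₁]
      simp only [Function.update_apply]
      split <;> rfl
    have hptr : ∀ k, (T'.stack k).ptr = (T₁.stack k).ptr := fun k => by
      rw [hT']
      simp only [Function.update_apply]
      split
      · next h => rw [h]
      · rfl
    have htop := hA₁.top_ge
    refine ⟨T', fun h => by rw [e], hk.wf hT hT₁.rankInv, hk, ?_, ht₁, fun t ht => ?_, ?_, ?_, ?_⟩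
    · refine ⟨hA₁.top_ge, hA₁.lev_mem, hA₁.sep, fun k h2 hk => ?_, ?_, fun k h1 hk => ?_⟩
      · rw [hptr]; exact hA₁.ptr k h2 hk
      · rw [hst, if_neg (by omega)]; exact hA.bot
      · have hk : k < T₁.top := hk
        rw [hst, hst, if_neg (by omega)]
        split
        · next h => rw [show k = T₁.top - 1 by omega]; exact hlt₁
        · exact hA.mono k h1 (by omega)
    · have hl := hl₁ t ht
      have hm := hA.lev_mem t ht
      show (T'.stack (T₁.lev t)).val = min (T.stack (T.lev t)).val v
      rw [hst, hl]
      by_cases h : T.lev t < T₁.top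
      · rw [if_neg (by omega), min_eq_left h.le, min_eq_left]
        exact (hA.val_mono (by omega) (by omega) (by omega)).trans hlt₁.le
      · rw [if_pos (by omega), min_eq_right]
        exact hle₁.trans (hA.val_mono (by omega) (by omega) (by omega))
    · rw [hst]
      by_cases h : 2 = T₁.top
      · rw [if_pos h, min_eq_right]; rw [h]; exact hle₁
      · rw [if_neg h, min_eq_left]
        exact (hA.val_mono (by omega) (by omega) (by omega)).trans hlt₁.le
    · rw [hst, if_pos rfl]
    · intro Ω _ P _ hs a A hu hsz hA'
      refine ((hc₁ P hs a A hu hsz hA').add_const 1).mono (fun ω => ?_) (by omega)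
      rw [e]
      show (popLoop v T.top (T.rehash (hs ω))).2 + 1 + (ufPot A T₁.uf + (3 * A + 10) * T₁.top) ≤ _
      omega
  · have hc' : ∀ h, ¬ v < ((T.rehash h).stack (T.rehash h).top).val := fun _ => hc
    have e : ∀ h, (T.rehash h).value v = (T.rehash h, 1) := fun h => by rw [value, if_neg (hc' h)]
    rw [not_lt] at hc
    have htop := hA.top_ge
    refine ⟨T, fun h => by rw [e], hT, Keeps.refl T, hA, le_rfl, fun t ht => ?_, ?_, hc, ?_⟩
    · have hm := hA.lev_mem t ht
      exact (min_eq_left ((hA.val_mono (by omega) hm.2 le_rfl).trans hc)).symm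
    · exact (min_eq_left ((hA.val_mono (by omega) htop le_rfl).trans hc)).symm
    · intro Ω _ P _ hs a A _ _ _
      refine (Avg.const (1 + (ufPot A T.uf + (3 * A + 10) * T.top))).mono (fun ω => ?_) (by omega)
      rw [e]

end Struct
end RMQ

/-! ### The command `Mark` -/

namespace RMQ

open Batteries Finset MeasureTheory

namespace Struct

variable {V : Type*}

theorem insert_rootD (T : Struct V) (x k t : ℕ) : (T.insert x k).uf.rootD t = T.uf.rootD t :=
  UnionFind.root_push

theorem insert_key_of_lt (T : Struct V) (x k : ℕ) {t : ℕ} (ht : t < T.size) :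
    (T.insert x k).key t = T.key t := Function.update_of_ne (by omega) ..

theorem insert_key_size (T : Struct V) (x k : ℕ) : (T.insert x k).key T.size = x :=
  Function.update_self ..

theorem ufPot_insert (A : ℕ) (T : Struct V) (x k : ℕ) :
    ufPot A (T.insert x k).uf = ufPot A T.uf + A * 2 := ufPot_push A T.uf

theorem insert_keeps_insert (T : Struct V) (x k k' : ℕ) : Keeps (T.insert x k) (T.insert x k') :=
  ⟨rfl, rfl, rfl, rfl, rfl, rfl⟩

variable [LinearOrder V]

/-- Inserting an element at the top of the stack. -/
theorem Act.insert {T : Struct V} (hA : T.Act) (x : ℕ)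
    (hno : ∀ t < T.size, T.lev t ≠ T.top) {s : ℕ → Item V} (htop : (s T.top).ptr = x)
    (hptr : ∀ k < T.top, (s k).ptr = (T.stack k).ptr) (hval : ∀ k, (s k).val = (T.stack k).val) :
    ({ T.insert x T.top with stack := s } : Struct V).Act where
  top_ge := hA.top_ge
  lev_mem t ht := by
    have ht : t < (T.insert x T.top).size := ht
    show 2 ≤ (T.insert x T.top).lev t ∧ (T.insert x T.top).lev t ≤ T.top
    rw [insert_size] at ht
    rcases Nat.lt_succ_iff_lt_or_eq.1 ht with h | rfl
    · rw [insert_lev_of_lt _ _ _ h]; exact hA.lev_mem t h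
    · rw [insert_lev_size]; exact ⟨hA.top_ge, le_rfl⟩
  sep t u ht hu := by
    have ht : t < (T.insert x T.top).size := ht
    have hu : u < (T.insert x T.top).size := hu
    show (T.insert x T.top).lev t = (T.insert x T.top).lev u →
      (T.insert x T.top).uf.rootD t = (T.insert x T.top).uf.rootD u
    rw [insert_size] at ht hu
    rw [insert_rootD, insert_rootD]
    rcases Nat.lt_succ_iff_lt_or_eq.1 ht with h | rfl <;>
      rcases Nat.lt_succ_iff_lt_or_eq.1 hu with h' | rfl
    · rw [insert_lev_of_lt _ _ _ h, insert_lev_of_lt _ _ _ h']; exact hA.sep t u h h'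
    · rw [insert_lev_of_lt _ _ _ h, insert_lev_size]; exact fun e => absurd e (hno t h)
    · rw [insert_lev_of_lt _ _ _ h', insert_lev_size]; exact fun e => absurd e.symm (hno u h')
    · exact fun _ => rfl
  ptr k h2 hk := by
    have hk : k ≤ T.top := hk
    show ((s k).ptr = 0 ∧ ∀ t < (T.insert x T.top).size, (T.insert x T.top).lev t ≠ k) ∨
      ∃ t < (T.insert x T.top).size, (T.insert x T.top).key t = (s k).ptr ∧
        (T.insert x T.top).lev t = k
    rw [insert_size]
    rcases hk.eq_or_lt with rfl | hlt
    · exact .inr ⟨T.size, by omega, by rw [insert_key_size, htop], insert_lev_size ..⟩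
    · rw [hptr k hlt]
      rcases hA.ptr k h2 hk with ⟨h0, h⟩ | ⟨t, ht, h1, h3⟩
      · refine .inl ⟨h0, fun t ht => ?_⟩
        rcases Nat.lt_succ_iff_lt_or_eq.1 ht with h' | rfl
        · rw [insert_lev_of_lt _ _ _ h']; exact h t h'
        · rw [insert_lev_size]; omega
      · exact .inr ⟨t, by omega, by rw [insert_key_of_lt _ _ _ ht, h1],
          by rw [insert_lev_of_lt _ _ _ ht, h3]⟩
  bot := (hval 1).trans hA.bot
  mono k h1 hk := by
    show (s k).val < (s (k + 1)).val
    rw [hval, hval]; exact hA.mono k h1 hk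

/-- The worst case is a new item: `2 * A` for the new node of the forest, `3 * A + 10` for the new
level, and one unit of time. Joining the set of the top item costs a search and a union instead of a
level, which is less. -/
theorem mark_spec {v : Val V} {j : ℕ} {T : Struct V} (hT : T.Wf) (hA : T.Act) (hj : 0 < j)
    (hlt : ∀ t < T.size, T.key t < j) (hv : (T.stack T.top).val ≤ v) :
    ∃ T' : Struct V, (∀ h, ((T.rehash h).mark j v).1 = T'.rehash h) ∧ T'.Wf ∧
      Keeps (T.insert j 0) T' ∧ T'.Act ∧ T'.top ≤ T.top + 1 ∧
      (∀ t < T.size, T'.elemVal t = T.elemVal t) ∧ T'.elemVal T.size = v ∧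
      (T'.stack 2).val = (T.stack 2).val ∧
      ∀ {Ω : Type*} [MeasurableSpace Ω] (P : Measure Ω) [IsProbabilityMeasure P]
        (hs : Ω → ℕ → ℕ) (a A : ℕ), UnivHash P hs a → T.size < a → a + 1 < ack (A - 1) 1 →
        Avg P (fun ω => ((T.rehash (hs ω)).mark j v).2 + (ufPot A T'.uf + (3 * A + 10) * T'.top))
          (ufPot A T.uf + (3 * A + 10) * T.top + (5 * A + 11)) := by
  have htop := hA.top_ge
  by_cases hc : (T.stack T.top).val < v
  -- The new item is pushed with a null pointer first. Its level is then empty and the stack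
  -- invariant holds, so that `Act.insert` can add the element together with the pointer.
  · set T₁ : Struct V := { T with
      top := T.top + 1, stack := Function.update T.stack (T.top + 1) ⟨v, 0⟩ } with hT₁
    have hT₁w : T₁.Wf := ⟨hT.key_lt, hT.key_pos, hT.count_eq, hT.lt_minPos, hT.rankInv⟩
    have hst : ∀ k ≤ T.top, T₁.stack k = T.stack k := fun k hk =>
      Function.update_of_ne (by omega) ..
    have hsttop : T₁.stack (T.top + 1) = ⟨v, 0⟩ := Function.update_self ..
    have hA₁ : T₁.Act := by
      refine ⟨by show 2 ≤ T.top + 1; omega, fun t ht => ?_, hA.sep, fun k h2 hk => ?_, ?_,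
        fun k h1 hk => ?_⟩
      · have := hA.lev_mem t ht
        exact ⟨this.1, this.2.trans (Nat.le_succ _)⟩
      · have hk : k ≤ T.top + 1 := hk
        rcases hk.eq_or_lt with rfl | h
        · refine .inl ⟨by rw [hsttop], fun t ht => ?_⟩
          have h3 : T.lev t ≤ T.top := (hA.lev_mem t ht).2
          show T.lev t ≠ T.top + 1
          omega
        · rw [hst k (by omega)]; exact hA.ptr k h2 (by omega)
      · rw [hst 1 (by omega)]; exact hA.bot
      · have hk : k < T.top + 1 := hk
        rcases (Nat.lt_succ_iff.1 hk).eq_or_lt with rfl | h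
        · rw [hst _ le_rfl, hsttop]; exact hc
        · rw [hst k (by omega), hst (k + 1) (by omega)]; exact hA.mono k h1 h
    set s : ℕ → Item V := Function.update T.stack (T.top + 1) ⟨v, j⟩ with hs
    have hs1 : ∀ k ≤ T.top, s k = T.stack k := fun k hk => Function.update_of_ne (by omega) ..
    have hs2 : s (T.top + 1) = ⟨v, j⟩ := Function.update_self ..
    have hs3 : ∀ k, (s k).val = (T₁.stack k).val := fun k => by
      simp only [hs, hT₁, Function.update_apply]
      split <;> rfl
    set T' : Struct V := { T₁.insert j T₁.top with stack := s } with hT'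
    have e : ∀ h, (T.rehash h).mark j v = (T'.rehash h, 1) := fun h => by
      have hc' : ((T.rehash h).stack (T.rehash h).top).val < v := hc
      rw [mark, if_pos hc', hT']
      have e1 := rehash_insert ({ T₁ with stack := s } : Struct V) j (T.top + 1) h
      exact Prod.ext e1 rfl
    have hno : ∀ t < T₁.size, T₁.lev t ≠ T₁.top := fun t ht => by
      have h3 : T.lev t ≤ T.top := (hA.lev_mem t ht).2
      show T.lev t ≠ T.top + 1
      omega
    have hk : Keeps (T.insert j 0) T' := ⟨rfl, rfl, rfl, rfl, rfl, rfl⟩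
    refine ⟨T', fun h => by rw [e], hk.wf (hT.insert _ hj hlt) (hT.rankInv.push), hk,
      hA₁.insert j hno (by rw [show T₁.top = T.top + 1 from rfl, hs2]) (fun k hk => ?_) hs3,
      le_rfl, fun t ht => ?_, ?_, ?_, ?_⟩
    · have hk : k < T.top + 1 := hk
      rw [hs1 k (by omega), hst k (by omega)]
    · show (s ((T₁.insert j T₁.top).lev t)).val = (T.stack (T.lev t)).val
      rw [insert_lev_of_lt T₁ j T₁.top ht, show T₁.lev t = T.lev t from rfl, hs1]
      · exact (hA.lev_mem t ht).2
    · show (s ((T₁.insert j T₁.top).lev T₁.size)).val = v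
      rw [insert_lev_size, show T₁.top = T.top + 1 from rfl, hs2]
    · show (s 2).val = _
      rw [hs1 2 htop]
    · intro Ω _ P _ hs a A _ _ _
      refine (Avg.const (1 + (ufPot A T'.uf + (3 * A + 10) * T'.top))).mono (fun ω => ?_) ?_
      · rw [e]
      · rw [show T'.top = T.top + 1 from rfl, show ufPot A T'.uf = ufPot A T.uf + A * 2 from
          ufPot_push A T.uf, mul_add_one (3 * A + 10)]
        omega
  -- The top value is at most `v` by hypothesis and not below `v` in this case, so the new position
  -- belongs to the top item.
  have hveq : (T.stack T.top).val = v := le_antisymm hv (not_lt.1 hc)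
  have hc' : ∀ h, ¬ ((T.rehash h).stack (T.rehash h).top).val < v := fun _ => hc
  rcases hA.ptr T.top htop le_rfl with ⟨hp, hno⟩ | ⟨u, hu, hup, hul⟩
  · set s := Function.update T.stack T.top { T.stack T.top with ptr := j } with hs
    set T' : Struct V := { T.insert j T.top with stack := s } with hT'
    have hs3 : ∀ k, (s k).val = (T.stack k).val := fun k => by
      simp only [hs, Function.update_apply]
      split
      · next h => rw [h]
      · rfl
    have e : ∀ h, (T.rehash h).mark j v = (T'.rehash h, 1) := fun h => by
      have hp' : ((T.rehash h).stack (T.rehash h).top).ptr = 0 := hp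
      rw [mark, if_neg (hc' h)]
      simp only [hp', if_true]
      rw [rehash_insert]
      rfl
    have hk : Keeps (T.insert j 0) T' := ⟨rfl, rfl, rfl, rfl, rfl, rfl⟩
    refine ⟨T', fun h => by rw [e], hk.wf (hT.insert _ hj hlt) (hT.rankInv.push), hk,
      hA.insert j hno (by simp [hs]) (fun k hk => ?_) hs3, Nat.le_succ _, fun t ht => ?_, ?_, ?_, ?_⟩
    · rw [hs, Function.update_of_ne (by omega)]
    · show (s ((T.insert j T.top).lev t)).val = (T.stack (T.lev t)).val
      rw [insert_lev_of_lt _ _ _ ht, hs3]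
    · show (s ((T.insert j T.top).lev T.size)).val = v
      rw [insert_lev_size, hs3, hveq]
    · exact hs3 2
    · intro Ω _ P _ hs a A _ _ _
      refine (Avg.const (1 + (ufPot A T'.uf + (3 * A + 10) * T'.top))).mono (fun ω => ?_) ?_
      · rw [e]
      · rw [show T'.top = T.top from rfl, show ufPot A T'.uf = ufPot A T.uf + A * 2 from
          ufPot_push A T.uf]
        omega
  · have hp0 : (T.stack T.top).ptr ≠ 0 := by have := hT.key_pos u hu; omega
    set T₂ := T.insert j T.top with hT₂
    have hT₂w : T₂.Wf := hT.insert _ hj hlt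
    have hsz : T₂.size = T.size + 1 := insert_size ..
    have hu2 : u < T₂.size := by omega
    have hs2 : T.size < T₂.size := by omega
    set T' := T₂.uniteS u T.size T.top with hT'
    have e : ∀ h, (T.rehash h).mark j v = (T'.rehash h,
        ((T₂.rehash h).lookup (T.stack T.top).ptr).2 +
        (ufDepth T₂.uf u + ufDepth (T₂.uf.findD u).1 T.size + 3)) := fun h => by
      have hp' : ¬ ((T.rehash h).stack (T.rehash h).top).ptr = 0 := hp0
      rw [mark, if_neg (hc' h)]
      simp only [if_neg hp', rehash_insert]
      rw [show T.insert j (T.rehash h).top = T₂ from rfl,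
        show ((T.rehash h).stack (T.rehash h).top).ptr = (T.stack T.top).ptr from rfl,
        lookup_eq_some hT₂w hu2 (by rw [hT₂, insert_key_of_lt _ _ _ hu, hup]) h]
      simp only [show (T.rehash h).size = T.size from rfl, show (T.rehash h).top = T.top from rfl,
        rehash_unite hu2 hs2, hT']
    obtain ⟨hst, htp⟩ := uniteS_stack hu2 hs2 T.top
    obtain ⟨r, hr, -, hroot, hlev⟩ := unite_spec hu2 hs2 T.top
    have hru : ∀ i < T.size, T.uf.rootD i = T.uf.rootD u ↔ T.lev i = T.top := fun i hi =>
      ⟨fun h => (lev_eq_of_rootD_eq h).trans hul, fun h => hA.sep i u hi hu (h.trans hul.symm)⟩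
    -- The two sets that are united make up exactly the top level, so the union changes no level.
    have hcond : ∀ i < T.size + 1, (T₂.uf.rootD i = T₂.uf.rootD u ∨
        T₂.uf.rootD i = T₂.uf.rootD T.size) ↔ T₂.lev i = T.top := by
      intro i hi
      simp only [hT₂, insert_rootD, rootD_size]
      rcases Nat.lt_succ_iff_lt_or_eq.1 hi with h | rfl
      · have h2 : T.uf.rootD i < T.size := UnionFind.rootD_lt.2 h
        rw [insert_lev_of_lt _ _ _ h, ← hru i h]
        constructor
        · rintro (h | h)
          · exact h
          · omega
        · exact .inl
      · rw [insert_lev_size]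
        simp [rootD_size]
    have hl : ∀ i < T.size + 1, T'.lev i = T₂.lev i := fun i hi => by
      rw [hT', hlev i]
      split
      · next h => exact ((hcond i hi).1 h).symm
      · rfl
    have hk2 : Keeps T₂ T' := uniteS_keeps hu2 hs2 _
    have hk : Keeps (T.insert j 0) T' := (insert_keeps_insert T j 0 T.top).trans hk2
    have hst' : T'.stack = T.stack := hst
    have htp' : T'.top = T.top := htp
    have hl1 : ∀ i < T.size, T'.lev i = T.lev i := fun i hi => by
      rw [hl i (by omega), hT₂, insert_lev_of_lt _ _ _ hi]
    have hl2 : T'.lev T.size = T.top := by rw [hl _ (by omega), hT₂, insert_lev_size]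
    have hsz' : T'.size = T.size + 1 := hk2.size.trans hsz
    refine ⟨T', fun h => by rw [e], uniteS_wf hT₂w hu2 hs2 _, hk, ?_, by omega, fun t ht => ?_,
      ?_, by rw [hst'], ?_⟩
    · refine ⟨by omega, fun t ht => ?_, fun t w ht hw htw => ?_, fun k h2 hk => ?_, ?_, ?_⟩
      · rw [htp']
        rcases Nat.lt_succ_iff_lt_or_eq.1 (hsz' ▸ ht) with h | rfl
        · rw [hl1 t h]; exact hA.lev_mem t h
        · rw [hl2]; omega
      · rw [hsz'] at ht hw
        rw [hl t ht, hl w hw] at htw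
        simp only [hT', hroot, hcond t ht, hcond w hw, htw]
        split
        · rfl
        · next h =>
          have h2 : T₂.lev T.size = T.top := insert_lev_size ..
          rcases Nat.lt_succ_iff_lt_or_eq.1 ht with h' | rfl
          · rcases Nat.lt_succ_iff_lt_or_eq.1 hw with h'' | rfl
            · rw [hT₂, insert_lev_of_lt _ _ _ h', insert_lev_of_lt _ _ _ h''] at htw
              rw [hT₂, insert_rootD, insert_rootD]
              exact hA.sep t w h' h'' htw
            · exact absurd h2 h
          · rw [htw] at h2; exact absurd h2 h
      · rw [hst', hsz']
        rcases hA.ptr k h2 (by omega) with ⟨h0, h⟩ | ⟨t, ht, h1, h3⟩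
        · refine .inl ⟨h0, fun t ht => ?_⟩
          rcases Nat.lt_succ_iff_lt_or_eq.1 ht with h' | rfl
          · rw [hl1 t h']; exact h t h'
          · rw [hl2]; rintro rfl; exact h u hu hul
        · refine .inr ⟨t, by omega, ?_, by rw [hl1 t ht, h3]⟩
          rw [hk2.key, hT₂, insert_key_of_lt _ _ _ ht, h1]
      · rw [hst']; exact hA.bot
      · rw [hst', htp']; exact hA.mono
    · rw [elemVal, hl1 t ht, hst', elemVal]
    · rw [elemVal, hl2, hst', hveq]
    · intro Ω _ P _ hs a A hun hsz'' hA'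
      have h1 := (avg_lookup hun hT₂w (by omega) (T.stack T.top).ptr).add_const
        (ufPot A T₂.uf + 3 * A + 3 + (3 * A + 10) * T.top)
      refine h1.mono (fun ω => ?_) ?_
      · rw [e, htp']
        have := uniteS_cost hT₂w (by omega) hA' hu2 hs2 T.top
        rw [← hT'] at this
        dsimp only
        omega
      · rw [hT₂, ufPot_insert]; omega

end Struct
end RMQ

/-! ### The commands `Query` and `Close` -/

namespace RMQ

open Batteries Finset MeasureTheory

namespace Struct

variable {V : Type*}

/-- `T'` differs from `T` only in the shape of the forest, in the flags and their number. -/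
structure Like (T T' : Struct V) : Prop where
  cap : T'.cap = T.cap
  size : T'.size = T.size
  key : T'.key = T.key
  minPos : T'.minPos = T.minPos
  stack : T'.stack = T.stack
  top : T'.top = T.top
  label : T'.label = T.label
  rootD : ∀ i, T'.uf.rootD i = T.uf.rootD i

theorem Like.refl (T : Struct V) : Like T T := ⟨rfl, rfl, rfl, rfl, rfl, rfl, rfl, fun _ => rfl⟩

theorem Like.trans {T T' T'' : Struct V} (h : Like T T') (h' : Like T' T'') : Like T T'' :=
  ⟨h'.cap.trans h.cap, h'.size.trans h.size, h'.key.trans h.key, h'.minPos.trans h.minPos,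
    h'.stack.trans h.stack, h'.top.trans h.top, h'.label.trans h.label,
    fun i => (h'.rootD i).trans (h.rootD i)⟩

theorem Like.lev {T T' : Struct V} (h : Like T T') (t : ℕ) : T'.lev t = T.lev t := by
  rw [Struct.lev, Struct.lev, h.label, h.rootD]

theorem Like.elemVal {T T' : Struct V} (h : Like T T') (t : ℕ) : T'.elemVal t = T.elemVal t := by
  rw [Struct.elemVal, Struct.elemVal, h.stack, h.lev]

theorem Like.act [LT V] {T T' : Struct V} (h : Like T T') (hA : T.Act) : T'.Act where
  top_ge := h.top ▸ hA.top_ge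
  lev_mem := by simpa only [h.size, h.lev, h.top] using hA.lev_mem
  sep := by simpa only [h.size, h.lev, h.rootD] using hA.sep
  ptr := by simpa only [h.size, h.lev, h.top, h.stack, h.key] using hA.ptr
  bot := h.stack ▸ hA.bot
  mono := by simpa only [h.top, h.stack] using hA.mono

theorem findS_like (T : Struct V) (t : ℕ) : Like T (T.findS t) :=
  ⟨rfl, findS_size T t, rfl, rfl, rfl, rfl, rfl, findD_rootD T.uf t⟩

/-- The three answers belong to a structure that contains `i`, one opened after `i`, and one that
contributes nothing; in the last case `⊤` is neutral for the minimum over all structures. -/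
theorem query_spec [LinearOrder V] {T : Struct V} (hT : T.Wf) (i : ℕ) :
    ∃ (T' : Struct V) (ans : Val V),
      (∀ h, ((T.rehash h).query i).1 = T'.rehash h ∧ ((T.rehash h).query i).2.1 = ans) ∧
      T'.Wf ∧ Like T T' ∧ T'.live = T.live ∧ T'.count = T.count ∧
      (∀ t < T.size, T.key t = i → ans = T.elemVal t) ∧
      ((∀ t < T.size, i < T.key t) → 2 ≤ T.top → ans = (T.stack 2).val) ∧
      ((∀ t < T.size, T.key t ≠ i) → (∃ t < T.size, T.key t ≤ i) ∨ T.top < 2 → ans = ⊤) ∧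
      ∀ {Ω : Type*} [MeasurableSpace Ω] (P : Measure Ω) [IsProbabilityMeasure P]
        (hs : Ω → ℕ → ℕ) (a A : ℕ), UnivHash P hs a → T.size ≤ a → a + 1 < ack (A - 1) 1 →
        Avg P (fun ω => ((T.rehash (hs ω)).query i).2.2 + ufPot A T'.uf)
          (ufPot A T.uf + (A + 4)) := by
  by_cases hi : ∃ t < T.size, T.key t = i
  · obtain ⟨t, ht, hti⟩ := hi
    have e : ∀ h, (T.rehash h).query i = ((T.findS t).rehash h, T.elemVal t,
        ((T.rehash h).lookup i).2 + (ufDepth T.uf t + 1)) := fun h => by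
      rw [query, lookup_eq_some hT ht hti h]
      simp only [rehash_find]
      rfl
    refine ⟨T.findS t, T.elemVal t, fun h => by rw [e]; exact ⟨rfl, rfl⟩, hT.findS t,
      findS_like T t, rfl, rfl, fun u hu hui => ?_, fun h => ?_, fun h => absurd hti (h t ht), ?_⟩
    · rw [hT.key_inj hu ht (hui.trans hti.symm)]
    · have := h t ht; omega
    · intro Ω _ P _ hs a A hu hsz hA
      refine ((avg_lookup hu hT hsz i).add_const (ufPot A T.uf + A + 1)).mono (fun ω => ?_)
        (by omega)
      rw [e]
      have := findS_cost hT hsz hA t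
      dsimp only
      omega
  · push Not at hi
    have e : ∀ h, (T.rehash h).query i = (T.rehash h,
        if (i : WithTop ℕ) < T.minPos ∧ 2 ≤ T.top then (T.stack 2).val else ⊤,
        ((T.rehash h).lookup i).2) := fun h => by
      rw [query, lookup_eq_none hi h]
      simp only []
      rw [show (T.rehash h).minPos = T.minPos from rfl, show (T.rehash h).top = T.top from rfl]
      split <;> rfl
    refine ⟨T, if (i : WithTop ℕ) < T.minPos ∧ 2 ≤ T.top then (T.stack 2).val else ⊤,
      fun h => by rw [e]; exact ⟨rfl, rfl⟩, hT, Like.refl T, rfl, rfl,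
      fun t ht h => absurd h (hi t ht), fun h h2 => ?_, fun _ h => ?_, ?_⟩
    · rw [if_pos ⟨(hT.lt_minPos i).2 h, h2⟩]
    · rw [if_neg]
      rw [hT.lt_minPos]
      rintro ⟨h1, h2⟩
      rcases h with ⟨t, ht, hti⟩ | h
      · have := h1 t ht; omega
      · omega
    · intro Ω _ P _ hs a A hu hsz hA
      refine ((avg_lookup hu hT hsz i).add_const (ufPot A T.uf)).mono (fun ω => ?_) (by omega)
      rw [e]

/-- All structures in memory receive the command, so a position that is absent or already closed
must do no harm, in particular in a destination to which it has not been copied. -/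
theorem close_spec {T : Struct V} (hT : T.Wf) (x : ℕ) :
    ∃ T' : Struct V, (∀ h, ((T.rehash h).close x).1 = T'.rehash h) ∧ T'.Wf ∧ Like T T' ∧
      T'.uf = T.uf ∧ (∀ t < T.size, T'.live t = true ↔ T.live t = true ∧ T.key t ≠ x) ∧
      ∀ {Ω : Type*} [MeasurableSpace Ω] (P : Measure Ω) [IsProbabilityMeasure P]
        (hs : Ω → ℕ → ℕ) (a : ℕ), UnivHash P hs a → T.size ≤ a →
        Avg P (fun ω => ((T.rehash (hs ω)).close x).2) 3 := by
  by_cases hx : ∃ t < T.size, T.key t = x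
  · obtain ⟨t, ht, htx⟩ := hx
    by_cases hl : T.live t = true
    · set T' : Struct V :=
        { T with live := Function.update T.live t false, count := T.count - 1 } with hT'
      have e : ∀ h, (T.rehash h).close x = (T'.rehash h, ((T.rehash h).lookup x).2) := fun h => by
        rw [close, lookup_eq_some hT ht htx h]
        simp only [show (T.rehash h).live t = true from hl, if_true]
        rfl
      have hlive : ∀ u < T.size, T'.live u = true ↔ T.live u = true ∧ T.key u ≠ x := fun u hu => by
        simp only [hT', Function.update_apply]
        by_cases hut : u = t
        · subst hut; simp [htx]
        · rw [if_neg hut]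
          exact ⟨fun h => ⟨h, fun h' => hut (hT.key_inj hu ht (h'.trans htx.symm))⟩, fun h => h.1⟩
      refine ⟨T', fun h => by rw [e], ⟨hT.key_lt, hT.key_pos, ?_, hT.lt_minPos, hT.rankInv⟩,
        ⟨rfl, rfl, rfl, rfl, rfl, rfl, rfl, fun _ => rfl⟩, rfl, hlive, ?_⟩
      · show T.count - 1 = #{u ∈ range T.size | T'.live u = true}
        have : ({u ∈ range T.size | T'.live u = true} : Finset ℕ) =
            ({u ∈ range T.size | T.live u = true} : Finset ℕ).erase t := by
          ext u
          simp only [mem_filter, mem_erase, mem_range, hT', Function.update_apply]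
          by_cases hut : u = t <;> simp [hut]
        rw [this, card_erase_of_mem (by simp [ht, hl]), hT.count_eq]
      · intro Ω _ P _ hs a hu hsz
        refine (avg_lookup hu hT hsz x).mono (fun ω => ?_) le_rfl
        rw [e]
    · have e : ∀ h, (T.rehash h).close x = (T.rehash h, ((T.rehash h).lookup x).2) := fun h => by
        rw [close, lookup_eq_some hT ht htx h]
        simp only [show ¬ (T.rehash h).live t = true from hl]
        rfl
      refine ⟨T, fun h => by rw [e], hT, Like.refl T, rfl, fun u hu => ⟨fun h => ⟨h, fun h' => ?_⟩,
        fun h => h.1⟩, ?_⟩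
      · rw [hT.key_inj hu ht (h'.trans htx.symm)] at h; exact hl h
      · intro Ω _ P _ hs a hu hsz
        refine (avg_lookup hu hT hsz x).mono (fun ω => ?_) le_rfl
        rw [e]
  · push Not at hx
    have e : ∀ h, (T.rehash h).close x = (T.rehash h, ((T.rehash h).lookup x).2) := fun h => by
      rw [close, lookup_eq_none hx h]
    refine ⟨T, fun h => by rw [e], hT, Like.refl T, rfl, fun u hu => ⟨fun h => ⟨h, hx u hu⟩,
      fun h => h.1⟩, ?_⟩
    intro Ω _ P _ hs a hu hsz
    refine (avg_lookup hu hT hsz x).mono (fun ω => ?_) le_rfl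
    rw [e]

end Struct
end RMQ

namespace RMQ

open Batteries Finset MeasureTheory

/-! ## The merging program -/

/-- An instruction without effect. -/
def pad : Instr := .jumpLt 0 0 0

/-- A loop, placed at `b`, that transfers the elements of a structure to the destination. Every
round takes exactly `23` instructions, and so does leaving the loop. The value of an element is
the minimum of its value in `s` and the value at the level of `young` that register `w` holds. -/
def block (s : Slot) (w b : ℕ) : List Instr :=
  [.size s 1, .jumpLt 0 1 (b + 3), .jumpEq 0 0 (b + 52), .jumpClosed s 0 (b + 32),
    .find s 2 0, .label s 2 2, .val s 0 2, .const 3 2, .val .young 1 w, .jumpValLt 1 0 (b + 12),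
    pad, .jumpEq 0 0 (b + 14), .val .young 0 w, .jumpEq 0 0 (b + 14),
    .key s 4 0, .size .dest 5, .insert 4, .top .dest 6, .val .dest 2 6, .jumpValLt 2 0 (b + 26),
    .unite 8 5 6, pad, pad, .move 8 5, .succ 0, .jumpEq 0 0 b,
    .push 0, .top .dest 6, .setLabel .dest 5 6, .move 8 5, .succ 0, .jumpEq 0 0 b] ++
  (List.replicate 18 pad ++ [.succ 0, .jumpEq 0 0 b]) ++ (List.replicate 19 pad ++ [.const 0 0])

/-- The merging program: remove the sentinel `+∞`, transfer the old structure, then the young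
one. -/
def mergeProg : List Instr :=
  (.pop :: List.replicate 22 pad) ++ block .old 3 23 ++ block .young 2 95

variable {V : Type*} [LinearOrder V]

/-- Go to `l`. -/
def Merge.goto {V : Type*} (m : Merge V) (l : ℕ) : Merge V := { m with pc := l }

/-- Replace the place in the program and the registers. -/
def Merge.put {V : Type*} (m : Merge V) (l : ℕ) (reg : ℕ → ℕ) (vreg : ℕ → Val V) : Merge V :=
  { m with pc := l, reg := reg, vreg := vreg }

/-- Executing `k` instructions leads from `m` to `m'` in time `c`. -/
def Runs (prog : List Instr) (m : Merge V) (k c : ℕ) (m' : Merge V) : Prop :=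
  ∀ n, m.steps prog (k + n) = (m'.steps prog n).map fun r => (r.1, c + r.2)

namespace Runs

variable {prog : List Instr} {m m' m'' : Merge V} {k c k' c' : ℕ}

theorem refl (m : Merge V) : Runs prog m 0 0 m := fun n => by simp

theorem one {i : Instr} (hf : prog[m.pc]? = some i) (he : m.exec i = some (m', c)) :
    Runs prog m 1 (c + 1) m' := fun n => by
  rw [Nat.add_comm 1 n, Merge.steps, hf]
  simp only [he]
  cases hq : m'.steps prog n <;> simp [hq]

/-- Executions compose because `Runs` quantifies over the budget that remains afterwards. -/
theorem trans (h : Runs prog m k c m') (h' : Runs prog m' k' c' m'') :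
    Runs prog m (k + k') (c + c') m'' := fun n => by
  rw [Nat.add_assoc, h, h', Option.map_map]
  congr 1
  funext r
  simp [Nat.add_assoc]

theorem snoc (h : Runs prog m k c m') {i : Instr} (hf : prog[m'.pc]? = some i)
    (he : m'.exec i = some (m'', c')) : Runs prog m (k + 1) (c + (c' + 1)) m'' :=
  h.trans (one hf he)

theorem cast (h : Runs prog m k c m') (hk : k = k') (hc : c = c') : Runs prog m k' c' m' := by
  subst hk hc; exact h

theorem pads (n : ℕ) (m : Merge V) (hf : ∀ i < n, prog[m.pc + i]? = some pad) :
    Runs prog m n n (m.goto (m.pc + n)) := by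
  induction n with
  | zero => exact refl m
  | succ n ih =>
    refine ((ih fun i hi => hf i (by omega)).snoc (m'' := m.goto (m.pc + (n + 1)))
      (i := pad) (c' := 0) ?_ ?_).cast rfl rfl
    · exact hf n (by omega)
    · simp [pad, Merge.exec, Merge.jump, Merge.next, Merge.goto, Nat.add_assoc]

end Runs

namespace Merge

/-- The merge with the same contents, hashed by other functions. -/
def rehash {V : Type*} (m : Merge V) (hh : Slot → ℕ → ℕ) : Merge V :=
  { m with
    old := m.old.rehash (hh .old)
    young := m.young.rehash (hh .young)
    dest := m.dest.rehash (hh .dest) }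

variable (m : Merge V) (hh : Slot → ℕ → ℕ)

section Simp

variable {V : Type*} (m : Merge V) (r n l : ℕ) (s : Slot)

@[simp] theorem get_load : (m.load r n).get s = m.get s := by cases s <;> rfl
@[simp] theorem get_goto : (m.goto l).get s = m.get s := by cases s <;> rfl
@[simp] theorem get_next : m.next.get s = m.get s := by cases s <;> rfl
@[simp] theorem get_put (reg : ℕ → ℕ) (vreg : ℕ → Val V) : (m.put l reg vreg).get s = m.get s := by
  cases s <;> rfl
@[simp] theorem reg_put (reg : ℕ → ℕ) (vreg : ℕ → Val V) : (m.put l reg vreg).reg = reg := rfl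
theorem load_put (reg : ℕ → ℕ) (vreg : ℕ → Val V) :
    (m.put l reg vreg).load r n = m.put (l + 1) (Function.update reg r n) vreg := rfl
theorem goto_put (l' : ℕ) (reg : ℕ → ℕ) (vreg : ℕ → Val V) :
    (m.put l reg vreg).goto l' = m.put l' reg vreg := rfl
theorem next_put (reg : ℕ → ℕ) (vreg : ℕ → Val V) :
    (m.put l reg vreg).next = m.put (l + 1) reg vreg := rfl
@[simp] theorem reg_load : (m.load r n).reg = Function.update m.reg r n := rfl
@[simp] theorem vreg_put (reg : ℕ → ℕ) (vreg : ℕ → Val V) : (m.put l reg vreg).vreg = vreg := rfl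
@[simp] theorem reg_next : m.next.reg = m.reg := rfl
@[simp] theorem vreg_next : m.next.vreg = m.vreg := rfl
@[simp] theorem reg_goto : (m.goto l).reg = m.reg := rfl

end Simp

/-- This and the following lemmas cover the instructions that the merging program uses. None of them
searches a hash table, so their times do not depend on the hash functions. -/
theorem exec_const (r n : ℕ) :
    (m.rehash hh).exec (.const r n) = some ((m.load r n).rehash hh, 0) := rfl

theorem exec_move (r r' : ℕ) :
    (m.rehash hh).exec (.move r r') = some ((m.load r (m.reg r')).rehash hh, 0) := rfl

theorem exec_succ (r : ℕ) :
    (m.rehash hh).exec (.succ r) = some ((m.load r (m.reg r + 1)).rehash hh, 0) := rfl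

theorem exec_jumpLt_pos {r r' : ℕ} (h : m.reg r < m.reg r') (l : ℕ) :
    (m.rehash hh).exec (.jumpLt r r' l) = some ((m.goto l).rehash hh, 0) := by
  have h' : (m.rehash hh).reg r < (m.rehash hh).reg r' := h
  simp only [exec, jump, if_pos h']
  rfl

theorem exec_jumpLt_neg {r r' : ℕ} (h : ¬ m.reg r < m.reg r') (l : ℕ) :
    (m.rehash hh).exec (.jumpLt r r' l) = some (m.next.rehash hh, 0) := by
  have h' : ¬ (m.rehash hh).reg r < (m.rehash hh).reg r' := h
  simp only [exec, jump, if_neg h']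
  rfl

theorem exec_jumpEq_self (r l : ℕ) :
    (m.rehash hh).exec (.jumpEq r r l) = some ((m.goto l).rehash hh, 0) := by
  simp only [exec, jump, if_true]
  rfl

theorem exec_size (s : Slot) (r : ℕ) :
    (m.rehash hh).exec (.size s r) = some ((m.load r (m.get s).size).rehash hh, 0) := by
  cases s <;> rfl

theorem exec_key {s : Slot} {r' : ℕ} (h : m.reg r' < (m.get s).size) (r : ℕ) :
    (m.rehash hh).exec (.key s r r') =
      some ((m.load r ((m.get s).key (m.reg r'))).rehash hh, 0) := by
  cases s <;> exact if_pos h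

theorem exec_jumpClosed_pos {s : Slot} {r : ℕ} (h : m.reg r < (m.get s).size)
    (hl : (m.get s).live (m.reg r) = false) (l : ℕ) :
    (m.rehash hh).exec (.jumpClosed s r l) =
      some ((m.goto l).rehash hh, 0) := by
  cases s <;> exact (if_pos h).trans (congrArg (fun x => some (x, 0)) (if_pos hl))

theorem exec_jumpClosed_neg {s : Slot} {r : ℕ} (h : m.reg r < (m.get s).size)
    (hl : ¬ (m.get s).live (m.reg r) = false) (l : ℕ) :
    (m.rehash hh).exec (.jumpClosed s r l) = some (m.next.rehash hh, 0) := by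
  cases s <;> exact (if_pos h).trans (congrArg (fun x => some (x, 0)) (if_neg hl))

theorem exec_find {s : Slot} {r' : ℕ} (h : m.reg r' < (m.get s).size) (r : ℕ) :
    (m.rehash hh).exec (.find s r r') =
      some (((m.set ((m.get s).findS (m.reg r')) s).load r
        ((m.get s).uf.rootD (m.reg r'))).rehash hh, ufDepth (m.get s).uf (m.reg r') + 1) := by
  cases s
  all_goals
    refine (if_pos h).trans ?_
    simp only [get, rehash, Struct.rehash_find]
    rfl

theorem exec_label {s : Slot} {r' : ℕ} (h : m.reg r' < (m.get s).size) (r : ℕ) :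
    (m.rehash hh).exec (.label s r r') =
      some ((m.load r ((m.get s).label (m.reg r'))).rehash hh, 0) := by
  cases s <;> exact if_pos h

theorem exec_val {s : Slot} {r : ℕ} (h : m.reg r ≤ (m.get s).top) (x : ℕ) :
    (m.rehash hh).exec (.val s x r) = some (({ m.next with
      vreg := Function.update m.vreg x ((m.get s).stack (m.reg r)).val } : Merge V).rehash hh,
      0) := by
  cases s <;> exact if_pos h

theorem exec_jumpValLt_pos {x y : ℕ} (h : m.vreg x < m.vreg y) (l : ℕ) :
    (m.rehash hh).exec (.jumpValLt x y l) =
      some ((m.goto l).rehash hh, 0) := by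
  have h' : (m.rehash hh).vreg x < (m.rehash hh).vreg y := h
  simp only [exec, jump, if_pos h']
  rfl

theorem exec_jumpValLt_neg {x y : ℕ} (h : ¬ m.vreg x < m.vreg y) (l : ℕ) :
    (m.rehash hh).exec (.jumpValLt x y l) = some (m.next.rehash hh, 0) := by
  have h' : ¬ (m.rehash hh).vreg x < (m.rehash hh).vreg y := h
  simp only [exec, jump, if_neg h']
  rfl

theorem exec_setLabel_dest {r : ℕ} (h : m.reg r < m.dest.size) (r' : ℕ) :
    (m.rehash hh).exec (.setLabel .dest r r') = some (({ m.next with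
      dest := { m.dest with
        label := Function.update m.dest.label (m.reg r) (m.reg r') } } : Merge V).rehash hh, 0) :=
  if_pos h

theorem exec_push (h : m.dest.top < m.dest.cap + 2) (x : ℕ) :
    (m.rehash hh).exec (.push x) = some (({ m.next with
      dest := { m.dest with
        top := m.dest.top + 1
        stack := Function.update m.dest.stack (m.dest.top + 1) ⟨m.vreg x, 0⟩ } } :
          Merge V).rehash hh, 0) :=
  if_pos h

theorem exec_pop : (m.rehash hh).exec .pop = some (({ m.next with
      dest := { m.dest with top := m.dest.top - 1 } } : Merge V).rehash hh, 0) := rfl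

theorem exec_insert (h : m.dest.size < m.dest.cap) (r : ℕ) :
    (m.rehash hh).exec (.insert r) = some (({ m.next with
      dest := m.dest.insert (m.reg r) 0 } : Merge V).rehash hh, 0) := by
  refine (if_pos h).trans ?_
  simp only [rehash, Struct.rehash_insert]
  rfl

theorem exec_unite {r r' : ℕ} (h : m.reg r < m.dest.size) (h' : m.reg r' < m.dest.size) (r'' : ℕ) :
    (m.rehash hh).exec (.unite r r' r'') = some (({ m.next with
      dest := m.dest.uniteS (m.reg r) (m.reg r') (m.reg r'') } : Merge V).rehash hh,
      ufDepth m.dest.uf (m.reg r) + ufDepth (m.dest.uf.findD (m.reg r)).1 (m.reg r') + 3) := by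
  refine (if_pos ⟨h, h'⟩).trans ?_
  simp only [rehash, Struct.rehash_unite h h']
  rfl

end Merge

/-- `Runs` for all hash functions at once. -/
def RunsAll (prog : List Instr) (m : Merge V) (k c : ℕ) (m' : Merge V) : Prop :=
  ∀ hh, Runs prog (m.rehash hh) k c (m'.rehash hh)

namespace RunsAll

variable {prog : List Instr} {m m' m'' : Merge V} {k c k' c' : ℕ}

theorem refl (m : Merge V) : RunsAll prog m 0 0 m := fun _ => Runs.refl _

theorem trans (h : RunsAll prog m k c m') (h' : RunsAll prog m' k' c' m'') :
    RunsAll prog m (k + k') (c + c') m'' := fun hh => (h hh).trans (h' hh)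

theorem snoc (h : RunsAll prog m k c m') {i : Instr} (hf : prog[m'.pc]? = some i)
    (he : ∀ hh, (m'.rehash hh).exec i = some (m''.rehash hh, c')) :
    RunsAll prog m (k + 1) (c + (c' + 1)) m'' := fun hh => (h hh).snoc hf (he hh)

theorem cast (h : RunsAll prog m k c m') (hk : k = k') (hc : c = c') : RunsAll prog m k' c' m' := by
  subst hk hc; exact h

theorem pads (n : ℕ) (m : Merge V) (hf : ∀ i < n, prog[m.pc + i]? = some pad) :
    RunsAll prog m n n (m.goto (m.pc + n)) := fun hh => Runs.pads n (m.rehash hh) hf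

end RunsAll

section Block

variable {prog : List Instr} {s : Slot} {w b : ℕ}
  (hB : ∀ i < 72, prog[b + i]? = (block s w b)[i]?)
include hB

/-- A round of the loop for a closed element. -/
theorem block_skip (m : Merge V) (hpc : m.pc = b) (hi : m.reg 0 < (m.get s).size)
    (hl : (m.get s).live (m.reg 0) = false) :
    ∃ reg', reg' 0 = m.reg 0 + 1 ∧ reg' 8 = m.reg 8 ∧
      RunsAll prog m 23 23 (m.put b reg' m.vreg) := by
  subst hpc
  have h0 := (RunsAll.refl (prog := prog) (m.put m.pc m.reg m.vreg)).snoc (hB 0 (by omega))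
    fun hh => Merge.exec_size (m.put m.pc m.reg m.vreg) hh s 1
  have h1 := h0.snoc (hB 1 (by omega))
    fun hh => Merge.exec_jumpLt_pos _ hh (by simpa using hi) (m.pc + 3)
  have h2 := h1.snoc (hB 3 (by omega)) fun hh =>
    Merge.exec_jumpClosed_pos (s := s) (r := 0) _ hh (by simpa using hi)
      (by simpa using hl) _
  -- A skipped element takes `3 + 18 + 2 = 23` instructions.
  have h3 := h2.trans (RunsAll.pads 18 _ fun i hi => by
    show prog[m.pc + 32 + i]? = _
    rw [Nat.add_assoc, hB (32 + i) (by omega)]; interval_cases i <;> rfl)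
  have h4 := (h3.snoc (hB 50 (by omega)) fun hh => Merge.exec_succ _ hh 0).snoc (hB 51 (by omega))
    fun hh => Merge.exec_jumpEq_self _ hh 0 _
  simp only [Merge.load_put, Merge.goto_put] at h4
  exact ⟨_, by simp, by simp, h4⟩

/-- Leaving the loop. -/
theorem block_exit (m : Merge V) (hpc : m.pc = b) (hi : ¬ m.reg 0 < (m.get s).size) :
    ∃ reg', reg' 0 = 0 ∧ reg' 8 = m.reg 8 ∧
      RunsAll prog m 23 23 (m.put (b + 72) reg' m.vreg) := by
  subst hpc
  have h0 := (RunsAll.refl (prog := prog) (m.put m.pc m.reg m.vreg)).snoc (hB 0 (by omega))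
    fun hh => Merge.exec_size (m.put m.pc m.reg m.vreg) hh s 1
  have h1 := h0.snoc (hB 1 (by omega))
    fun hh => Merge.exec_jumpLt_neg _ hh (by simpa using hi) (m.pc + 3)
  have h2 := h1.snoc (hB 2 (by omega)) fun hh => Merge.exec_jumpEq_self _ hh 0 _
  -- Leaving takes `3 + 19 + 1 = 23` instructions and ends just behind the block, with the element
  -- counter reset for the next loop.
  have h3 := h2.trans (RunsAll.pads 19 _ fun i hi => by
    show prog[m.pc + 52 + i]? = _
    rw [Nat.add_assoc, hB (52 + i) (by omega)]; interval_cases i <;> rfl)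
  have h4 := h3.snoc (hB 71 (by omega)) fun hh => Merge.exec_const _ hh 0 0
  simp only [Merge.load_put, Merge.goto_put, Merge.next_put] at h4
  exact ⟨_, by simp, by simp, h4⟩

/-- The first part of a round: the value of the element. -/
theorem block_value (m : Merge V) (hpc : m.pc = b)
    (hi : m.reg 0 < (m.get s).size) (hl : (m.get s).live (m.reg 0) = true)
    (hlev : (m.get s).lev (m.reg 0) ≤ (m.get s).top) {k : ℕ} (hk : k ≤ m.young.top)
    (hw : w = 3 ∧ k = 2 ∨ w = 2 ∧ k = (m.get s).lev (m.reg 0)) :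
    ∃ reg' vreg', reg' 0 = m.reg 0 ∧ reg' 8 = m.reg 8 ∧
      vreg' 0 = min ((m.get s).elemVal (m.reg 0)) (m.young.stack k).val ∧
      RunsAll prog m 11 (12 + ufDepth (m.get s).uf (m.reg 0))
        ((m.set ((m.get s).findS (m.reg 0)) s).put (b + 14) reg' vreg') := by
  subst hpc
  set t := m.reg 0 with ht
  set T := m.get s with hT
  set M := m.set (T.findS t) s with hM
  have hMs : M.get s = T.findS t := by cases s <;> rfl
  have hMr : M.reg = m.reg := by cases s <;> rfl
  have hMv : M.vreg = m.vreg := by cases s <;> rfl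
  have hMp : M.pc = m.pc := by cases s <;> rfl
  have hMy : M.young.stack = m.young.stack ∧ M.young.top = m.young.top := by
    cases s <;> exact ⟨rfl, rfl⟩
  have hroot : T.uf.rootD t < (T.findS t).size := by
    rw [Struct.findS_size]; exact UnionFind.rootD_lt.2 hi
  have h0 := (RunsAll.refl (prog := prog) m).snoc (hB 0 (by omega))
    fun hh => Merge.exec_size m hh s 1
  have h1 := h0.snoc (hB 1 (by omega))
    fun hh => Merge.exec_jumpLt_pos _ hh (by simpa using hi) (m.pc + 3)
  have h2 := h1.snoc (hB 3 (by omega)) fun hh =>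
    Merge.exec_jumpClosed_neg (s := s) (r := 0) _ hh (by simpa using hi) (by simpa using hl) _
  have h3 := h2.snoc (m'' := M.put (m.pc + 5)
      (Function.update (Function.update m.reg 1 T.size) 2 (T.uf.rootD t)) m.vreg)
    (c' := ufDepth T.uf t + 1) (hB 4 (by omega)) fun hh => by
      refine (Merge.exec_find (s := s) (r' := 0) _ hh (by simpa using hi) _).trans ?_
      simp only [Merge.get_next, Merge.get_goto, Merge.get_load]
      rw [hM]
      cases s <;> rfl
  have h4 := h3.snoc (m'' := M.put (m.pc + 6)
      (Function.update (Function.update m.reg 1 T.size) 2 (T.lev t)) m.vreg)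
    (hB 5 (by omega)) fun hh => by
      refine (Merge.exec_label (s := s) (r' := 2) _ hh (by simpa [hMs] using hroot) _).trans ?_
      rw [Merge.get_put, hMs]
      simp only [Merge.put, Merge.load, Function.update_self, Function.update_idem]
      rfl
  have h5 := h4.snoc (m'' := M.put (m.pc + 7)
      (Function.update (Function.update m.reg 1 T.size) 2 (T.lev t))
      (Function.update m.vreg 0 (T.elemVal t)))
    (hB 6 (by omega)) fun hh => by
      refine (Merge.exec_val (s := s) (r := 2) _ hh (by simp [hMs]; exact hlev) _).trans ?_
      rw [Merge.get_put, hMs]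
      simp only [Merge.put, Merge.next, Function.update_self]
      rfl
  set r2 := Function.update (Function.update (Function.update m.reg 1 T.size) 2 (T.lev t)) 3 2
    with hr2
  have h6 := h5.snoc (m'' := M.put (m.pc + 8) r2 (Function.update m.vreg 0 (T.elemVal t)))
    (hB 7 (by omega)) fun hh => rfl
  -- Register `w` holds the level of `young` used for the comparison: the constant `2` in register
  -- `3`, or the element's own level in register `2`. In the young loop the minimum thus changes
  -- nothing.
  have hrw : r2 w = k := by rcases hw with ⟨rfl, rfl⟩ | ⟨rfl, rfl⟩ <;> simp [hr2]
  have h7 := h6.snoc (m'' := M.put (m.pc + 9) r2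
      (Function.update (Function.update m.vreg 0 (T.elemVal t)) 1 (m.young.stack k).val))
    (hB 8 (by omega)) fun hh => by
      refine (Merge.exec_val (s := .young) (r := w) _ hh ?_ _).trans ?_
      · rw [Merge.reg_put, hrw]; exact hk.trans_eq hMy.2.symm
      · rw [Merge.get_put, Merge.reg_put, hrw, ← hMy.1]; rfl
  have hr0 : r2 0 = m.reg 0 := by simp [hr2]
  have hr8 : r2 8 = m.reg 8 := by simp [hr2]
  by_cases hc : (m.young.stack k).val < T.elemVal t
  · have h8 := h7.snoc (hB 9 (by omega)) fun hh =>
      Merge.exec_jumpValLt_pos _ hh (by simpa using hc) _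
    have h9 := h8.snoc (m'' := M.put (m.pc + 13) r2 (Function.update (Function.update (
        Function.update m.vreg 0 (T.elemVal t)) 1 (m.young.stack k).val) 0 (m.young.stack k).val))
      (hB 12 (by omega)) fun hh => by
        refine (Merge.exec_val (s := .young) (r := w) _ hh ?_ _).trans ?_
        · rw [Merge.reg_goto, Merge.reg_put, hrw]; exact hk.trans_eq hMy.2.symm
        · rw [Merge.get_goto, Merge.get_put, Merge.reg_goto, Merge.reg_put, hrw, ← hMy.1]; rfl
    have h10 := h9.snoc (hB 13 (by omega)) fun hh => Merge.exec_jumpEq_self _ hh 0 _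
    refine ⟨r2, _, hr0, hr8, ?_, h10.cast rfl (by omega)⟩
    simp [min_eq_right hc.le]
  · have h8 := h7.snoc (hB 9 (by omega)) fun hh =>
      Merge.exec_jumpValLt_neg _ hh (by simpa using hc) _
    -- The padding gives both branches the same length.
    have h9 := h8.snoc (hB 10 (by omega)) fun hh => Merge.exec_jumpLt_neg _ hh (lt_irrefl _) _
    have h10 := h9.snoc (hB 11 (by omega)) fun hh => Merge.exec_jumpEq_self _ hh 0 _
    refine ⟨r2, _, hr0, hr8, ?_, h10.cast rfl (by omega)⟩
    simp [min_eq_left (not_lt.1 hc)]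

/-- The second part of a round: the element is inserted into the destination. -/
theorem block_insert (m : Merge V) (hpc : m.pc = b + 14)
    (hi : m.reg 0 < (m.get s).size) (hcap : m.dest.size < m.dest.cap) :
    ∃ reg' vreg', reg' 0 = m.reg 0 ∧ reg' 8 = m.reg 8 ∧ reg' 5 = m.dest.size ∧
      reg' 6 = m.dest.top ∧ vreg' 0 = m.vreg 0 ∧
      RunsAll prog m 6 6
        (({ m with dest := m.dest.insert ((m.get s).key (m.reg 0)) 0 } : Merge V).put
          (if (m.dest.stack m.dest.top).val < m.vreg 0 then b + 26 else b + 20) reg' vreg') := by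
  set x := (m.get s).key (m.reg 0) with hx
  set M : Merge V := { m with dest := m.dest.insert x 0 } with hM
  have e0 : m = m.put (b + 14) m.reg m.vreg := by rw [← hpc]; rfl
  have h0 := (RunsAll.refl (prog := prog) m).snoc
    (m'' := m.put (b + 15) (Function.update m.reg 4 x) m.vreg)
    (by rw [hpc]; exact hB 14 (by omega)) fun hh => by
      refine (Merge.exec_key m hh hi 4).trans ?_
      rw [e0]; rfl
  have h1 := h0.snoc
    (m'' := m.put (b + 16) (Function.update (Function.update m.reg 4 x) 5 m.dest.size) m.vreg)
    (hB 15 (by omega)) fun hh => rfl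
  have h2 := h1.snoc
    (m'' := M.put (b + 17) (Function.update (Function.update m.reg 4 x) 5 m.dest.size) m.vreg)
    (c' := 0)
    (hB 16 (by omega)) fun hh => by
      refine (Merge.exec_insert (m.put (b + 16) _ _) hh hcap 4).trans ?_
      simp [hM, Merge.put, Merge.next]
  -- Register `5` now holds the number of the new element and register `6` the top level. Register
  -- `8`, which names the element inserted before, is not touched yet.
  set r2 := Function.update (Function.update (Function.update m.reg 4 x) 5 m.dest.size) 6 m.dest.top
    with hr2
  have h3 := h2.snoc (m'' := M.put (b + 18) r2 m.vreg) (hB 17 (by omega)) fun hh => rfl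
  have h4 := h3.snoc (m'' := M.put (b + 19) r2
      (Function.update m.vreg 2 (m.dest.stack m.dest.top).val)) (c' := 0) (hB 18 (by omega)) fun hh => by
      refine (Merge.exec_val (s := .dest) (r := 6) _ hh ?_ _).trans ?_
      · simp [hr2]; exact le_rfl
      · simp [hr2]; rfl
  refine ⟨r2, Function.update m.vreg 2 (m.dest.stack m.dest.top).val, by simp [hr2], by simp [hr2],
    by simp [hr2], by simp [hr2], by simp, ?_⟩
  split
  · next h =>
    exact h4.snoc (hB 19 (by omega)) fun hh => Merge.exec_jumpValLt_pos _ hh (by simpa using h) _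
  · next h =>
    exact h4.snoc (hB 19 (by omega)) fun hh => Merge.exec_jumpValLt_neg _ hh (by simpa using h) _

/-- The third part of a round, if the value is that of the top item. -/
theorem block_unite (m : Merge V) (hpc : m.pc = b + 20) (h8 : m.reg 8 < m.dest.size)
    (h5 : m.reg 5 < m.dest.size) :
    ∃ reg', reg' 0 = m.reg 0 + 1 ∧ reg' 8 = m.reg 5 ∧
      RunsAll prog m 6
        (9 + (ufDepth m.dest.uf (m.reg 8) + ufDepth (m.dest.uf.findD (m.reg 8)).1 (m.reg 5)))
        (({ m with dest := m.dest.uniteS (m.reg 8) (m.reg 5) (m.reg 6) } : Merge V).put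
          b reg' m.vreg) := by
  set M : Merge V := { m with dest := m.dest.uniteS (m.reg 8) (m.reg 5) (m.reg 6) } with hM
  have e0 : m = m.put (b + 20) m.reg m.vreg := by rw [← hpc]; rfl
  have h0 := (RunsAll.refl (prog := prog) m).snoc (m'' := M.put (b + 21) m.reg m.vreg)
    (by rw [hpc]; exact hB 20 (by omega)) fun hh => by
      refine (Merge.exec_unite m hh h8 h5 6).trans ?_
      rw [hM, Merge.next, hpc]; rfl
  -- Two idle instructions make this branch as long as the pushing one, namely six; a round takes
  -- `11 + 6 + 6 = 23`.
  have h1 := h0.trans (RunsAll.pads 2 _ fun i hi => by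
    show prog[b + 21 + i]? = _
    rw [Nat.add_assoc, hB (21 + i) (by omega)]; interval_cases i <;> rfl)
  have h2 := ((h1.snoc (hB 23 (by omega)) fun hh => Merge.exec_move _ hh 8 5).snoc
    (hB 24 (by omega)) fun hh => Merge.exec_succ _ hh 0).snoc (hB 25 (by omega))
    fun hh => Merge.exec_jumpEq_self _ hh 0 _
  exact ⟨_, by simp, by simp, h2.cast rfl (by omega)⟩

/-- The third part of a round, if the value is above that of the top item. -/
theorem block_push (m : Merge V) (hpc : m.pc = b + 26) (hcap : m.dest.top < m.dest.cap + 2)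
    (h5 : m.reg 5 < m.dest.size) :
    ∃ reg', reg' 0 = m.reg 0 + 1 ∧ reg' 8 = m.reg 5 ∧
      RunsAll prog m 6 6
        (({ m with dest := { m.dest with
          top := m.dest.top + 1
          stack := Function.update m.dest.stack (m.dest.top + 1) ⟨m.vreg 0, 0⟩
          label := Function.update m.dest.label (m.reg 5) (m.dest.top + 1) } } : Merge V).put
          b reg' m.vreg) := by
  set M₁ : Merge V := { m with dest := { m.dest with
    top := m.dest.top + 1
    stack := Function.update m.dest.stack (m.dest.top + 1) ⟨m.vreg 0, 0⟩ } } with hM₁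
  have h0 := (RunsAll.refl (prog := prog) m).snoc (m'' := M₁.put (b + 27) m.reg m.vreg)
    (by rw [hpc]; exact hB 26 (by omega)) fun hh => by
      refine (Merge.exec_push m hh hcap 0).trans ?_
      rw [hM₁, Merge.next, hpc]; rfl
  have h1 := h0.snoc
    (m'' := M₁.put (b + 28) (Function.update m.reg 6 (m.dest.top + 1)) m.vreg)
    (hB 27 (by omega)) fun hh => rfl
  have h2 := h1.snoc (hB 28 (by omega)) fun hh =>
    Merge.exec_setLabel_dest (r := 5) _ hh (by simp; exact h5) 6
  have h3 := ((h2.snoc (hB 29 (by omega)) fun hh => Merge.exec_move _ hh 8 5).snoc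
    (hB 30 (by omega)) fun hh => Merge.exec_succ _ hh 0).snoc (hB 31 (by omega))
    fun hh => Merge.exec_jumpEq_self _ hh 0 _
  refine ⟨_, ?_, ?_, h3⟩ <;> simp

end Block
end RMQ

/-! ### Transferring one element to the destination -/

namespace RMQ

open Batteries Finset MeasureTheory

theorem Struct.Wf.size_le_card {V : Type*} {T : Struct V} (hT : T.Wf) {D : Finset ℕ}
    (h : ∀ t < T.size, T.key t ∈ D) : T.size ≤ #D := by
  rw [← card_range T.size]
  exact card_le_card_of_injOn T.key (fun t ht => h t (by simpa using ht)) fun t ht u hu h =>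
    hT.key_inj (by simpa using ht) (by simpa using hu) h

variable {V : Type*} [LinearOrder V]

/-- A full structure during a merge: `w` bounds the values of its elements from the side of the
younger structure, `f` is the value that a position has in the end, and `D` contains the active
positions. -/
structure Source (f : ℕ → Val V) (act D : Finset ℕ) (w : ℕ → Val V) (T : Struct V) : Prop where
  wf : T.Wf
  lev_le : ∀ t < T.size, T.lev t ≤ T.top
  val : ∀ t < T.size, min (T.elemVal t) (w t) = f (T.key t)
  live : ∀ t < T.size, T.live t = true ↔ T.key t ∈ act
  sub : ∀ t < T.size, T.key t ∈ act → T.key t ∈ D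

/-- The destination of a merge; `r` is the element inserted last. -/
structure Target (f : ℕ → Val V) (act D : Finset ℕ) (r : ℕ) (T : Struct V) : Prop where
  wf : T.Wf
  lev_le : ∀ t < T.size, T.lev t ≤ T.top
  val : ∀ t < T.size, T.elemVal t = f (T.key t)
  live : ∀ t < T.size, T.live t = true ↔ T.key t ∈ act
  sub : ∀ t < T.size, T.key t ∈ D
  card : #D ≤ T.cap
  top_ge : 1 ≤ T.top
  top_le : T.top ≤ T.size + 1
  empty : T.size = 0 → T.top = 1 ∧ (T.stack 1).val = ⊥
  last : 0 < T.size → r + 1 = T.size ∧ T.lev r = T.top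

omit [LinearOrder V] in
theorem Target.size_le {f : ℕ → Val V} {act D : Finset ℕ} {r : ℕ} {T : Struct V}
    (h : Target f act D r T) : T.size ≤ T.cap :=
  (h.wf.size_le_card h.sub).trans h.card

section Insert

variable {f : ℕ → Val V} {act D : Finset ℕ} {r x : ℕ} {T : Struct V}

omit [LinearOrder V] in
-- A copied position keeps its place even if it is closed later. Room is therefore measured by the
-- fixed set `D`, of which the keys present and `x` are distinct members.
theorem Target.size_lt (h : Target f act D r T) (hx : 0 < x) (hlt : ∀ t < T.size, T.key t < x)
    (hD : x ∈ D) : T.size < T.cap := by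
  have h1 := (h.wf.insert 0 hx hlt).size_le_card (D := D) fun t ht => by
    rw [Struct.insert_size] at ht
    rcases Nat.lt_succ_iff_lt_or_eq.1 ht with h' | rfl
    · rw [Struct.insert_key_of_lt _ _ _ h']; exact h.sub t h'
    · rw [Struct.insert_key_size]; exact hD
  rw [Struct.insert_size] at h1
  have := h.card
  omega

/-- The invariant of the destination after an insertion, for any way to assign the level. -/
theorem Target.insert (h : Target f act D r T) (hx : 0 < x) (hlt : ∀ t < T.size, T.key t < x)
    (hD : x ∈ D) (hact : x ∈ act) {T' : Struct V} (hk : Struct.Keeps (T.insert x 0) T')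
    (hr : RankInv T'.uf) (hv : ∀ t < T.size, T'.elemVal t = T.elemVal t)
    (hl : ∀ t < T.size, T'.lev t ≤ T'.top) (hvx : T'.elemVal T.size = f x)
    (hlx : T'.lev T.size = T'.top) (htop : 1 ≤ T'.top) (htop' : T'.top ≤ T.top + 1) :
    Target f act D T.size T' := by
  have hsz : T'.size = T.size + 1 := hk.size.trans (Struct.insert_size ..)
  have hkey1 : ∀ t < T.size, T'.key t = T.key t := fun t ht => by
    rw [hk.key, Struct.insert_key_of_lt _ _ _ ht]
  have hkey2 : T'.key T.size = x := by rw [hk.key, Struct.insert_key_size]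
  refine ⟨hk.wf (h.wf.insert 0 hx hlt) hr, fun t ht => ?_, fun t ht => ?_, fun t ht => ?_,
    fun t ht => ?_, hk.cap.symm ▸ h.card, htop, ?_, fun h0 => ?_, fun _ => ⟨hsz.symm, hlx⟩⟩
  · rcases Nat.lt_succ_iff_lt_or_eq.1 (hsz ▸ ht) with h' | rfl
    · exact hl t h'
    · exact hlx.le
  · rcases Nat.lt_succ_iff_lt_or_eq.1 (hsz ▸ ht) with h' | rfl
    · rw [hv t h', hkey1 t h', h.val t h']
    · rw [hvx, hkey2]
  · rw [hk.live]
    rcases Nat.lt_succ_iff_lt_or_eq.1 (hsz ▸ ht) with h' | rfl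
    · rw [show (T.insert x 0).live t = T.live t from Function.update_of_ne (by omega) ..,
        hkey1 t h', h.live t h']
    · rw [show (T.insert x 0).live T.size = true from Function.update_self .., hkey2]
      simp [hact]
  · rcases Nat.lt_succ_iff_lt_or_eq.1 (hsz ▸ ht) with h' | rfl
    · rw [hkey1 t h']; exact h.sub t h'
    · rw [hkey2]; exact hD
  · have := h.top_le; omega
  · omega

/-- Insertion into the set of the top item. -/
theorem Target.insert_unite (h : Target f act D r T) (hx : 0 < x)
    (hlt : ∀ t < T.size, T.key t < x) (hD : x ∈ D) (hact : x ∈ act) (h0 : 0 < T.size)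
    (hv : (T.stack T.top).val = f x) :
    Target f act D T.size ((T.insert x 0).uniteS r T.size T.top) := by
  obtain ⟨hr1, hr2⟩ := h.last h0
  have hsz := Struct.insert_size T x 0
  have hr : r < (T.insert x 0).size := by omega
  have hs : T.size < (T.insert x 0).size := by omega
  obtain ⟨hst, htop⟩ := Struct.uniteS_stack hr hs T.top
  obtain ⟨-, -, -, -, hlev⟩ := Struct.unite_spec hr hs T.top
  -- The set of `r` already lies on level `T.top`, so the union moves no earlier element.
  have hl : ∀ t < T.size, ((T.insert x 0).uniteS r T.size T.top).lev t = T.lev t := by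
    intro t ht
    rw [hlev]
    simp only [Struct.insert_rootD, Struct.rootD_size]
    have h2 : T.uf.rootD t < T.size := UnionFind.rootD_lt.2 ht
    split
    · next h3 =>
      rcases h3 with h3 | h3
      · rw [Struct.lev_eq_of_rootD_eq h3, hr2]
      · omega
    · rw [Struct.insert_lev_of_lt _ _ _ ht]
  have hl' : ((T.insert x 0).uniteS r T.size T.top).lev T.size = T.top := by
    rw [hlev, if_pos (.inr rfl)]
  have htop' : ((T.insert x 0).uniteS r T.size T.top).top = T.top := htop
  refine h.insert hx hlt hD hact (Struct.uniteS_keeps hr hs _)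
    (Struct.uniteS_wf (h.wf.insert 0 hx hlt) hr hs _).rankInv (fun t ht => ?_) (fun t ht => ?_)
    ?_ ?_ ?_ ?_
  · rw [Struct.elemVal, hl t ht, hst]; rfl
  · rw [hl t ht, htop']; exact h.lev_le t ht
  · rw [Struct.elemVal, hl', hst]; exact hv
  · rw [hl', htop']
  · rw [htop']; exact h.top_ge
  · omega

/-- Insertion with a new top item. -/
theorem Target.insert_push (h : Target f act D r T) (hx : 0 < x)
    (hlt : ∀ t < T.size, T.key t < x) (hD : x ∈ D) (hact : x ∈ act) :
    Target f act D T.size { T.insert x 0 with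
      top := T.top + 1
      stack := Function.update T.stack (T.top + 1) ⟨f x, 0⟩
      label := Function.update (T.insert x 0).label T.size (T.top + 1) } := by
  set T' : Struct V := { T.insert x 0 with
      top := T.top + 1
      stack := Function.update T.stack (T.top + 1) ⟨f x, 0⟩
      label := Function.update (T.insert x 0).label T.size (T.top + 1) } with hT'
  have hlev : ∀ t, T'.lev t = if T.uf.rootD t = T.size then T.top + 1 else (T.insert x 0).lev t :=
    fun t => by
      show Function.update (T.insert x 0).label T.size (T.top + 1) ((T.insert x 0).uf.rootD t) = _
      rw [Struct.insert_rootD, Function.update_apply, Struct.lev, Struct.insert_rootD]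
  have hl : ∀ t < T.size, T'.lev t = T.lev t := fun t ht => by
    have h2 : T.uf.rootD t < T.size := UnionFind.rootD_lt.2 ht
    rw [hlev, if_neg (by omega), Struct.insert_lev_of_lt _ _ _ ht]
  have hl' : T'.lev T.size = T.top + 1 := by rw [hlev, if_pos (Struct.rootD_size T)]
  refine h.insert hx hlt hD hact ⟨rfl, rfl, rfl, rfl, rfl, rfl⟩ h.wf.rankInv.push (fun t ht => ?_)
    (fun t ht => ?_) ?_ hl' (Nat.le_add_left _ _) le_rfl
  · have := h.lev_le t ht
    rw [Struct.elemVal, hl t ht]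
    show (Function.update T.stack (T.top + 1) ⟨f x, 0⟩ (T.lev t)).val = _
    rw [Function.update_of_ne (by omega)]
    rfl
  · rw [hl t ht]; exact (h.lev_le t ht).trans (Nat.le_succ _)
  · rw [Struct.elemVal, hl']
    show (Function.update T.stack (T.top + 1) ⟨f x, 0⟩ (T.top + 1)).val = _
    rw [Function.update_self]

end Insert

section Round

variable {prog : List Instr} {s : Slot} {w b : ℕ}
  (hB : ∀ i < 72, prog[b + i]? = (block s w b)[i]?)
include hB

/-- A round of the loop. -/
theorem block_round {f : ℕ → Val V} (hf : Monotone f) (hbot : ∀ x, ⊥ < f x) {act D : Finset ℕ}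
    {m : Merge V} (hs : s ≠ .dest) (hpc : m.pc = b) (hi : m.reg 0 < (m.get s).size) {lv : ℕ → ℕ}
    (hlv : ∀ t < (m.get s).size, lv t ≤ m.young.top)
    (hw : w = 3 ∧ lv = (fun _ => 2) ∨ w = 2 ∧ lv = (m.get s).lev)
    (hS : Source f act D (fun t => (m.young.stack (lv t)).val) (m.get s))
    (hT : Target f act D (m.reg 8) m.dest)
    (hlt : ∀ u < m.dest.size, ∀ t, m.reg 0 ≤ t → t < (m.get s).size →
      m.dest.key u < (m.get s).key t) :
    ∃ (T d : Struct V) (reg' : ℕ → ℕ) (vreg' : ℕ → Val V) (c : ℕ),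
      RunsAll prog m 23 c (({ m.set T s with dest := d } : Merge V).put b reg' vreg') ∧
      reg' 0 = m.reg 0 + 1 ∧ Target f act D (reg' 8) d ∧
      T.Wf ∧ Struct.Like (m.get s) T ∧ T.live = (m.get s).live ∧ T.count = (m.get s).count ∧
      d.cap = m.dest.cap ∧
      (∀ u < m.dest.size, u < d.size ∧ d.key u = m.dest.key u) ∧
      ((m.get s).key (m.reg 0) ∈ act → ∃ u < d.size, d.key u = (m.get s).key (m.reg 0)) ∧
      (∀ u < d.size, u < m.dest.size ∨ d.key u = (m.get s).key (m.reg 0)) ∧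
      ∀ a A, (m.get s).size ≤ a → m.dest.cap ≤ a → a + 1 < ack (A - 1) 1 →
        c + (ufPot A T.uf + ufPot A d.uf) ≤
          ufPot A (m.get s).uf + ufPot A m.dest.uf + (6 * A + 27) := by
  set t := m.reg 0 with ht
  by_cases hl : (m.get s).live t = true
  · have hact := (hS.live t hi).1 hl
    have hD := hS.sub t hi hact
    have hx := hS.wf.key_pos t hi
    have hlt' : ∀ u < m.dest.size, m.dest.key u < (m.get s).key t := fun u hu =>
      hlt u hu t le_rfl hi
    have hcap := hT.size_lt hx hlt' hD
    obtain ⟨reg₁, vreg₁, h10, h18, h1v, hr1⟩ := block_value hB m hpc hi hl (hS.lev_le t hi)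
      (k := lv t) (hlv t hi) (by
        rcases hw with ⟨h1, h2⟩ | ⟨h1, h2⟩
        · exact .inl ⟨h1, by rw [h2]⟩
        · exact .inr ⟨h1, by rw [h2]⟩)
    rw [hS.val t hi] at h1v
    set T := (m.get s).findS t with hTdef
    set m₁ := (m.set T s).put (b + 14) reg₁ vreg₁ with hm₁
    have hg₁ : m₁.get s = T := by rw [hm₁, Merge.get_put]; cases s <;> rfl
    have hd₁ : m₁.dest = m.dest := by cases s <;> first | rfl | exact absurd rfl hs
    have hr₁ : m₁.reg = reg₁ := rfl
    have hTs : T.size = (m.get s).size := Struct.findS_size _ _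
    obtain ⟨reg₂, vreg₂, h20, h28, h25, h26, h2v, hr2⟩ := block_insert hB m₁ rfl
      (by rw [hr₁, h10, hg₁, hTs]; exact hi) (by rw [hd₁]; exact hcap)
    set x := (m.get s).key t with hxdef
    have hkx : (m₁.get s).key (m₁.reg 0) = x := by rw [hg₁, hr₁, h10]; rfl
    rw [hkx, hd₁] at hr2
    rw [hd₁] at h25 h26
    rw [hr₁, h10] at h20
    rw [hr₁, h18] at h28
    have hv1 : m₁.vreg 0 = f x := h1v
    rw [hv1] at hr2 h2v
    set M : Merge V := { m₁ with dest := m.dest.insert x 0 } with hM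
    have hlike := Struct.findS_like (m.get s) t
    have hins := Struct.insert_size m.dest x 0
    by_cases hc : (m.dest.stack m.dest.top).val < f x
    · rw [if_pos hc] at hr2
      obtain ⟨reg₃, h30, h38, hr3⟩ := block_push hB (M.put (b + 26) reg₂ vreg₂) rfl (by
          have := hT.top_le
          show m.dest.top < m.dest.cap + 2
          omega)
        (by show reg₂ 5 < (m.dest.insert x 0).size; omega)
      have hv2 : (M.put (b + 26) reg₂ vreg₂).vreg 0 = f x := h2v
      have hr5 : (M.put (b + 26) reg₂ vreg₂).reg 5 = m.dest.size := h25
      rw [hv2, hr5] at hr3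
      have hr := (hr1.trans hr2).trans hr3
      refine ⟨T, { m.dest.insert x 0 with
          top := m.dest.top + 1
          stack := Function.update m.dest.stack (m.dest.top + 1) ⟨f x, 0⟩
          label := Function.update (m.dest.insert x 0).label m.dest.size (m.dest.top + 1) },
        reg₃, vreg₂, _, hr, ?_, ?_, hS.wf.findS t, hlike, rfl, rfl, rfl,
        fun u hu => ⟨?_, ?_⟩, fun _ => ⟨m.dest.size, ?_, ?_⟩, fun u hu => ?_, ?_⟩
      · rw [h30]; show reg₂ 0 + 1 = _; rw [h20]
      · rw [h38]; show Target f act D (reg₂ 5) _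
        rw [h25]; exact hT.insert_push hx hlt' hD hact
      · show u < (m.dest.insert x 0).size; omega
      · exact Struct.insert_key_of_lt m.dest x 0 hu
      · show m.dest.size < (m.dest.insert x 0).size; omega
      · exact Struct.insert_key_size m.dest x 0
      · have hu : u < (m.dest.insert x 0).size := hu
        rcases Nat.lt_succ_iff_lt_or_eq.1 (hins ▸ hu) with h | rfl
        · exact .inl h
        · exact .inr (Struct.insert_key_size m.dest x 0)
      · intro a A ha hca hA
        have c1 := Struct.findS_cost hS.wf ha hA t
        rw [← hTdef] at c1
        have c2 := Struct.ufPot_insert A m.dest x 0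
        show 12 + ufDepth (m.get s).uf t + 6 + 6 +
          (ufPot A T.uf + ufPot A (m.dest.insert x 0).uf) ≤ _
        omega
    · rw [if_neg hc] at hr2
      rw [not_lt] at hc
      -- An empty destination holds only the sentinel `⊥`, which is below every value. The first
      -- element is thus pushed, and register `8` is not used for a union before it has been set.
      have h0 : 0 < m.dest.size := by
        by_contra h0
        obtain ⟨e1, e2⟩ := hT.empty (by omega)
        rw [e1, e2] at hc
        exact absurd (hbot x) (not_lt.2 hc)
      obtain ⟨hl1, hl2⟩ := hT.last h0
      -- The top value is that of the last element copied. Its key is smaller than `x` and `f` is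
      -- monotone, so the top value cannot exceed `f x`.
      have hveq : (m.dest.stack m.dest.top).val = f x := by
        refine le_antisymm ?_ hc
        have h3 := hT.val (m.reg 8) (by omega)
        rw [Struct.elemVal, hl2] at h3
        rw [h3]
        exact hf (hlt' (m.reg 8) (by omega)).le
      obtain ⟨reg₃, h30, h38, hr3⟩ := block_unite hB (M.put (b + 20) reg₂ vreg₂) rfl
        (by show reg₂ 8 < (m.dest.insert x 0).size; omega)
        (by show reg₂ 5 < (m.dest.insert x 0).size; omega)
      have hr5 : (M.put (b + 20) reg₂ vreg₂).reg 5 = m.dest.size := h25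
      have hr6 : (M.put (b + 20) reg₂ vreg₂).reg 6 = m.dest.top := h26
      have hr8 : (M.put (b + 20) reg₂ vreg₂).reg 8 = m.reg 8 := h28
      rw [hr5, hr6, hr8] at hr3
      have hz1 : m.reg 8 < (m.dest.insert x 0).size := by omega
      have hz2 : m.dest.size < (m.dest.insert x 0).size := by omega
      have hk := Struct.uniteS_keeps hz1 hz2 m.dest.top
      have hr := (hr1.trans hr2).trans hr3
      refine ⟨T, (m.dest.insert x 0).uniteS (m.reg 8) m.dest.size m.dest.top,
        reg₃, vreg₂, _, hr, ?_, ?_, hS.wf.findS t, hlike, rfl, rfl, hk.cap,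
        fun u hu => ⟨?_, ?_⟩, fun _ => ⟨m.dest.size, ?_, ?_⟩, fun u hu => ?_, ?_⟩
      · rw [h30]; show reg₂ 0 + 1 = _; rw [h20]
      · rw [h38]; show Target f act D (reg₂ 5) _
        rw [h25]; exact hT.insert_unite hx hlt' hD hact h0 hveq
      · rw [hk.size]; omega
      · rw [hk.key]; exact Struct.insert_key_of_lt m.dest x 0 hu
      · rw [hk.size]; omega
      · rw [hk.key]; exact Struct.insert_key_size m.dest x 0
      · rw [hk.size] at hu
        rw [hk.key]
        rcases Nat.lt_succ_iff_lt_or_eq.1 (hins ▸ hu) with h | rfl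
        · exact .inl h
        · exact .inr (Struct.insert_key_size m.dest x 0)
      · intro a A ha hca hA
        have c1 := Struct.findS_cost hS.wf ha hA t
        rw [← hTdef] at c1
        have c2 := Struct.ufPot_insert A m.dest x 0
        have c3 := Struct.uniteS_cost (hT.wf.insert 0 hx hlt') (a := a) (by omega) hA hz1 hz2
          m.dest.top
        -- The constants add up to `12 + 6 + 9 = 27`; the find, the new node and the union account
        -- for `A + 2 * A + 3 * A`.
        show 12 + ufDepth (m.get s).uf t + 6 + (9 + (ufDepth (m.dest.insert x 0).uf (m.reg 8) +
          ufDepth ((m.dest.insert x 0).uf.findD (m.reg 8)).1 m.dest.size)) + _ ≤ _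
        omega
  · rw [Bool.not_eq_true] at hl
    obtain ⟨reg', h0, h8, hr⟩ := block_skip hB m hpc hi hl
    have hmm : ({ m.set (m.get s) s with dest := m.dest } : Merge V) = m := by cases s <;> rfl
    refine ⟨m.get s, m.dest, reg', m.vreg, 23, by rw [hmm]; exact hr, h0, by rw [h8]; exact hT,
      hS.wf, Struct.Like.refl _, rfl, rfl, rfl, fun u hu => ⟨hu, rfl⟩, fun h => ?_,
      fun u hu => .inl hu, fun a A _ _ _ => by omega⟩
    rw [(hS.live t hi).2 h] at hl
    exact absurd hl (by simp)

end Round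
end RMQ

/-! ### The progress of a whole merge -/

namespace RMQ

open Batteries Finset MeasureTheory

theorem block_length (s : Slot) (w b : ℕ) : (block s w b).length = 72 := by simp [block]

theorem mergeProg_old : ∀ i < 72, mergeProg[23 + i]? = (block .old 3 23)[i]? := fun i hi => by
  rw [mergeProg, List.getElem?_append_left (by simp [block_length]; omega),
    List.getElem?_append_right (by simp)]
  simp

theorem mergeProg_young : ∀ i < 72, mergeProg[95 + i]? = (block .young 2 95)[i]? := fun i hi => by
  rw [mergeProg, List.getElem?_append_right (by simp [block_length])]
  simp [block_length]

theorem mergeProg_length : mergeProg.length = 167 := by simp [mergeProg, block_length]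

variable {V : Type*} [LinearOrder V]

theorem Source.like {f : ℕ → Val V} {act act' D : Finset ℕ} {w w' : ℕ → Val V} {T T' : Struct V}
    (h : Source f act D w T) (hl : T.Like T') (hw : T'.Wf)
    (hact : ∀ t < T.size, T.key t ∈ act' → T.key t ∈ act)
    (hlive : ∀ t < T.size, T'.live t = true ↔ T.key t ∈ act') (hww : ∀ t < T.size, w' t = w t) :
    Source f act' D w' T' where
  wf := hw
  lev_le t ht := by rw [hl.lev, hl.top]; exact h.lev_le t (hl.size ▸ ht)
  val t ht := by
    rw [hl.elemVal, hl.key, hww t (hl.size ▸ ht)]; exact h.val t (hl.size ▸ ht)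
  live t ht := by rw [hl.key]; exact hlive t (hl.size ▸ ht)
  sub t ht hx := by rw [hl.key] at hx ⊢; exact h.sub t (hl.size ▸ ht) (hact t (hl.size ▸ ht) hx)

omit [LinearOrder V] in
theorem Target.like {f : ℕ → Val V} {act act' D : Finset ℕ} {r : ℕ} {T T' : Struct V}
    (h : Target f act D r T) (hl : T.Like T') (hw : T'.Wf)
    (hlive : ∀ t < T.size, T'.live t = true ↔ T.key t ∈ act') : Target f act' D r T' where
  wf := hw
  lev_le t ht := by rw [hl.lev, hl.top]; exact h.lev_le t (hl.size ▸ ht)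
  val t ht := by rw [hl.elemVal, hl.key]; exact h.val t (hl.size ▸ ht)
  live t ht := by rw [hl.key]; exact hlive t (hl.size ▸ ht)
  sub t ht := by rw [hl.key]; exact h.sub t (hl.size ▸ ht)
  card := hl.cap ▸ h.card
  top_ge := hl.top ▸ h.top_ge
  top_le := by rw [hl.top, hl.size]; exact h.top_le
  empty h0 := by rw [hl.top, hl.stack]; exact h.empty (hl.size ▸ h0)
  last h0 := by rw [hl.top, hl.size, hl.lev]; exact h.last (hl.size ▸ h0)

/-- The active positions among the first `n` elements of `T` have been transferred to `d`. -/
def Moved (act : Finset ℕ) (T : Struct V) (n : ℕ) (d : Struct V) : Prop :=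
  ∀ t < n, T.key t ∈ act → ∃ u < d.size, d.key u = T.key t

/-- The positions in `d` precede those of the elements of `T` from `n` on. -/
def Precede (d T : Struct V) (n : ℕ) : Prop :=
  ∀ u < d.size, ∀ t, n ≤ t → t < T.size → d.key u < T.key t

/-- The progress of a merge; the last argument is the number of rounds that remain. -/
inductive Stage (f : ℕ → Val V) (act D : Finset ℕ) (m : Merge V) : ℕ → Prop
  | start (hpc : m.pc = 0) (wf : m.dest.Wf) (size : m.dest.size = 0) (top : m.dest.top = 2)
    (bot : (m.dest.stack 1).val = ⊥) (card : #D ≤ m.dest.cap) (hr : m.reg 0 = 0) :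
    Stage f act D m (m.old.size + m.young.size + 3)
  | old (hpc : m.pc = 23) (hT : Target f act D (m.reg 8) m.dest) {n : ℕ}
    (hn : m.reg 0 + n = m.old.size) (moved : Moved act m.old (m.reg 0) m.dest)
    (prec : Precede m.dest m.old (m.reg 0)) (prec' : Precede m.dest m.young 0) :
    Stage f act D m (n + m.young.size + 2)
  | young (hpc : m.pc = 95) (hT : Target f act D (m.reg 8) m.dest) {n : ℕ}
    (hn : m.reg 0 + n = m.young.size) (moved : Moved act m.old m.old.size m.dest)
    (moved' : Moved act m.young (m.reg 0) m.dest) (prec : Precede m.dest m.young (m.reg 0)) :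
    Stage f act D m (n + 1)
  | done (hpc : m.pc = 167) (hT : Target f act D (m.reg 8) m.dest)
    (moved : Moved act m.old m.old.size m.dest) (moved' : Moved act m.young m.young.size m.dest) :
    Stage f act D m 0

/-- The invariant of a merge of which `n` rounds remain. -/
structure Merge.Inv (f : ℕ → Val V) (act D : Finset ℕ) (m : Merge V) (n : ℕ) : Prop where
  old : Source f act D (fun _ => (m.young.stack 2).val) m.old
  young : Source f act D (fun t => m.young.elemVal t) m.young
  top_ge : 2 ≤ m.young.top
  old_lt : ∀ t < m.old.size, ∀ u < m.young.size, m.old.key t < m.young.key u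
  stage : Stage f act D m n

/-- What the merging program does not change. -/
structure Merge.Same (m m' : Merge V) : Prop where
  old : m.old.Like m'.old
  young : m.young.Like m'.young
  old_live : m'.old.live = m.old.live
  young_live : m'.young.live = m.young.live
  cap : m'.dest.cap = m.dest.cap
  age : m'.age = m.age

theorem Merge.Same.refl {V : Type*} (m : Merge V) : m.Same m :=
  ⟨.refl _, .refl _, rfl, rfl, rfl, rfl⟩

theorem Merge.Same.trans {V : Type*} {m m' m'' : Merge V} (h : m.Same m') (h' : m'.Same m'') :
    m.Same m'' :=
  ⟨h.old.trans h'.old, h.young.trans h'.young, h'.old_live.trans h.old_live,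
    h'.young_live.trans h.young_live, h'.cap.trans h.cap, h'.age.trans h.age⟩

/-- The potential of the forests of a merge. -/
def Merge.pot {V : Type*} (A : ℕ) (m : Merge V) : ℕ :=
  ufPot A m.old.uf + ufPot A m.young.uf + ufPot A m.dest.uf

/-- Removing the sentinel takes one round, each element one, and leaving each of the two loops one.
This accounts for the summand `3` at the start and makes the number of remaining rounds drop by
exactly one. -/
theorem Merge.Inv.round {f : ℕ → Val V} (hf : Monotone f) (hbot : ∀ x, ⊥ < f x)
    {act D : Finset ℕ} {m : Merge V} {n : ℕ} (h : m.Inv f act D (n + 1)) :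
    ∃ (m' : Merge V) (c : ℕ), RunsAll mergeProg m 23 c m' ∧ m'.Inv f act D n ∧ m.Same m' ∧
      ∀ a A, m.old.size ≤ a → m.young.size ≤ a → m.dest.cap ≤ a → a + 1 < ack (A - 1) 1 →
        c + m'.pot A ≤ m.pot A + (6 * A + 27) := by
  obtain ⟨ho, hy, htop, hlt, hst⟩ := h
  generalize hk : n + 1 = k at hst
  cases hst with
  | start hpc wf hs htp hb hcard hr =>
    obtain ⟨d, hd⟩ : ∃ d : Struct V, d = { m.dest with top := m.dest.top - 1 } := ⟨_, rfl⟩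
    have h1 := (RunsAll.refl (prog := mergeProg) m).snoc (i := .pop) (by rw [hpc]; rfl)
      fun hh => m.exec_pop hh
    have h2 := h1.trans (RunsAll.pads 22 _ fun i hi => by
      show mergeProg[m.pc + 1 + i]? = _
      rw [hpc]; interval_cases i <;> rfl)
    have hds : d.size = 0 := hd ▸ hs
    have hdt : d.top = 1 := by rw [hd]; show m.dest.top - 1 = 1; omega
    refine ⟨_, _, h2.cast rfl rfl, ⟨ho, hy, htop, hlt, ?_⟩, ⟨.refl _, .refl _, rfl, rfl, rfl, rfl⟩,
      fun a A _ _ _ _ => ?_⟩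
    · have e : n = m.old.size + m.young.size + 2 := by omega
      rw [e]
      refine Stage.old (m := _) (n := m.old.size) ?_ ?_ ?_ ?_ ?_ ?_
      · show m.pc + 1 + 22 = 23; omega
      · show Target f act D (m.reg 8) { m.dest with top := m.dest.top - 1 }
        rw [← hd]
        refine ⟨hd ▸ ⟨wf.key_lt, wf.key_pos, wf.count_eq, wf.lt_minPos, wf.rankInv⟩,
          fun t ht => by omega, fun t ht => by omega, fun t ht => by omega, fun t ht => by omega,
          hd ▸ hcard, hdt.ge, by omega, fun _ => ⟨hdt, hd ▸ hb⟩, fun h0 => by omega⟩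
      · show m.reg 0 + m.old.size = m.old.size; omega
      · intro t ht
        replace ht : t < m.reg 0 := ht
        omega
      · intro u hu
        replace hu : u < m.dest.size := hu
        omega
      · intro u hu
        replace hu : u < m.dest.size := hu
        omega
    · show 0 + (0 + 1) + 22 + (ufPot A m.old.uf + ufPot A m.young.uf + ufPot A m.dest.uf) ≤
        (ufPot A m.old.uf + ufPot A m.young.uf + ufPot A m.dest.uf) + _
      omega
  | @old hpc hT j hn moved prec prec' =>
    by_cases hi : m.reg 0 < m.old.size
    · obtain ⟨T, d, reg', vreg', c, hr, h0, hT', hTw, hTl, hTlive, -, hcap, hd1, hd2, hd3, hc⟩ :=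
        block_round mergeProg_old hf hbot (s := .old) (lv := fun _ => 2) (by simp) hpc hi
          (fun _ _ => htop) (.inl ⟨rfl, rfl⟩) ho hT prec
      refine ⟨_, c, hr, ⟨?_, hy, htop, ?_, ?_⟩, ⟨hTl, .refl _, hTlive, rfl, hcap, rfl⟩,
        fun a A h1 _ h3 h4 => ?_⟩
      · exact ho.like hTl hTw (fun _ _ h => h) (fun t ht => (Bool.eq_iff_iff.1 (congrFun hTlive t)).trans (ho.live t ht))
          fun t ht => rfl
      · intro t ht u hu
        show T.key t < _
        rw [hTl.key]; exact hlt t (hTl.size ▸ ht) u hu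
      · have e : n = (j - 1) + m.young.size + 2 := by omega
        rw [e]
        refine Stage.old (m := _) (n := j - 1) rfl hT' ?_ ?_ ?_ ?_
        · show reg' 0 + (j - 1) = T.size
          rw [h0, hTl.size]; show _ = m.old.size; omega
        · intro t ht hx
          replace ht : t < m.reg 0 + 1 := h0 ▸ ht
          replace hx : T.key t ∈ act := hx
          show ∃ u < d.size, d.key u = T.key t
          rw [hTl.key] at hx ⊢
          rcases Nat.lt_succ_iff_lt_or_eq.1 ht with h' | rfl
          · obtain ⟨u, hu, e⟩ := moved t h' hx
            exact ⟨u, (hd1 u hu).1, (hd1 u hu).2.trans e⟩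
          · exact hd2 hx
        · intro u hu t h1 h2
          show d.key u < T.key t
          replace h1 : m.reg 0 + 1 ≤ t := h0 ▸ h1
          replace h2 : t < m.old.size := hTl.size ▸ h2
          rw [hTl.key]
          rcases hd3 u hu with h' | h'
          · rw [(hd1 u h').2]; exact prec u h' t (by omega) h2
          · rw [h']; exact ho.wf.key_lt _ _ (by omega) h2
        · intro u hu t h1 h2
          show d.key u < m.young.key t
          rcases hd3 u hu with h' | h'
          · rw [(hd1 u h').2]; exact prec' u h' t h1 h2
          · rw [h']; exact hlt _ hi t h2
      · have := hc a A h1 h3 h4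
        show c + (ufPot A T.uf + ufPot A m.young.uf + ufPot A d.uf) ≤ ufPot A m.old.uf + _ + _ + _
        simp only [Merge.get] at this
        omega
    · obtain ⟨reg', h0, h8, hr⟩ := block_exit mergeProg_old m hpc hi
      refine ⟨_, _, hr, ⟨ho, hy, htop, hlt, ?_⟩, ⟨.refl _, .refl _, rfl, rfl, rfl, rfl⟩,
        fun a A _ _ _ _ => ?_⟩
      · have e : n = m.young.size + 1 := by omega
        rw [e]
        refine Stage.young (m := _) rfl ?_ ?_ ?_ ?_ ?_
        · show Target f act D (reg' 8) m.dest
          rw [h8]; exact hT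
        · show reg' 0 + m.young.size = m.young.size; omega
        · have e1 : m.reg 0 = m.old.size := by omega
          rw [e1] at moved; exact moved
        · intro t ht
          replace ht : t < reg' 0 := ht
          omega
        · show Precede m.dest m.young (reg' 0)
          rw [h0]; exact prec'
      · show 23 + m.pot A ≤ m.pot A + _
        omega
  | @young hpc hT j hn moved moved' prec =>
    by_cases hi : m.reg 0 < m.young.size
    · obtain ⟨T, d, reg', vreg', c, hr, h0, hT', hTw, hTl, hTlive, -, hcap, hd1, hd2, hd3, hc⟩ :=
        block_round mergeProg_young hf hbot (s := .young) (lv := m.young.lev) (by simp) hpc hi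
          hy.lev_le (.inr ⟨rfl, rfl⟩) hy hT prec
      refine ⟨_, c, hr, ⟨?_, ?_, ?_, ?_, ?_⟩, ⟨.refl _, hTl, rfl, hTlive, hcap, rfl⟩,
        fun a A _ h2 h3 h4 => ?_⟩
      · exact ho.like (.refl _) ho.wf (fun _ _ h => h) ho.live fun t ht =>
          congrArg (fun s => (s 2 : Item V).val) hTl.stack
      · exact hy.like hTl hTw (fun _ _ h => h) (fun t ht => (Bool.eq_iff_iff.1 (congrFun hTlive t)).trans (hy.live t ht))
          fun t ht => hTl.elemVal t
      · show 2 ≤ T.top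
        rw [hTl.top]; exact htop
      · intro t ht u hu
        show _ < T.key u
        rw [hTl.key]; exact hlt t ht u (hTl.size ▸ hu)
      · by_cases hj : j = 0
        · omega
        · have e : n = (j - 1) + 1 := by omega
          rw [e]
          refine Stage.young (m := _) (n := j - 1) rfl hT' ?_ ?_ ?_ ?_
          · show reg' 0 + (j - 1) = T.size
            rw [h0, hTl.size]; show _ = m.young.size; omega
          · intro t ht hx
            obtain ⟨u, hu, e⟩ := moved t ht hx
            exact ⟨u, (hd1 u hu).1, (hd1 u hu).2.trans e⟩
          · intro t ht hx
            replace ht : t < m.reg 0 + 1 := h0 ▸ ht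
            replace hx : T.key t ∈ act := hx
            show ∃ u < d.size, d.key u = T.key t
            rw [hTl.key] at hx ⊢
            rcases Nat.lt_succ_iff_lt_or_eq.1 ht with h' | rfl
            · obtain ⟨u, hu, e⟩ := moved' t h' hx
              exact ⟨u, (hd1 u hu).1, (hd1 u hu).2.trans e⟩
            · exact hd2 hx
          · intro u hu t h1 h2
            show d.key u < T.key t
            replace h1 : m.reg 0 + 1 ≤ t := h0 ▸ h1
            replace h2 : t < m.young.size := hTl.size ▸ h2
            rw [hTl.key]
            rcases hd3 u hu with h' | h'
            · rw [(hd1 u h').2]; exact prec u h' t (by omega) h2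
            · rw [h']; exact hy.wf.key_lt _ _ (by omega) h2
      · have := hc a A h2 h3 h4
        show c + (ufPot A m.old.uf + ufPot A T.uf + ufPot A d.uf) ≤ _ + ufPot A m.young.uf + _ + _
        simp only [Merge.get] at this
        omega
    · obtain ⟨reg', h0, h8, hr⟩ := block_exit mergeProg_young m hpc hi
      refine ⟨_, _, hr, ⟨ho, hy, htop, hlt, ?_⟩, ⟨.refl _, .refl _, rfl, rfl, rfl, rfl⟩,
        fun a A _ _ _ _ => ?_⟩
      · have e : n = 0 := by omega
        rw [e]
        refine Stage.done (m := _) rfl ?_ moved ?_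
        · show Target f act D (reg' 8) m.dest
          rw [h8]; exact hT
        · have e1 : m.reg 0 = m.young.size := by omega
          rw [e1] at moved'; exact moved'
      · show 23 + m.pot A ≤ m.pot A + _
        omega
  | done hpc hT moved moved' => omega

theorem Merge.Inv.rounds {f : ℕ → Val V} (hf : Monotone f) (hbot : ∀ x, ⊥ < f x)
    {act D : Finset ℕ} {m : Merge V} {n : ℕ} (j : ℕ) (h : m.Inv f act D (n + j)) :
    ∃ (m' : Merge V) (c : ℕ), RunsAll mergeProg m (j * 23) c m' ∧ m'.Inv f act D n ∧ m.Same m' ∧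
      ∀ a A, m.old.size ≤ a → m.young.size ≤ a → m.dest.cap ≤ a → a + 1 < ack (A - 1) 1 →
        c + m'.pot A ≤ m.pot A + j * (6 * A + 27) := by
  induction j generalizing m with
  | zero => exact ⟨m, 0, (RunsAll.refl m).cast (by simp) rfl, h, .refl m, fun a A _ _ _ _ => by simp⟩
  | succ j ih =>
    obtain ⟨m₁, c₁, hr₁, h₁, hs₁, hc₁⟩ := Merge.Inv.round hf hbot (n := n + j) h
    obtain ⟨m₂, c₂, hr₂, h₂, hs₂, hc₂⟩ := ih h₁
    refine ⟨m₂, _, (hr₁.trans hr₂).cast (by ring) rfl, h₂, hs₁.trans hs₂, fun a A a1 a2 a3 a4 => ?_⟩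
    have b1 := hc₁ a A a1 a2 a3 a4
    have b2 := hc₂ a A (hs₁.old.size ▸ a1) (hs₁.young.size ▸ a2) (hs₁.cap ▸ a3) a4
    rw [Nat.succ_mul]
    omega

theorem Merge.Inv.pc_eq {f : ℕ → Val V} {act D : Finset ℕ} {m : Merge V} {n : ℕ}
    (h : m.Inv f act D n) : mergeProg.length ≤ m.pc ↔ n = 0 := by
  rw [mergeProg_length]
  cases h.stage <;> omega

/-- The number of instructions of the merging program per command. -/
def instrPerCmd : ℕ := 115

theorem Merge.Inv.steps {f : ℕ → Val V} (hf : Monotone f) (hbot : ∀ x, ⊥ < f x)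
    {act D : Finset ℕ} {m : Merge V} {n : ℕ} (h : m.Inv f act D n) :
    ∃ (m' : Merge V) (c : ℕ),
      (∀ hh, (m.rehash hh).steps mergeProg instrPerCmd = some (m'.rehash hh, c)) ∧
      m'.Inv f act D (n - 5) ∧ m.Same m' ∧
      ∀ a A, m.old.size ≤ a → m.young.size ≤ a → m.dest.cap ≤ a → a + 1 < ack (A - 1) 1 →
        c + m'.pot A ≤ m.pot A + 5 * (6 * A + 27) := by
  -- The `115` instructions of a command are five rounds of `23`. If fewer rounds remain, the
  -- program ends and the rest of the budget is not used.
  obtain ⟨j, hj⟩ : ∃ j, j = min n 5 := ⟨_, rfl⟩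
  have e : n = (n - 5) + j := by omega
  rw [e] at h
  obtain ⟨m', c, hr, hi, hs, hc⟩ := Merge.Inv.rounds hf hbot j h
  refine ⟨m', c, fun hh => ?_, hi, hs, fun a A a1 a2 a3 a4 => (hc a A a1 a2 a3 a4).trans ?_⟩
  · have h1 := hr hh (115 - j * 23)
    rw [show j * 23 + (115 - j * 23) = 115 by omega] at h1
    rw [instrPerCmd, h1]
    have h2 : (m'.rehash hh).steps mergeProg (115 - j * 23) = some (m'.rehash hh, 0) := by
      by_cases h5 : j = 5
      · rw [h5]; rfl
      · obtain ⟨i, hi'⟩ : ∃ i, 115 - j * 23 = i + 1 := ⟨114 - j * 23, by omega⟩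
        rw [hi', Merge.steps]
        have : mergeProg[(m'.rehash hh).pc]? = none := by
          rw [List.getElem?_eq_none_iff]
          exact hi.pc_eq.2 (by omega)
        rw [this]
    rw [h2]
    rfl
  · gcongr
    omega
end RMQ

namespace RMQ

open Batteries Finset MeasureTheory

/-! ## Minima of segments -/

section Seg

variable {V : Type*} [LinearOrder V]

/-- The minimum of the values in the places `i, …, j - 1`. -/
def seg (l : List V) (i j : ℕ) : Val V :=
  ((l.take j).drop i).foldr (fun v m => min (Val.of v) m) ⊤

theorem foldr_min_append (l l' : List V) :
    (l ++ l').foldr (fun v m => min (Val.of v) m) ⊤ =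
      min (l.foldr (fun v m => min (Val.of v) m) ⊤)
        (l'.foldr (fun v m => min (Val.of v) m) ⊤) := by
  induction l with
  | nil => simp
  | cons v l ih => simp only [List.cons_append, List.foldr_cons, ih, min_assoc]

theorem bot_lt_seg (l : List V) (i j : ℕ) : ⊥ < seg l i j := by
  rw [seg]
  generalize (l.take j).drop i = l'
  induction l' with
  | nil => exact WithBot.bot_lt_coe _
  | cons v l ih => exact lt_min (WithBot.bot_lt_coe _) ih

theorem seg_of_le (l : List V) {i j : ℕ} (h : j ≤ i) : seg l i j = ⊤ := by
  rw [seg, List.drop_eq_nil_of_le ((List.length_take_le ..).trans h)]; rfl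

theorem seg_concat (l : List V) {i k j : ℕ} (h : i ≤ k) (h' : k ≤ j) :
    min (seg l i k) (seg l k j) = seg l i j := by
  have e1 : (l.take k).drop i = ((l.take j).drop i).take (k - i) := by
    rw [← List.drop_take, List.take_take, Nat.min_eq_left h']
  have e2 : (l.take j).drop k = ((l.take j).drop i).drop (k - i) := by
    rw [List.drop_drop, Nat.add_sub_cancel' h]
  rw [seg, seg, seg, ← foldr_min_append, e1, e2, List.take_append_drop]

/-- This monotonicity is what lets the destination be filled by pushing only. -/
theorem seg_mono (l : List V) (j : ℕ) {i i' : ℕ} (h : i ≤ i') : seg l i j ≤ seg l i' j := by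
  by_cases hj : i' ≤ j
  · rw [← seg_concat l h hj]; exact min_le_right _ _
  · rw [seg_of_le l (le_of_not_ge hj)]; exact le_top

theorem seg_of_prefix {l l' : List V} (h : l <+: l') (i : ℕ) {j : ℕ} (hj : j ≤ l.length) :
    seg l' i j = seg l i j := by
  obtain ⟨l'', rfl⟩ := h
  rw [seg, seg, List.take_append_of_le_length hj]

theorem seg_snoc_self (l : List V) (v : V) :
    seg (l ++ [v]) l.length (l.length + 1) = Val.of v := by
  rw [seg, List.take_of_length_le (by simp)]
  simp [Val.of]

theorem seg_snoc (l : List V) (v : V) {i : ℕ} (h : i ≤ l.length) :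
    seg (l ++ [v]) i (l.length + 1) = min (seg l i l.length) (Val.of v) := by
  rw [← seg_concat _ h (Nat.le_succ _), seg_snoc_self, seg_of_prefix (List.prefix_append ..) _ le_rfl]

theorem Hist.rmq_eq_seg (h : Hist V) (i : ℕ) : h.rmq i = seg h.vals (i - 1) h.vals.length := by
  rw [seg, List.take_length]; rfl

end Seg

/-! ## Invariants of the procedure -/

/-- `T'` arises from `T` by path compression and by closing positions outside `p`. -/
structure Struct.Upd {V : Type*} (p : ℕ → Prop) (T T' : Struct V) : Prop where
  like : T.Like T'
  wf : T'.Wf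
  live : ∀ t < T.size, T'.live t = true ↔ T.live t = true ∧ p (T.key t)

theorem Struct.Upd.refl {V : Type*} {T : Struct V} (hT : T.Wf) : T.Upd (fun _ => True) T :=
  ⟨.refl T, hT, fun _ _ => by simp⟩

/-- `h'` is a later history than `h`; among the positions that were marked in `h`, those outside
`p` have been closed. -/
structure Hist.Ext {V : Type*} (p : ℕ → Prop) (h h' : Hist V) : Prop where
  vals : h.vals <+: h'.vals
  marked : h.marked ⊆ h'.marked
  act : ∀ x ∈ h.marked, x ∈ h'.act ↔ x ∈ h.act ∧ p x

variable {V : Type*} [LinearOrder V]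

/-- A full structure for positions up to `e`. -/
structure Full (h : Hist V) (e : ℕ) (T : Struct V) : Prop where
  wf : T.Wf
  lev_le : ∀ t < T.size, T.lev t ≤ T.top
  key_le : ∀ t < T.size, T.key t ≤ e
  marked : ∀ t < T.size, T.key t ∈ h.marked
  val : ∀ t < T.size, T.elemVal t = seg h.vals (T.key t - 1) e
  live : ∀ t < T.size, T.live t = true ↔ T.key t ∈ h.act
  empty : T.size = 0 → T.top < 2
  le_length : e ≤ h.vals.length
  size_le : T.size ≤ T.cap
  top_le : T.top ≤ T.cap + 2

/-- Values read later do not concern a full structure, since its segments end at `e`. -/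
theorem Full.upd {h h' : Hist V} {p : ℕ → Prop} {e : ℕ} {T T' : Struct V} (hT : Full h e T)
    (hh : h.Ext p h') (hu : T.Upd p T') : Full h' e T' := by
  have hl := hu.like
  refine ⟨hu.wf, ?_, ?_, ?_, ?_, ?_, ?_, hT.le_length.trans hh.vals.length_le, ?_, ?_⟩ <;>
    simp only [hl.size, hl.key, hl.cap, hl.top, hl.lev, hl.elemVal]
  · exact hT.lev_le
  · exact hT.key_le
  · exact fun t ht => hh.marked (hT.marked t ht)
  · intro t ht
    rw [hT.val t ht, seg_of_prefix hh.vals _ hT.le_length]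
  · intro t ht
    rw [hu.live t ht, hT.live t ht, hh.act _ (hT.marked t ht)]
  · exact hT.empty
  · exact hT.size_le
  · exact hT.top_le

/-- The invariant of a merge for positions up to `e`, while the active structure supports `b`
elements. -/
structure Merging (h : Hist V) (l b e : ℕ) (m : Merge V) (e₁ : ℕ) (D : Finset ℕ) (n : ℕ) :
    Prop where
  inv : m.Inv (fun x => seg h.vals (x - 1) e) h.act D n
  old : Full h e₁ m.old
  le : e₁ ≤ e
  le_length : e ≤ h.vals.length
  lt_key : ∀ t < m.young.size, e₁ < m.young.key t
  key_le : ∀ t < m.young.size, m.young.key t ≤ e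
  marked : ∀ t < m.young.size, m.young.key t ∈ h.marked
  stack : (m.young.stack 2).val = seg h.vals e₁ e
  sub : D ⊆ h.marked
  bound : ∀ x ∈ D, x ≤ e
  size_pos : 0 < m.young.size
  size_le : m.young.size ≤ m.young.cap
  top_le : m.young.top ≤ m.young.cap + 2
  old_cap : m.old.cap ≤ 2 * l
  young_cap : m.young.cap ≤ 2 * l
  dest_cap : m.dest.cap ≤ 2 * l
  dest_cap' : m.dest.cap ≤ 2 * b
  cap : b = (m.old.cap + m.young.cap + 1) / 2
  rounds : n ≤ 5 * (b - m.age)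
  age : m.age < b

/-- `m'` arises from `m` by path compression and by closing positions outside `p`. -/
structure Merge.Upd {V : Type*} (p : ℕ → Prop) (m m' : Merge V) : Prop where
  get : ∀ s, (m.get s).Upd p (m'.get s)
  pc : m'.pc = m.pc
  reg : m'.reg = m.reg
  age : m'.age = m.age

omit [LinearOrder V] in
-- A command meets a merge only between two rounds. Compression and closing leave keys, levels,
-- registers and the place in the program alone, and `Close` reaches the sources and the copies
-- alike, so the stage persists.
theorem Stage.upd {f : ℕ → Val V} {act act' D : Finset ℕ} {m m' : Merge V} {n : ℕ} {p : ℕ → Prop}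
    (h : Stage f act D m n) (hu : m.Upd p m')
    (hact : ∀ s, s ≠ .dest → ∀ t < (m.get s).size, (m.get s).key t ∈ act' → (m.get s).key t ∈ act)
    (hact' : ∀ x ∈ D, x ∈ act' ↔ x ∈ act ∧ p x) :
    Stage f act' D m' n := by
  have ho := hu.get .old
  have hy := hu.get .young
  have hd := hu.get .dest
  have ao := hact .old (by simp)
  have ay := hact .young (by simp)
  simp only [Merge.get] at ho hy hd ao ay
  have hT : ∀ {r}, Target f act D r m.dest → Target f act' D r m'.dest := fun hT =>
    hT.like hd.like hd.wf fun t ht => by rw [hd.live t ht, hT.live t ht, hact' _ (hT.sub t ht)]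
  have hmo : ∀ {k}, k ≤ m.old.size → Moved act m.old k m.dest → Moved act' m'.old k m'.dest := by
    intro k hk hm t ht hx
    rw [ho.like.key] at hx ⊢
    rw [hd.like.size, hd.like.key]
    exact hm t ht (ao t (by omega) hx)
  have hmy : ∀ {k}, k ≤ m.young.size → Moved act m.young k m.dest →
      Moved act' m'.young k m'.dest := by
    intro k hk hm t ht hx
    rw [hy.like.key] at hx ⊢
    rw [hd.like.size, hd.like.key]
    exact hm t ht (ay t (by omega) hx)
  have hpo : ∀ {k}, Precede m.dest m.old k → Precede m'.dest m'.old k := by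
    intro k hp u h' t h1 h2
    rw [hd.like.size] at h'
    rw [ho.like.size] at h2
    rw [hd.like.key, ho.like.key]
    exact hp u h' t h1 h2
  have hpy : ∀ {k}, Precede m.dest m.young k → Precede m'.dest m'.young k := by
    intro k hp u h' t h1 h2
    rw [hd.like.size] at h'
    rw [hy.like.size] at h2
    rw [hd.like.key, hy.like.key]
    exact hp u h' t h1 h2
  cases h with
  | start hpc wf hs ht hb hc hr =>
    rw [← ho.like.size, ← hy.like.size]
    exact .start (hu.pc.trans hpc) hd.wf (hd.like.size.trans hs) (hd.like.top.trans ht)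
      (by rw [hd.like.stack]; exact hb) (hd.like.cap ▸ hc) (by rw [hu.reg]; exact hr)
  | old hpc hT' hn hm hp hp' =>
    rw [← hy.like.size]
    exact .old (hu.pc.trans hpc) (by rw [hu.reg]; exact hT hT')
      (by rw [hu.reg, ho.like.size]; exact hn) (by rw [hu.reg]; exact hmo (by omega) hm)
      (by rw [hu.reg]; exact hpo hp) (hpy hp')
  | young hpc hT' hn hm hm' hp =>
    exact .young (hu.pc.trans hpc) (by rw [hu.reg]; exact hT hT')
      (by rw [hu.reg, hy.like.size]; exact hn) (by rw [ho.like.size]; exact hmo le_rfl hm)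
      (by rw [hu.reg]; exact hmy (by omega) hm') (by rw [hu.reg]; exact hpy hp)
  | done hpc hT' hm hm' =>
    exact .done (hu.pc.trans hpc) (by rw [hu.reg]; exact hT hT')
      (by rw [ho.like.size]; exact hmo le_rfl hm) (by rw [hy.like.size]; exact hmy le_rfl hm')

theorem Merging.upd {h h' : Hist V} {p : ℕ → Prop} {l b e e₁ n : ℕ} {D : Finset ℕ} {m m' : Merge V}
    (hm : Merging h l b e m e₁ D n) (hh : h.Ext p h') (hu : m.Upd p m') :
    Merging h' l b e m' e₁ D n := by
  have ho : m.old.Upd p m'.old := hu.get .old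
  have hy : m.young.Upd p m'.young := hu.get .young
  have hd : m.dest.Upd p m'.dest := hu.get .dest
  have hf : (fun x => seg h'.vals (x - 1) e) = fun x => seg h.vals (x - 1) e :=
    funext fun x => seg_of_prefix hh.vals _ hm.le_length
  have hao : ∀ t < m.old.size, m.old.key t ∈ h'.act → m.old.key t ∈ h.act := fun t ht hx =>
    ((hh.act _ (hm.old.marked t ht)).1 hx).1
  have hay : ∀ t < m.young.size, m.young.key t ∈ h'.act → m.young.key t ∈ h.act := fun t ht hx =>
    ((hh.act _ (hm.marked t ht)).1 hx).1
  refine ⟨⟨?_, ?_, hy.like.top ▸ hm.inv.top_ge, ?_, ?_⟩, hm.old.upd hh ho, hm.le,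
    hm.le_length.trans hh.vals.length_le, ?_, ?_, ?_, ?_, hm.sub.trans hh.marked, hm.bound,
    hy.like.size ▸ hm.size_pos, ?_, ?_, ?_, ?_, ?_, ?_, ?_, ?_, ?_⟩
  · rw [hf]
    exact hm.inv.old.like ho.like ho.wf hao
      (fun t ht => by rw [ho.live t ht, hm.inv.old.live t ht, hh.act _ (hm.old.marked t ht)])
      fun t ht => by rw [hy.like.stack]
  · rw [hf]
    exact hm.inv.young.like hy.like hy.wf hay
      (fun t ht => by rw [hy.live t ht, hm.inv.young.live t ht, hh.act _ (hm.marked t ht)])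
      fun t ht => hy.like.elemVal t
  · rw [ho.like.size, hy.like.size, ho.like.key, hy.like.key]; exact hm.inv.old_lt
  · rw [hf]
    refine hm.inv.stage.upd hu (fun s hs => ?_) fun x hx => hh.act x (hm.sub hx)
    cases s
    · exact hao
    · exact hay
    · exact absurd rfl hs
  · rw [hy.like.size, hy.like.key]; exact hm.lt_key
  · rw [hy.like.size, hy.like.key]; exact hm.key_le
  · rw [hy.like.size, hy.like.key]; exact fun t ht => hh.marked (hm.marked t ht)
  · rw [hy.like.stack, hm.stack, seg_of_prefix hh.vals _ hm.le_length]
  · rw [hy.like.size, hy.like.cap]; exact hm.size_le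
  · rw [hy.like.top, hy.like.cap]; exact hm.top_le
  · rw [ho.like.cap]; exact hm.old_cap
  · rw [hy.like.cap]; exact hm.young_cap
  · rw [hd.like.cap]; exact hm.dest_cap
  · rw [hd.like.cap]; exact hm.dest_cap'
  · rw [ho.like.cap, hy.like.cap]; exact hm.cap
  · rw [hu.age]; exact hm.rounds
  · rw [hu.age]; exact hm.age

namespace Phase

/-- The invariant of the structures besides the active one, for positions up to `e`. -/
def Inv (h : Hist V) (l b e : ℕ) : Phase V → Prop
  | .single => e = 0
  | .waiting T => Full h e T ∧ T.cap ≤ 2 * b ∧ T.cap ≤ 2 * l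
  | .merging m => ∃ e₁ D n, Merging h l b e m e₁ D n

/-- `q'` arises from `q` by path compression and by closing positions outside `p`. -/
def Upd {V : Type*} (p : ℕ → Prop) : Phase V → Phase V → Prop
  | .single, .single => True
  | .waiting T, .waiting T' => T.Upd p T'
  | .merging m, .merging m' => m.Upd p m'
  | _, _ => False

/-- `x` is a position of an element of a full structure. -/
def HasKey {V : Type*} (x : ℕ) : Phase V → Prop
  | .single => False
  | .waiting T => ∃ t < T.size, T.key t = x
  | .merging m => (∃ t < m.old.size, m.old.key t = x) ∨ ∃ t < m.young.size, m.young.key t = x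

theorem Inv.upd {h h' : Hist V} {p : ℕ → Prop} {l b e : ℕ} {q q' : Phase V} (hq : q.Inv h l b e)
    (hh : h.Ext p h') (hu : q.Upd p q') : q'.Inv h' l b e := by
  match q, q', hu with
  | .single, .single, _ => exact hq
  | .waiting T, .waiting T', hu =>
    exact ⟨hq.1.upd hh hu, hu.like.cap ▸ hq.2.1, hu.like.cap ▸ hq.2.2⟩
  | .merging m, .merging m', hu =>
    obtain ⟨e₁, D, n, hm⟩ := hq
    exact ⟨e₁, D, n, hm.upd hh hu⟩

theorem Upd.hasKey {V : Type*} {p : ℕ → Prop} {q q' : Phase V} (hu : q.Upd p q') (x : ℕ) :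
    q'.HasKey x ↔ q.HasKey x := by
  match q, q', hu with
  | .single, .single, _ => rfl
  | .waiting T, .waiting T', hu => simp only [HasKey, hu.like.size, hu.like.key]
  | .merging m, .merging m', hu =>
    have ho : m.old.Upd p m'.old := hu.get .old
    have hy : m.young.Upd p m'.young := hu.get .young
    simp only [HasKey, ho.like.size, ho.like.key, hy.like.size, hy.like.key]

theorem Inv.le_length {h : Hist V} {l b e : ℕ} {q : Phase V} (hq : q.Inv h l b e) :
    e ≤ h.vals.length := by
  match q, hq with
  | .single, hq => exact (Nat.le_zero.2 hq).trans (Nat.zero_le _)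
  | .waiting T, hq => exact hq.1.le_length
  | .merging m, ⟨e₁, D, n, hm⟩ => exact hm.le_length

theorem Inv.key_le {h : Hist V} {l b e x : ℕ} {q : Phase V} (hq : q.Inv h l b e)
    (hx : q.HasKey x) : x ≤ e := by
  match q, hq, hx with
  | .waiting T, hq, ⟨t, ht, hx⟩ => exact hx ▸ hq.1.key_le t ht
  | .merging m, ⟨e₁, D, n, hm⟩, .inl ⟨t, ht, hx⟩ => exact hx ▸ (hm.old.key_le t ht).trans hm.le
  | .merging m, ⟨e₁, D, n, hm⟩, .inr ⟨t, ht, hx⟩ => exact hx ▸ hm.key_le t ht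

end Phase
end RMQ

namespace RMQ

open Batteries Finset MeasureTheory

/-! ## Processing a command -/

variable {V : Type*} [LinearOrder V]

theorem Merge.Inv.dest {f : ℕ → Val V} {act D : Finset ℕ} {m : Merge V} {n : ℕ}
    (hm : m.Inv f act D n) : m.dest.Wf ∧ m.dest.size ≤ m.dest.cap ∧ m.dest.top ≤ m.dest.cap + 2 := by
  have hT : ∀ {r}, Target f act D r m.dest →
      m.dest.Wf ∧ m.dest.size ≤ m.dest.cap ∧ m.dest.top ≤ m.dest.cap + 2 := fun hT => by
    have h1 := hT.size_le
    have h2 := hT.top_le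
    exact ⟨hT.wf, h1, by omega⟩
  cases hm.stage with
  | start hpc wf hs ht => exact ⟨wf, by omega, by omega⟩
  | old hpc h' => exact hT h'
  | young hpc h' => exact hT h'
  | done hpc h' => exact hT h'

namespace Phase

/-- The phase with the same contents, hashed by other functions. -/
def rehash {V : Type*} (hh : Slot → ℕ → ℕ) : Phase V → Phase V
  | .single => .single
  | .waiting T => .waiting (T.rehash (hh .dest))
  | .merging m => .merging (m.rehash hh)

/-- The random hash functions suit the sizes of the structures. -/
def Hashed {V Ω : Type*} [MeasurableSpace Ω] (P : Measure Ω) (hh : Ω → Slot → ℕ → ℕ) :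
    Phase V → Prop
  | .single => True
  | .waiting T => UnivHash P (fun ω => hh ω .dest) T.cap
  | .merging m => ∀ s, UnivHash P (fun ω => hh ω s) (m.get s).cap

/-- The potential of the forests of a phase. -/
def pot {V : Type*} (A : ℕ) : Phase V → ℕ
  | .single => 0
  | .waiting T => ufPot A T.uf
  | .merging m => m.pot A

theorem Upd.hashed {V Ω : Type*} [MeasurableSpace Ω] {P : Measure Ω} {hh : Ω → Slot → ℕ → ℕ}
    {p : ℕ → Prop} {q q' : Phase V} (hu : q.Upd p q') (hq : q.Hashed P hh) : q'.Hashed P hh := by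
  match q, q', hu with
  | .single, .single, _ => exact hq
  | .waiting T, .waiting T', hu => rw [Hashed, hu.like.cap]; exact hq
  | .merging m, .merging m', hu => intro s; rw [(hu.get s).like.cap]; exact hq s

theorem Inv.upd_refl {h : Hist V} {l b e : ℕ} {q : Phase V} (hq : q.Inv h l b e) :
    q.Upd (fun _ => True) q := by
  match q, hq with
  | .single, _ => trivial
  | .waiting T, hq => exact .refl hq.1.wf
  | .merging m, ⟨e₁, D, n, hm⟩ =>
    refine ⟨fun s => .refl ?_, rfl, rfl, rfl⟩
    cases s
    · exact hm.old.wf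
    · exact hm.inv.young.wf
    · exact hm.inv.dest.1

/-- During a merge, the value of an old element covers the segment up to `e₁`, and level `2` of the
young structure covers the rest up to `e`. For a young element all old positions are smaller, so the
old structure answers `⊤`. -/
theorem Inv.query {h : Hist V} {l b e : ℕ} {q : Phase V} (hq : q.Inv h l b e) (i : ℕ) :
    ∃ (q' : Phase V) (ans : Val V) (τ : (Slot → ℕ → ℕ) → ℕ),
      (∀ hh, (q.rehash hh).query i = (q'.rehash hh, ans, τ hh)) ∧ q.Upd (fun _ => True) q' ∧
      (q.HasKey i → ans = seg h.vals (i - 1) e) ∧ (e < i → ans = ⊤) ∧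
      ∀ {Ω : Type*} [MeasurableSpace Ω] (P : Measure Ω) [IsProbabilityMeasure P]
        (hs : Ω → Slot → ℕ → ℕ) (A : ℕ), q.Hashed P hs → 2 * l + 1 < ack (A - 1) 1 →
        Avg P (fun ω => τ (hs ω) + q'.pot A) (q.pot A + 2 * (A + 4)) := by
  match q, hq with
  | .single, hq =>
    refine ⟨.single, ⊤, fun _ => 0, fun hh => rfl, trivial, fun h => h.elim, fun _ => rfl,
      fun P _ hs A _ _ => (Avg.const 0).mono (fun _ => le_rfl) (Nat.zero_le _)⟩
  | .waiting T, ⟨hT, _, hcap⟩ =>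
    obtain ⟨T', ans, hr, hw, hl, hlive, -, ha1, -, ha3, hc⟩ := Struct.query_spec hT.wf i
    refine ⟨.waiting T', ans, fun hh => ((T.rehash (hh .dest)).query i).2.2, fun hh => ?_,
      ⟨hl, hw, fun t ht => by rw [hlive]; simp⟩, fun ⟨t, ht, hx⟩ => ?_, fun he => ?_,
      fun P _ hs A hu hA => ?_⟩
    · simp only [rehash, Phase.query, (hr _).1, (hr _).2]
    · rw [ha1 t ht hx, hT.val t ht, hx]
    · refine ha3 (fun t ht => ?_) ?_
      · have := hT.key_le t ht; omega
      -- In a structure without elements every `i` counts as smaller than all positions. Such a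
      -- structure arises when nothing active was left to copy; its stack has lost level `2`, and
      -- the test of the stack height makes it answer `⊤`.
      · by_cases h0 : T.size = 0
        · exact .inr (hT.empty h0)
        · exact .inl ⟨0, by omega, (hT.key_le 0 (by omega)).trans he.le⟩
    · exact (hc P _ T.cap A hu hT.size_le (by omega)).mono (fun ω => le_rfl)
        (by simp only [pot]; omega)
  | .merging m, ⟨e₁, D, n, hm⟩ =>
    obtain ⟨T, ans, hr, hw, hl, hlive, -, ha1, -, ha3, hc⟩ := Struct.query_spec hm.old.wf i
    obtain ⟨T', ans', hr', hw', hl', hlive', -, hb1, hb2, hb3, hc'⟩ :=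
      Struct.query_spec hm.inv.young.wf i
    have hempty : (∀ t < m.old.size, m.old.key t < i) → ans = ⊤ := fun hlt => by
      refine ha3 (fun t ht => (hlt t ht).ne) ?_
      by_cases h0 : m.old.size = 0
      · exact .inr (hm.old.empty h0)
      · exact .inl ⟨0, by omega, (hlt 0 (by omega)).le⟩
    refine ⟨.merging { m with old := T, young := T' }, min ans ans', fun hh =>
      ((m.old.rehash (hh .old)).query i).2.2 + ((m.young.rehash (hh .young)).query i).2.2,
      fun hh => ?_, ⟨fun s => ?_, rfl, rfl, rfl⟩, fun hk => ?_, fun he => ?_,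
      fun P _ hs A hu hA => ?_⟩
    · simp only [rehash, Phase.query, Merge.rehash, (hr _).1, (hr _).2, (hr' _).1, (hr' _).2]
    · cases s
      · exact ⟨hl, hw, fun t ht => by show T.live t = true ↔ _; rw [hlive]; simp [Merge.get]⟩
      · exact ⟨hl', hw', fun t ht => by show T'.live t = true ↔ _; rw [hlive']; simp [Merge.get]⟩
      · exact .refl hm.inv.dest.1
    · rcases hk with ⟨t, ht, hx⟩ | ⟨t, ht, hx⟩
      · have h1 := hm.old.key_le t ht
        rw [ha1 t ht hx, hm.old.val t ht, hx, hb2 (fun u hu => ?_) hm.inv.top_ge, hm.stack]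
        · exact seg_concat _ (by omega) hm.le
        · have := hm.lt_key u hu; omega
      · have h1 := hm.lt_key t ht
        have h2 := hm.inv.young.val t ht
        rw [min_self] at h2
        rw [hempty fun u hu => (hm.old.key_le u hu).trans_lt (hx ▸ h1), hb1 t ht hx, h2, hx,
          min_eq_right le_top]
    · rw [hempty fun u hu => ((hm.old.key_le u hu).trans hm.le).trans_lt he,
        hb3 (fun u hu => ((hm.key_le u hu).trans_lt he).ne)
          (.inl ⟨0, hm.size_pos, (hm.key_le 0 hm.size_pos).trans he.le⟩), min_self]
    · have c1 := hc P _ m.old.cap A (hu .old) hm.old.size_le (by have := hm.old_cap; omega)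
      have c2 := hc' P _ m.young.cap A (hu .young) hm.size_le (by have := hm.young_cap; omega)
      refine ((c1.add c2).add_const (ufPot A m.dest.uf)).mono (fun ω => ?_) ?_
      · simp only [pot, Merge.pot]; omega
      · simp only [pot, Merge.pot]; omega

theorem Inv.close {h : Hist V} {l b e : ℕ} {q : Phase V} (hq : q.Inv h l b e) (i : ℕ) :
    ∃ (q' : Phase V) (τ : (Slot → ℕ → ℕ) → ℕ),
      (∀ hh, (q.rehash hh).close i = (q'.rehash hh, τ hh)) ∧ q.Upd (fun x => x ≠ i) q' ∧
      ∀ {Ω : Type*} [MeasurableSpace Ω] (P : Measure Ω) [IsProbabilityMeasure P]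
        (hs : Ω → Slot → ℕ → ℕ) (A : ℕ), q.Hashed P hs →
        Avg P (fun ω => τ (hs ω) + q'.pot A) (q.pot A + 9) := by
  match q, hq with
  | .single, hq =>
    exact ⟨.single, fun _ => 0, fun hh => rfl, trivial,
      fun P _ hs A _ => (Avg.const 0).mono (fun _ => le_rfl) (Nat.zero_le _)⟩
  | .waiting T, ⟨hT, _, hcap⟩ =>
    obtain ⟨T', hr, hw, hl, huf, hlive, hc⟩ := Struct.close_spec hT.wf i
    refine ⟨.waiting T', fun hh => ((T.rehash (hh .dest)).close i).2, fun hh => ?_,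
      ⟨hl, hw, hlive⟩, fun P _ hs A hu => ?_⟩
    · simp only [rehash, Phase.close, hr]
    · refine ((hc P _ T.cap hu hT.size_le).add_const (ufPot A T.uf)).mono (fun ω => ?_) ?_
      · simp only [pot, huf]; exact le_rfl
      · simp only [pot]; omega
  | .merging m, ⟨e₁, D, n, hm⟩ =>
    obtain ⟨T, hr, hw, hl, huf, hlive, hc⟩ := Struct.close_spec hm.old.wf i
    obtain ⟨T', hr', hw', hl', huf', hlive', hc'⟩ := Struct.close_spec hm.inv.young.wf i
    obtain ⟨hdw, hds, -⟩ := hm.inv.dest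
    obtain ⟨d, hrd, hwd, hld, hufd, hlived, hcd⟩ := Struct.close_spec hdw i
    refine ⟨.merging { m with old := T, young := T', dest := d }, fun hh =>
      ((m.old.rehash (hh .old)).close i).2 + ((m.young.rehash (hh .young)).close i).2 +
        ((m.dest.rehash (hh .dest)).close i).2,
      fun hh => ?_, ⟨fun s => ?_, rfl, rfl, rfl⟩, fun P _ hs A hu => ?_⟩
    · simp only [rehash, Phase.close, Merge.rehash, hr, hr', hrd]
    · cases s
      · exact ⟨hl, hw, hlive⟩
      · exact ⟨hl', hw', hlive'⟩
      · exact ⟨hld, hwd, hlived⟩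
    · have c1 := hc P _ m.old.cap (hu .old) hm.old.size_le
      have c2 := hc' P _ m.young.cap (hu .young) hm.size_le
      have c3 := hcd P _ m.dest.cap (hu .dest) hds
      refine (((c1.add c2).add c3).add_const (m.pot A)).mono (fun ω => ?_) ?_
      · simp only [pot, Merge.pot, huf, huf', hufd]; exact le_rfl
      · simp only [pot]; omega

end Phase

/-- The active structure, for positions greater than `e`. -/
structure Active (h : Hist V) (e : ℕ) (T : Struct V) : Prop where
  wf : T.Wf
  act : T.Act
  lt_key : ∀ t < T.size, e < T.key t
  key_le : ∀ t < T.size, T.key t ≤ h.vals.length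
  marked : ∀ t < T.size, T.key t ∈ h.marked
  val : ∀ t < T.size, T.elemVal t = seg h.vals (T.key t - 1) h.vals.length
  stack : (T.stack 2).val = seg h.vals e h.vals.length
  live : ∀ t < T.size, T.live t = true ↔ T.key t ∈ h.act
  top_le : T.top ≤ T.size + 2

theorem Active.upd {h h' : Hist V} {p : ℕ → Prop} {e : ℕ} {T T' : Struct V} (hT : Active h e T)
    (hh : h.Ext p h') (hv : h'.vals = h.vals) (hu : T.Upd p T') : Active h' e T' := by
  have hl := hu.like
  refine ⟨hu.wf, hl.act hT.act, ?_, ?_, ?_, ?_, ?_, ?_, ?_⟩ <;>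
    simp only [hl.size, hl.key, hl.top, hl.stack, hl.elemVal, hv]
  · exact hT.lt_key
  · exact hT.key_le
  · exact fun t ht => hh.marked (hT.marked t ht)
  · exact hT.val
  · exact hT.stack
  · intro t ht
    rw [hu.live t ht, hT.live t ht, hh.act _ (hT.marked t ht)]
  · exact hT.top_le

namespace State

/-- The state with the same contents, hashed by other functions, and with other times. -/
def rehash {V : Type*} (S : State V) (g : ℕ → ℕ) (hh : Slot → ℕ → ℕ) (ct tt : ℕ) : State V where
  active := S.active.rehash g
  phase := S.phase.rehash hh
  pos := S.pos
  cur := S.cur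
  created := S.created
  cmdTime := ct
  transferTime := tt

/-- The invariant of the procedure, when the active structure is for positions greater than
`e`. -/
structure Inv (h : Hist V) (l e : ℕ) (S : State V) : Prop where
  active : Active h e S.active
  phase : S.phase.Inv h l S.active.cap e
  pos : S.pos = h.vals.length
  cur : 0 < h.vals.length → S.cur = seg h.vals (h.vals.length - 1) h.vals.length
  top_le : 0 < h.vals.length → h.vals.length ∉ h.marked →
    (S.active.stack S.active.top).val ≤ S.cur
  cover : ∀ x ∈ h.act, (∃ t < S.active.size, S.active.key t = x) ∨ S.phase.HasKey x
  cap_le : S.active.cap ≤ 2 * l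
  bound : e = 0 ∨ e ∈ h.marked

/-- The potential of a state. -/
def pot {V : Type*} (A : ℕ) (S : State V) : ℕ :=
  ufPot A S.active.uf + (3 * A + 10) * S.active.top + 14 * S.active.size + S.phase.pot A

/-- The random hash functions suit the sizes of the structures. -/
structure Hashed {V Ω : Type*} [MeasurableSpace Ω] (P : Measure Ω) (g : Ω → ℕ → ℕ)
    (hh : Ω → Slot → ℕ → ℕ) (S : State V) : Prop where
  active : UnivHash P g S.active.cap
  phase : S.phase.Hashed P hh

end State

/-- The answer to a command. -/
def Hist.answer (h : Hist V) : Cmd V → Option (Val V)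
  | .query i => some (h.rmq i)
  | _ => none

/-- The command `c` leads from `S` to `S'`, in time `τ`. -/
structure Processed (h : Hist V) (l e : ℕ) (c : Cmd V) (S S' : State V)
    (τ : (ℕ → ℕ) → (Slot → ℕ → ℕ) → ℕ) : Prop where
  eq : ∀ g hh ct tt,
    (S.rehash g hh ct tt).process c = (S'.rehash g hh (ct + τ g hh) tt, h.answer c)
  inv : S'.Inv (h.step c) l e
  cap : S'.active.cap = S.active.cap
  size : S'.active.size = S.active.size ∨
    S'.active.size = S.active.size + 1 ∧ (h.step c).vals.length ∈ (h.step c).marked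
  upd : ∃ p, S.phase.Upd p S'.phase
  avg : ∀ {Ω : Type*} [MeasurableSpace Ω] (P : Measure Ω) [IsProbabilityMeasure P]
    (g : Ω → ℕ → ℕ) (hh : Ω → Slot → ℕ → ℕ) (A : ℕ), S.Hashed P g hh →
    S.active.size < S.active.cap → 2 * l + 1 < ack (A - 1) 1 →
    Avg P (fun ω => τ (g ω) (hh ω) + S'.pot A) (S.pot A + (5 * A + 25))

section Commands

variable {h : Hist V} {l e : ℕ} {S : State V}

theorem State.Inv.process_value (hS : S.Inv h l e) (v : V) :
    ∃ S' τ, Processed h l e (.value v) S S' τ := by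
  have hA := hS.active
  obtain ⟨T', hr, hw, hk, ha, htop, hval, hst, hle, hc⟩ :=
    Struct.value_spec (v := Val.of v) (WithBot.bot_lt_coe _) hA.wf hA.act
  have hlen : (h.vals ++ [v]).length = h.vals.length + 1 := by simp
  have hext : h.Ext (fun _ => True) (h.step (.value v)) :=
    ⟨List.prefix_append .., Subset.rfl, fun x _ => by simp [Hist.step]⟩
  have hel := hS.phase.le_length
  refine ⟨{ S with active := T', pos := S.pos + 1, cur := Val.of v }, fun g _ =>
    ((S.active.rehash g).value (Val.of v)).2, fun g hh ct tt => ?_,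
    ⟨⟨hw, ha, ?_, ?_, ?_, ?_, ?_, ?_, ?_⟩, ?_, ?_, ?_, ?_, ?_, ?_, hS.bound⟩, hk.cap, .inl hk.size,
    ⟨_, hS.phase.upd_refl⟩, fun P _ g hh A hu hlt hA' => ?_⟩
  · simp only [State.rehash, State.process, hr]
    rfl
  · show ∀ t < T'.size, e < T'.key t
    rw [hk.size, hk.key]; exact hA.lt_key
  · show ∀ t < T'.size, T'.key t ≤ (h.vals ++ [v]).length
    rw [hk.size, hk.key, hlen]; exact fun t ht => (hA.key_le t ht).trans (Nat.le_succ _)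
  · show ∀ t < T'.size, T'.key t ∈ h.marked
    rw [hk.size, hk.key]; exact hA.marked
  · show ∀ t < T'.size, T'.elemVal t = seg (h.vals ++ [v]) (T'.key t - 1) (h.vals ++ [v]).length
    rw [hk.size, hk.key, hlen]
    intro t ht
    rw [hval t ht, hA.val t ht, seg_snoc _ _ (by have := hA.key_le t ht; omega)]
  · show (T'.stack 2).val = seg (h.vals ++ [v]) e (h.vals ++ [v]).length
    rw [hst, hA.stack, hlen, seg_snoc _ _ hel]
  · show ∀ t < T'.size, T'.live t = true ↔ T'.key t ∈ h.act
    rw [hk.size, hk.key, hk.live]; exact hA.live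
  · show T'.top ≤ T'.size + 2
    rw [hk.size]; exact htop.trans hA.top_le
  · show S.phase.Inv (h.step (.value v)) l T'.cap e
    rw [hk.cap]; exact hS.phase.upd hext hS.phase.upd_refl
  · show S.pos + 1 = (h.vals ++ [v]).length
    rw [hlen, hS.pos]
  · show _ → Val.of v = seg (h.vals ++ [v]) ((h.vals ++ [v]).length - 1) (h.vals ++ [v]).length
    rw [hlen, Nat.add_sub_cancel, seg_snoc_self]; exact fun _ => rfl
  · exact fun _ _ => hle
  · show ∀ x ∈ h.act, (∃ t < T'.size, T'.key t = x) ∨ S.phase.HasKey x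
    rw [hk.size, hk.key]; exact hS.cover
  · show T'.cap ≤ _
    rw [hk.cap]; exact hS.cap_le
  · have hcap := hS.cap_le
    refine ((hc P g S.active.cap A hu.active hlt.le (by omega)).add_const
      (14 * S.active.size + S.phase.pot A)).mono (fun ω => ?_) ?_
    · simp only [State.pot, hk.size]; omega
    · simp only [State.pot]; omega

theorem State.Inv.process_mark (hS : S.Inv h l e) (ha : h.Allowed .mark) :
    ∃ S' τ, Processed h l e .mark S S' τ := by
  have hA := hS.active
  obtain ⟨hpos, hnm⟩ := ha
  have hlt : ∀ t < S.active.size, S.active.key t < h.vals.length := fun t ht =>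
    lt_of_le_of_ne (hA.key_le t ht) fun h' => hnm (h' ▸ hA.marked t ht)
  obtain ⟨T', hr, hw, hk, hact, htop, hval, hnew, hst, hc⟩ :=
    Struct.mark_spec hA.wf hA.act hpos hlt (hS.top_le hpos hnm)
  have hext : h.Ext (fun _ => True) (h.step .mark) := by
    refine ⟨List.prefix_rfl, subset_insert _ _, fun x hx => ?_⟩
    have : x ≠ h.vals.length := fun h' => hnm (h' ▸ hx)
    simp [Hist.step, this]
  have hel := hS.phase.le_length
  have hsz : T'.size = S.active.size + 1 := hk.size.trans (Struct.insert_size ..)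
  have hkey : ∀ t < S.active.size, T'.key t = S.active.key t := fun t ht => by
    rw [hk.key, Struct.insert_key_of_lt _ _ _ ht]
  have hkey' : T'.key S.active.size = h.vals.length := by rw [hk.key, Struct.insert_key_size]
  have hcapT : T'.cap = S.active.cap := hk.cap
  have hcases : ∀ {Q : ℕ → Prop}, (∀ t < S.active.size, Q t) → Q S.active.size →
      ∀ t < T'.size, Q t := fun h1 h2 t ht => by
    rcases Nat.lt_succ_iff_lt_or_eq.1 (hsz ▸ ht) with h' | rfl
    exacts [h1 t h', h2]
  -- A structure is opened right after a `Mark`, so `e` is `0` or a marked position; the current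
  -- position is not marked and hence lies beyond `e`.
  have helt : e < h.vals.length := by
    refine lt_of_le_of_ne hel fun h' => ?_
    rcases hS.bound with h0 | h0
    · omega
    · exact hnm (h' ▸ h0)
  refine ⟨{ S with active := T' }, fun g _ => ((S.active.rehash g).mark h.vals.length S.cur).2,
    fun g hh ct tt => ?_,
    ⟨⟨hw, hact, ?_, ?_, ?_, ?_, ?_, ?_, ?_⟩, ?_, hS.pos, hS.cur, fun _ h' => ?_, ?_, ?_, ?_⟩,
    hcapT, .inr ⟨hsz, mem_insert_self _ _⟩, ⟨_, hS.phase.upd_refl⟩,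
    fun P _ g hh A hu hlt hA' => ?_⟩
  · simp only [State.rehash, State.process, hS.pos, hr]
    rfl
  · exact hcases (fun t ht => hkey t ht ▸ hA.lt_key t ht) (hkey'.symm ▸ helt)
  · exact hcases (fun t ht => hkey t ht ▸ hA.key_le t ht) hkey'.le
  · exact hcases (fun t ht => hkey t ht ▸ mem_insert_of_mem (hA.marked t ht))
      (hkey'.symm ▸ mem_insert_self _ _)
  · refine hcases (fun t ht => ?_) ?_
    · show T'.elemVal t = seg h.vals (T'.key t - 1) h.vals.length
      rw [hval t ht, hkey t ht, hA.val t ht]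
    · show T'.elemVal S.active.size = seg h.vals (T'.key S.active.size - 1) h.vals.length
      rw [hnew, hkey', hS.cur hpos]
  · exact hst.trans hA.stack
  · refine hcases (fun t ht => ?_) ?_
    · show T'.live t = true ↔ T'.key t ∈ Insert.insert h.vals.length h.act
      rw [hk.live, hkey t ht, mem_insert, or_iff_right (hlt t ht).ne, ← hA.live t ht]
      show Function.update S.active.live S.active.size true t = true ↔ _
      rw [Function.update_of_ne ht.ne]
    · show T'.live S.active.size = true ↔ T'.key S.active.size ∈ Insert.insert h.vals.length h.act
      rw [hk.live, hkey']
      show Function.update S.active.live S.active.size true S.active.size = true ↔ _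
      simp
  · show T'.top ≤ T'.size + 2
    have := hA.top_le
    omega
  · show S.phase.Inv (h.step .mark) l T'.cap e
    rw [hcapT]; exact hS.phase.upd hext hS.phase.upd_refl
  · exact absurd (mem_insert_self _ _) h'
  · intro x hx
    rcases mem_insert.1 hx with rfl | hx
    · exact .inl ⟨S.active.size, by show _ < T'.size; omega, hkey'⟩
    · refine (hS.cover x hx).imp_left fun ⟨t, ht, h'⟩ => ⟨t, ?_, (hkey t ht).trans h'⟩
      show t < T'.size
      omega
  · exact hcapT.trans_le hS.cap_le
  · exact hS.bound.imp_right fun h' => mem_insert_of_mem h'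
  · have hcap := hS.cap_le
    -- The new element stores `14` units for clearing memory later: `5 * A + 11 + 14`.
    refine ((hc P g S.active.cap A hu.active hlt (by omega)).add_const
      (14 * T'.size + S.phase.pot A)).mono (fun ω => ?_) ?_
    · simp only [State.pot]; omega
    · simp only [State.pot, hsz]; omega

theorem State.Inv.process_query (hS : S.Inv h l e) {i : ℕ} (hi : i ∈ h.act) :
    ∃ S' τ, Processed h l e (.query i) S S' τ := by
  have hA := hS.active
  obtain ⟨T', ans, hr, hw, hl, hlive, -, ha1, ha2, ha3, hc⟩ := Struct.query_spec hA.wf i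
  obtain ⟨q', ans', τ, hr', hu', hb1, hb2, hc'⟩ := hS.phase.query i
  have hel := hS.phase.le_length
  have hu : S.active.Upd (fun _ => True) T' := ⟨hl, hw, fun t _ => by rw [hlive]; simp⟩
  have hext : h.Ext (fun _ => True) (h.step (.query i)) :=
    ⟨List.prefix_rfl, Subset.rfl, fun x _ => by simp [Hist.step]⟩
  -- If the active structure contains `i`, the full ones end before `i` and answer `⊤`. Otherwise `i
  -- ≤ e`: the full structures give the minimum up to `e` and the active one the minimum after `e`.
  have hans : min ans ans' = h.rmq i := by
    rw [Hist.rmq_eq_seg]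
    rcases hS.cover i hi with ⟨t, ht, hx⟩ | hx
    · rw [ha1 t ht hx, hA.val t ht, hx, hb2 (hx ▸ hA.lt_key t ht), min_eq_left le_top]
    · have hie := hS.phase.key_le hx
      rw [ha2 (fun t ht => hie.trans_lt (hA.lt_key t ht)) hA.act.top_ge, hA.stack, hb1 hx,
        min_comm]
      exact seg_concat _ (by omega) hel
  refine ⟨{ S with active := T', phase := q' }, fun g hh =>
    ((S.active.rehash g).query i).2.2 + τ hh, fun g hh ct tt => ?_,
    ⟨hA.upd hext rfl hu, ?_, hS.pos, hS.cur, ?_, ?_, ?_, hS.bound⟩, hl.cap, .inl hl.size,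
    ⟨_, hu'⟩, fun P _ g hh A hh' hlt hA' => ?_⟩
  · simp only [State.rehash, State.process, (hr _).1, (hr _).2, hr', hans, Nat.add_assoc]
    rfl
  · show q'.Inv (h.step (.query i)) l T'.cap e
    rw [hl.cap]; exact hS.phase.upd hext hu'
  · show _ → _ → (T'.stack T'.top).val ≤ _
    rw [hl.stack, hl.top]; exact hS.top_le
  · show ∀ x ∈ h.act, (∃ t < T'.size, T'.key t = x) ∨ q'.HasKey x
    simp only [hl.size, hl.key, hu'.hasKey]; exact hS.cover
  · show T'.cap ≤ _
    rw [hl.cap]; exact hS.cap_le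
  · have hcap := hS.cap_le
    refine (((hc P g S.active.cap A hh'.active hlt.le (by omega)).add
      (hc' P hh A hh'.phase hA')).add_const
      ((3 * A + 10) * S.active.top + 14 * S.active.size)).mono (fun ω => ?_) ?_
    · simp only [State.pot, hl.size, hl.top]; omega
    · simp only [State.pot]; omega

theorem State.Inv.process_close (hS : S.Inv h l e) (i : ℕ) :
    ∃ S' τ, Processed h l e (.close i) S S' τ := by
  have hA := hS.active
  obtain ⟨T', hr, hw, hl, huf, hlive, hc⟩ := Struct.close_spec hA.wf i
  obtain ⟨q', τ, hr', hu', hc'⟩ := hS.phase.close i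
  have hu : S.active.Upd (fun x => x ≠ i) T' := ⟨hl, hw, hlive⟩
  have hext : h.Ext (fun x => x ≠ i) (h.step (.close i)) :=
    ⟨List.prefix_rfl, Subset.rfl, fun x _ => by simp [Hist.step, and_comm]⟩
  refine ⟨{ S with active := T', phase := q' }, fun g hh =>
    ((S.active.rehash g).close i).2 + τ hh, fun g hh ct tt => ?_,
    ⟨hA.upd hext rfl hu, ?_, hS.pos, hS.cur, ?_, ?_, ?_, hS.bound⟩, hl.cap, .inl hl.size,
    ⟨_, hu'⟩, fun P _ g hh A hh' hlt hA' => ?_⟩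
  · simp only [State.rehash, State.process, hr, hr', Nat.add_assoc]
    rfl
  · show q'.Inv (h.step (.close i)) l T'.cap e
    rw [hl.cap]; exact hS.phase.upd hext hu'
  · show _ → _ → (T'.stack T'.top).val ≤ _
    rw [hl.stack, hl.top]; exact hS.top_le
  · intro x hx
    show (∃ t < T'.size, T'.key t = x) ∨ q'.HasKey x
    simp only [hl.size, hl.key, hu'.hasKey]; exact hS.cover x (mem_of_mem_erase hx)
  · show T'.cap ≤ _
    rw [hl.cap]; exact hS.cap_le
  · refine (((hc P g S.active.cap hh'.active hlt.le).add (hc' P hh A hh'.phase)).add_const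
      (ufPot A S.active.uf + (3 * A + 10) * S.active.top + 14 * S.active.size)).mono
      (fun ω => ?_) ?_
    · simp only [State.pot, hl.size, hl.top, huf]; omega
    · simp only [State.pot]; omega

theorem State.Inv.process (hS : S.Inv h l e) {c : Cmd V} (hc : h.Allowed c) :
    ∃ S' τ, Processed h l e c S S' τ := by
  cases c with
  | value v => exact hS.process_value v
  | mark => exact hS.process_mark hc
  | query i => exact hS.process_query hc
  | close i => exact hS.process_close i

end Commands
end RMQ

/-! ### Contributing to a merge and replacing the active structure -/

namespace RMQ

open Batteries Finset MeasureTheory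

variable {V : Type*} [LinearOrder V]

omit [LinearOrder V] in
theorem Stage.with_age {f : ℕ → Val V} {act D : Finset ℕ} {m : Merge V} {n : ℕ}
    (h : Stage f act D m n) (k : ℕ) : Stage f act D { m with age := k } n := by
  cases h with
  | start h1 h2 h3 h4 h5 h6 h7 => exact Stage.start (m := { m with age := k }) h1 h2 h3 h4 h5 h6 h7
  | old h1 h2 h3 h4 h5 h6 => exact Stage.old (m := { m with age := k }) h1 h2 h3 h4 h5 h6
  | young h1 h2 h3 h4 h5 h6 => exact Stage.young (m := { m with age := k }) h1 h2 h3 h4 h5 h6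
  | done h1 h2 h3 h4 => exact Stage.done (m := { m with age := k }) h1 h2 h3 h4

theorem Merging.same {h : Hist V} {l b e e₁ n n' : ℕ} {D : Finset ℕ} {m m' : Merge V} {k : ℕ}
    (hm : Merging h l b e m e₁ D n) (hs : m.Same m')
    (hi : m'.Inv (fun x => seg h.vals (x - 1) e) h.act D n') (hn : n' ≤ 5 * (b - k)) (hk : k < b) :
    Merging h l b e { m' with age := k } e₁ D n' where
  inv := ⟨hi.old, hi.young, hi.top_ge, hi.old_lt, hi.stage.with_age k⟩
  old := hm.old.upd (p := fun _ => True) ⟨List.prefix_rfl, Subset.rfl, fun x _ => by simp⟩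
    ⟨hs.old, hi.old.wf, fun t _ => by show m'.old.live t = true ↔ _; rw [hs.old_live]; simp⟩
  le := hm.le
  le_length := hm.le_length
  lt_key := by
    show ∀ t < m'.young.size, e₁ < m'.young.key t
    rw [hs.young.size, hs.young.key]; exact hm.lt_key
  key_le := by
    show ∀ t < m'.young.size, m'.young.key t ≤ e
    rw [hs.young.size, hs.young.key]; exact hm.key_le
  marked := by
    show ∀ t < m'.young.size, m'.young.key t ∈ h.marked
    rw [hs.young.size, hs.young.key]; exact hm.marked
  stack := by
    show (m'.young.stack 2).val = _
    rw [hs.young.stack]; exact hm.stack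
  sub := hm.sub
  bound := hm.bound
  size_pos := hm.size_pos.trans_eq hs.young.size.symm
  size_le := by
    show m'.young.size ≤ m'.young.cap
    rw [hs.young.size, hs.young.cap]; exact hm.size_le
  top_le := by
    show m'.young.top ≤ m'.young.cap + 2
    rw [hs.young.top, hs.young.cap]; exact hm.top_le
  old_cap := hs.old.cap.trans_le hm.old_cap
  young_cap := hs.young.cap.trans_le hm.young_cap
  dest_cap := hs.cap.trans_le hm.dest_cap
  dest_cap' := hs.cap.trans_le hm.dest_cap'
  cap := by
    show b = (m'.old.cap + m'.young.cap + 1) / 2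
    rw [hs.old.cap, hs.young.cap]; exact hm.cap
  rounds := hn
  age := hk

theorem Merge.Inv.target {f : ℕ → Val V} {act D : Finset ℕ} {m : Merge V} (h : m.Inv f act D 0) :
    Target f act D (m.reg 8) m.dest ∧ Moved act m.old m.old.size m.dest ∧
      Moved act m.young m.young.size m.dest := by
  obtain ⟨-, -, -, -, hst⟩ := h
  generalize hk : 0 = k at hst
  cases hst with
  | start => omega
  | old => omega
  | young => omega
  | done _ hT h1 h2 => exact ⟨hT, h1, h2⟩

namespace State

section

variable {h : Hist V} {l e : ℕ} {S : State V}

/-- The contribution of a command to the merge in progress. -/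
theorem Inv.contribute (hS : S.Inv h l e)
    (hage : ∀ m, S.phase = .merging m → S.active.size ≤ m.age + 1) :
    ∃ (q : Phase V) (κ : ℕ),
      (∀ g hh ct tt, (S.rehash g hh ct tt).contribute mergeProg instrPerCmd =
        some (({ S with phase := q } : State V).rehash g hh ct (tt + κ))) ∧
      ({ S with phase := q } : State V).Inv h l e ∧
      (∀ m, q = .merging m → S.active.size ≤ m.age) ∧
      (∀ {Ω : Type*} [MeasurableSpace Ω] (P : Measure Ω) (hh : Ω → Slot → ℕ → ℕ),
        S.phase.Hashed P hh → q.Hashed P hh) ∧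
      ∀ A, 2 * l + 1 < ack (A - 1) 1 → κ + q.pot A ≤ S.phase.pot A + 5 * (6 * A + 27) := by
  obtain ⟨hact, hph, hpos, hcur, htop, hcov, hcap, hbd⟩ := hS
  generalize hq : S.phase = q at *
  match q with
  | .single =>
    refine ⟨.single, 0, fun g hh ct tt => ?_, ⟨hact, hph, hpos, hcur, htop, hcov, hcap, hbd⟩,
      fun m hm => by simp at hm, fun P hh h => h, fun A _ => by simp⟩
    simp only [State.contribute, State.rehash, hq, Phase.rehash]
    rfl
  | .waiting T =>
    refine ⟨.waiting T, 0, fun g hh ct tt => ?_, ⟨hact, hph, hpos, hcur, htop, hcov, hcap, hbd⟩,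
      fun m hm => by simp at hm, fun P hh h => h, fun A _ => by simp⟩
    simp only [State.contribute, State.rehash, hq, Phase.rehash]
    rfl
  | .merging m =>
    obtain ⟨e₁, D, n, hm⟩ := hph
    obtain ⟨m', c, hst, hi, hs, hc⟩ := hm.inv.steps
      (fun x y hxy => seg_mono _ _ (Nat.sub_le_sub_right hxy 1)) (fun x => bot_lt_seg _ _ _)
    have hsz := hm.old.size_le
    have hsz' := hm.size_le
    have hc1 := hm.old_cap
    have hc2 := hm.young_cap
    have hc3 := hm.dest_cap
    have hr := hm.rounds
    have ha := hm.age
    -- With truncated subtraction this says that the merge ends with the present command.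
    by_cases hn : n - 5 = 0
    · rw [hn] at hi
      obtain ⟨hT, hmo, hmy⟩ := hi.target
      refine ⟨.waiting m'.dest, c, fun g hh ct tt => ?_,
        ⟨hact, ⟨⟨hT.wf, hT.lev_le, fun t ht => hm.bound _ (hT.sub t ht),
          fun t ht => hm.sub (hT.sub t ht), hT.val, hT.live, fun h0 => ?_, hm.le_length, hT.size_le,
          ?_⟩, hs.cap.trans_le hm.dest_cap', hs.cap.trans_le hm.dest_cap⟩, hpos, hcur, htop,
          fun x hx => (hcov x hx).imp_right ?_, hcap, hbd⟩,
        fun m hm => by simp at hm, fun P hh h => ?_, fun A hA => ?_⟩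
      · have hpc : mergeProg.length ≤ (m'.rehash hh).pc := hi.pc_eq.2 rfl
        simp only [State.contribute, State.rehash, hq, Phase.rehash, hst, Option.bind_eq_bind,
          Option.bind_some, if_pos hpc]
        rfl
      · have := hT.top_le; omega
      · have := hT.top_le; have := hT.size_le; omega
      -- The two sources are discarded, but each of their active positions has been copied.
      · rintro (⟨t, ht, rfl⟩ | ⟨t, ht, rfl⟩)
        · have h1 := hmo t (by rw [hs.old.size]; exact ht)
          rw [hs.old.key] at h1
          exact h1 hx
        · have h1 := hmy t (by rw [hs.young.size]; exact ht)
          rw [hs.young.key] at h1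
          exact h1 hx
      · have := h .dest
        show UnivHash P _ m'.dest.cap
        rw [hs.cap]; exact this
      · have := hc (2 * l) A (by omega) (by omega) (by omega) hA
        simp only [Phase.pot, Merge.pot] at *
        omega
    -- More than five rounds were left, and they numbered at most five for each command before the
    -- deadline, so at least two such commands were left.
    · have hk : m.age + 1 < S.active.cap := by omega
      have hm' := hm.same hs hi (k := m.age + 1) (by omega) hk
      refine ⟨.merging { m' with age := m.age + 1 }, c, fun g hh ct tt => ?_,
        ⟨hact, ⟨e₁, D, _, hm'⟩, hpos, hcur, htop, fun x hx => (hcov x hx).imp_right ?_, hcap, hbd⟩,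
        fun m₂ hm₂ => ?_, fun P hh h s => ?_, fun A hA => ?_⟩
      · have hpc : ¬ mergeProg.length ≤ (m'.rehash hh).pc := fun h' => hn (hi.pc_eq.1 h')
        simp only [State.contribute, State.rehash, hq, Phase.rehash, hst, Option.bind_eq_bind,
          Option.bind_some, if_neg hpc]
        rw [← hs.age]
        rfl
      · simp only [Phase.HasKey, hs.old.size, hs.old.key, hs.young.size, hs.young.key]
        exact fun h => h
      · cases hm₂
        exact hage m rfl
      · have := h s
        cases s
        · show UnivHash P _ m'.old.cap
          rw [hs.old.cap]; exact this
        · show UnivHash P _ m'.young.cap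
          rw [hs.young.cap]; exact this
        · show UnivHash P _ m'.dest.cap
          rw [hs.cap]; exact this
      · exact hc (2 * l) A (by omega) (by omega) (by omega) hA

end

end State

namespace Struct

/-- A new structure, without hash function. -/
def blank (V : Type*) (a : ℕ) : Struct V := fresh (fun _ _ _ => 0) 0 a

theorem blank_size {V : Type*} (a : ℕ) : (blank V a).size = 0 := rfl

theorem blank_wf {V : Type*} (a : ℕ) : (blank V a).Wf where
  key_lt t u _ hu := by rw [blank_size] at hu; omega
  key_pos t ht := by rw [blank_size] at ht; omega
  count_eq := by rw [blank_size]; rfl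
  lt_minPos i := by
    rw [blank_size]
    simp [blank, fresh]
  rankInv := RankInv.empty

theorem blank_act {V : Type*} [LT V] (a : ℕ) : (blank V a).Act where
  top_ge := le_rfl
  lev_mem t ht := by rw [blank_size] at ht; omega
  sep t u ht := by rw [blank_size] at ht; omega
  ptr k h2 hk := by
    refine .inl ⟨?_, fun t ht => by rw [blank_size] at ht; omega⟩
    simp only [blank, fresh]
    split <;> rfl
  bot := rfl
  mono k h1 hk := by
    replace hk : k < 2 := hk
    have : k = 1 := by omega
    subst this
    exact WithBot.bot_lt_coe _

theorem blank_pot {V : Type*} (A a : ℕ) : ufPot A (blank V a).uf = 0 := ufPot_empty A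

end Struct

theorem blank_active (h : Hist V) (a : ℕ) : Active h h.vals.length (Struct.blank V a) where
  wf := Struct.blank_wf a
  act := Struct.blank_act a
  lt_key t ht := by rw [Struct.blank_size] at ht; omega
  key_le t ht := by rw [Struct.blank_size] at ht; omega
  marked t ht := by rw [Struct.blank_size] at ht; omega
  val t ht := by rw [Struct.blank_size] at ht; omega
  stack := by rw [seg_of_le _ le_rfl]; rfl
  live t ht := by rw [Struct.blank_size] at ht; omega
  top_le := by rw [Struct.blank_size]; exact le_rfl

theorem Active.full {h : Hist V} {e : ℕ} {T : Struct V} (hT : Active h e T) (h0 : 0 < T.size)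
    (hc : T.size ≤ T.cap) : Full h h.vals.length T where
  wf := hT.wf
  lev_le t ht := (hT.act.lev_mem t ht).2
  key_le := hT.key_le
  marked := hT.marked
  val := hT.val
  live := hT.live
  empty h' := by omega
  le_length := le_rfl
  size_le := hc
  top_le := hT.top_le.trans (by omega)

/-- The positions that are active. -/
def Struct.liveKeys {V : Type*} (T : Struct V) : Finset ℕ :=
  {t ∈ range T.size | T.live t = true}.image T.key

theorem Struct.Wf.card_liveKeys {V : Type*} {T : Struct V} (hT : T.Wf) : #T.liveKeys = T.count := by
  rw [hT.count_eq, liveKeys, card_image_of_injOn]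
  intro t ht u hu h
  simp only [coe_filter, mem_range, Set.mem_ofPred_eq] at ht hu
  exact hT.key_inj ht.1 hu.1 h

theorem Struct.Wf.count_le {V : Type*} {T : Struct V} (hT : T.Wf) : T.count ≤ T.size := by
  rw [hT.count_eq]
  exact (card_filter_le _ _).trans (card_range _).le

/-- The active positions are those of the two full structures. -/
theorem card_act {h : Hist V} {e : ℕ} {T T' : Struct V} (hT : Full h e T) (hT' : Active h e T')
    (hc : ∀ x ∈ h.act, (∃ t < T'.size, T'.key t = x) ∨ ∃ t < T.size, T.key t = x) :
    T.count + T'.count = #h.act := by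
  have hdisj : Disjoint T.liveKeys T'.liveKeys := by
    rw [disjoint_left]
    intro x hx hx'
    simp only [Struct.liveKeys, mem_image, mem_filter, mem_range] at hx hx'
    obtain ⟨t, ⟨ht, -⟩, rfl⟩ := hx
    obtain ⟨u, ⟨hu, -⟩, h'⟩ := hx'
    have := hT.key_le t ht
    have := hT'.lt_key u hu
    omega
  rw [← hT.wf.card_liveKeys, ← hT'.wf.card_liveKeys, ← card_union_of_disjoint hdisj]
  congr 1
  ext x
  simp only [Struct.liveKeys, mem_union, mem_image, mem_filter, mem_range]
  constructor
  · rintro (⟨t, ⟨ht, hl⟩, rfl⟩ | ⟨t, ⟨ht, hl⟩, rfl⟩)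
    · exact (hT.live t ht).1 hl
    · exact (hT'.live t ht).1 hl
  · intro hx
    rcases hc x hx with ⟨t, ht, rfl⟩ | ⟨t, ht, rfl⟩
    · exact .inr ⟨t, ⟨ht, (hT'.live t ht).2 hx⟩, rfl⟩
    · exact .inl ⟨t, ⟨ht, (hT.live t ht).2 hx⟩, rfl⟩

namespace State

/-- The invariant between two commands. -/
structure Ready (h : Hist V) (l e : ℕ) (S : State V) : Prop where
  inv : S.Inv h l e
  size_lt : S.active.size < S.active.cap
  age : ∀ m, S.phase = .merging m → S.active.size ≤ m.age

/-- The replacement of a full active structure. -/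
theorem Inv.rollover {h : Hist V} {l e : ℕ} {S : State V} (hS : S.Inv h l e)
    (h0 : 0 < S.active.cap) (hsz : S.active.size ≤ S.active.cap)
    (hfull : S.active.size = S.active.cap → h.vals.length ∈ h.marked)
    (hage : ∀ m, S.phase = .merging m → S.active.size ≤ m.age) (hl : #h.act ≤ l) :
    ∃ (S' : State V) (e' κ : ℕ) (g' : Hashing → (ℕ → ℕ) → (Slot → ℕ → ℕ) → ℕ → ℕ)
      (hh' : Hashing → (ℕ → ℕ) → (Slot → ℕ → ℕ) → Slot → ℕ → ℕ),
      (∀ H g hh ct tt, (S.rehash g hh ct tt).rollover H =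
        some (S'.rehash (g' H g hh) (hh' H g hh) ct (tt + κ))) ∧
      S'.Ready h l e' ∧
      (∀ {Ω : Type*} [MeasurableSpace Ω] (P : Measure Ω) (H : Ω → Hashing) (g : Ω → ℕ → ℕ)
        (hh : Ω → Slot → ℕ → ℕ), IsUniversal P H → S.Hashed P g hh →
        S'.Hashed P (fun ω => g' (H ω) (g ω) (hh ω)) fun ω => hh' (H ω) (g ω) (hh ω)) ∧
      ∀ A, κ + S'.pot A ≤ S.pot A := by
  by_cases hlt : S.active.size < S.active.cap
  · refine ⟨S, e, 0, fun _ g _ => g, fun _ _ hh => hh, fun H g hh ct tt => ?_, ⟨hS, hlt, hage⟩,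
      fun P H g hh _ h => h, fun A => by simp⟩
    have hlt' : (S.rehash g hh ct tt).active.size < (S.rehash g hh ct tt).active.cap := hlt
    simp only [State.rollover, if_pos hlt']
    rfl
  · have hnlt : ∀ g hh ct tt,
        ¬ (S.rehash g hh ct tt).active.size < (S.rehash g hh ct tt).active.cap :=
      fun _ _ _ _ => hlt
    obtain ⟨hact, hph, hpos, hcur, htop, hcov, hcap, hbd⟩ := hS
    -- Only `Mark` fills a structure, so the current position is marked and cannot be marked again.
    -- The condition on the top value, which the new stack with `⊤` on top would violate, is thereby
    -- vacuous.
    have hmk := hfull (by omega)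
    have hF := hact.full (by omega) hsz
    have htop2 := hact.act.top_ge
    have hpot : ∀ A, (3 * A + 10) * 2 ≤ (3 * A + 10) * S.active.top := fun A =>
      Nat.mul_le_mul_left _ htop2
    generalize hq : S.phase = q at *
    match q with
    | .single =>
      refine ⟨{ S with
          active := Struct.blank V S.active.cap
          phase := .waiting S.active
          created := S.created + 1 }, h.vals.length, Struct.freshTime S.active.cap,
        fun H _ _ => H S.created (buckets S.active.cap), fun _ g _ _ => g, fun H g hh ct tt => ?_,
        ⟨⟨blank_active h _, ⟨hF, ?_, hcap⟩, hpos, hcur, fun _ h' => absurd hmk h', fun x hx => ?_,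
          hcap, .inr hmk⟩, h0, fun m hm => by simp at hm⟩, fun P H g hh hH hh' => ?_, fun A => ?_⟩
      · simp only [State.rollover, if_neg (hnlt g hh ct tt)]
        simp only [State.rehash, hq, Phase.rehash]
        rfl
      · show S.active.cap ≤ 2 * S.active.cap
        omega
      · rcases hcov x hx with h' | h'
        · exact .inr h'
        · exact h'.elim
      · exact ⟨hH.univHash _ _, hh'.active⟩
      · have := hpot A
        simp only [State.pot, Phase.pot, hq, Struct.blank_pot, Struct.blank_size, Struct.freshTime,
          buckets, show (Struct.blank V S.active.cap).top = 2 from rfl]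
        omega
    | .waiting T =>
      obtain ⟨hT, hT1, hT2⟩ := hph
      have hcard := card_act hT hact hcov
      have hTs := hT.size_le
      have hct := hT.wf.count_le
      have hca := hact.wf.count_le
      set a := (T.cap + S.active.cap + 1) / 2 with ha
      set d := T.count + S.active.count with hd
      have hel := hT.le_length
      refine ⟨{ S with
          active := Struct.blank V a
          phase := .merging (Merge.start T S.active (Struct.blank V d))
          created := S.created + 2 }, h.vals.length, Struct.freshTime d + Struct.freshTime a,
        -- Hash functions move along with the structures: a waiting structure uses the slot `dest`,
        -- where the destination of the merge that produced it was hashed, and it now becomes `old`;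
        -- the full active one becomes `young`.
        fun H _ _ => H (S.created + 1) (buckets a), fun H g hh s => match s with
          | .old => hh .dest
          | .young => g
          | .dest => H S.created (buckets d), fun H g hh ct tt => ?_,
        ⟨⟨blank_active h _, ⟨e, h.act, T.size + S.active.size + 3, ?_⟩, hpos, hcur,
          fun _ h' => absurd hmk h', fun x hx => ?_, ?_, .inr hmk⟩, ?_, fun m hm => ?_⟩,
        fun P H g hh hH hh' => ?_, fun A => ?_⟩
      · simp only [State.rollover, if_neg (hnlt g hh ct tt)]
        simp only [State.rehash, hq, Phase.rehash, Nat.add_assoc]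
        rfl
      · refine ⟨⟨⟨hT.wf, hT.lev_le, fun t ht => ?_, hT.live, fun _ _ h' => h'⟩,
          ⟨hact.wf, fun t ht => (hact.act.lev_mem t ht).2, fun t ht => ?_, hact.live,
            fun _ _ h' => h'⟩, htop2, fun t ht u hu => (hT.key_le t ht).trans_lt (hact.lt_key u hu),
            .start rfl (Struct.blank_wf _) rfl rfl rfl hcard.ge rfl⟩, hT, hel, le_rfl, hact.lt_key,
          hact.key_le, hact.marked, hact.stack, fun x hx => ?_, fun x hx => ?_, by
            show 0 < S.active.size
            omega, hsz, hF.top_le, hT2, hcap, ?_, ?_, rfl, ?_, ?_⟩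
        · show min (T.elemVal t) (S.active.stack 2).val = _
          have := hT.key_le t ht
          rw [hT.val t ht, hact.stack]
          exact seg_concat _ (show T.key t - 1 ≤ e by omega) hel
        · show min (S.active.elemVal t) (S.active.elemVal t) = _
          rw [min_self]; exact hact.val t ht
        · rcases hcov x hx with ⟨t, ht, rfl⟩ | ⟨t, ht, rfl⟩
          · exact hact.marked t ht
          · exact hT.marked t ht
        · rcases hcov x hx with ⟨t, ht, rfl⟩ | ⟨t, ht, rfl⟩
          · exact hact.key_le t ht
          · exact (hT.key_le t ht).trans hel
        -- All active positions lie in the two full structures, so `d` is their number, at most `l`.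
        · show d ≤ 2 * l
          omega
        -- This keeps the merged structure at most twice as large as the active one, as needed to
        -- pay for the next replacement.
        · show d ≤ 2 * a
          omega
        -- The left side is at most `2 * a + 3`, and `a ≥ 1`.
        · show T.size + S.active.size + 3 ≤ 5 * (a - 0)
          omega
        · show 0 < a
          omega
      · exact .inr ((hcov x hx).symm)
      · show a ≤ 2 * l
        omega
      · show 0 < a
        omega
      · cases hm
        exact le_rfl
      · refine ⟨hH.univHash _ _, fun s => ?_⟩
        cases s
        · have := hh'.phase
          rw [hq] at this
          exact this
        · exact hh'.active
        · exact hH.univHash _ _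
      -- Let `b` be the size of the full active structure. From `T.cap ≤ 2 * b` follow `d ≤ 3 * b`
      -- and `2 * a ≤ 3 * b + 1`, so clearing costs `2 * d + 2 * a + 4 ≤ 9 * b + 5 ≤ 14 * b`, the
      -- amount stored on its elements.
      · have := hpot A
        simp only [State.pot, Phase.pot, Merge.pot, Merge.start, hq, Struct.blank_pot,
          Struct.blank_size, Struct.freshTime, buckets,
          show (Struct.blank V a).top = 2 from rfl]
        omega
    | .merging m =>
      -- The number of active elements is at most the age of the merge, which is below the capacity;
      -- a full structure and an unfinished merge exclude each other.
      obtain ⟨e₁, D, n, hm⟩ := hph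
      have := hm.age
      have := hage m rfl
      omega

end State
end RMQ

namespace RMQ

open Batteries Finset MeasureTheory

/-! ## Runs of the procedure -/

section Run

variable {V : Type*} [LinearOrder V]

theorem Hist.card_act_le_maxActive {V : Type*} (h : Hist V) (cs : List (Cmd V)) :
    #h.act ≤ h.maxActive cs := by
  cases cs with
  | nil => exact le_rfl
  | cons c cs => exact le_max_left _ _

/-- Serves to charge the clearing of the first structure, of size at most `2 * l`, to the commands.
-/
theorem Hist.maxActive_le {V : Type*} (h : Hist V) (cs : List (Cmd V)) :
    h.maxActive cs ≤ #h.act + cs.length := by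
  induction cs generalizing h with
  | nil => exact le_rfl
  | cons c cs ih =>
    refine max_le (Nat.le_add_right _ _) ((ih _).trans ?_)
    have : #(h.step c).act ≤ #h.act + 1 := by
      cases c with
      | value v => exact Nat.le_succ _
      | mark => exact card_insert_le _ _
      | query i => exact Nat.le_succ _
      | close i => exact (card_erase_le).trans (Nat.le_succ _)
    rw [List.length_cons]
    omega

theorem Hist.valid_append {V : Type*} {h : Hist V} {cs cs' : List (Cmd V)}
    (hv : h.Valid (cs ++ cs')) : h.Valid cs := by
  induction cs generalizing h with
  | nil => trivial
  | cons c cs ih => exact ⟨hv.1, ih hv.2⟩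

theorem Hist.maxActive_append_le {V : Type*} (h : Hist V) (cs cs' : List (Cmd V)) :
    h.maxActive cs ≤ h.maxActive (cs ++ cs') := by
  induction cs generalizing h with
  | nil => exact h.card_act_le_maxActive _
  | cons c cs ih => exact max_le_max le_rfl (ih _)

theorem Hist.answers_cons (h : Hist V) (c : Cmd V) (cs : List (Cmd V)) :
    h.answers (c :: cs) = (h.answer c).toList ++ (h.step c).answers cs := by
  cases c <;> rfl

namespace State

theorem Ready.within {h : Hist V} {l e : ℕ} {S : State V} (hS : S.Ready h l e) (g : ℕ → ℕ)
    (hh : Slot → ℕ → ℕ) (ct tt : ℕ) : (S.rehash g hh ct tt).Within l := by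
  obtain ⟨⟨hact, hph, -, -, -, -, hcap, -⟩, hlt, -⟩ := hS
  have htop := hact.top_le
  rcases S with ⟨T, q, pos, cur, created, c, t⟩
  dsimp only at *
  match q with
  | .single =>
    refine ⟨by simp [rehash, Phase.rehash, Phase.structs], ?_, ?_, fun m hm => by cases hm⟩
    all_goals
      simp only [rehash, Phase.rehash, Phase.structs, List.mem_cons, List.not_mem_nil, or_false,
        forall_eq]
    · exact hcap
    · exact ⟨hlt.le, show T.top ≤ T.cap + 2 by omega⟩
  | .waiting T' =>
    obtain ⟨hT, -, hc⟩ := hph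
    refine ⟨by simp [rehash, Phase.rehash, Phase.structs], ?_, ?_, fun m hm => by cases hm⟩
    all_goals
      simp only [rehash, Phase.rehash, Phase.structs, List.mem_cons, List.not_mem_nil, or_false,
        forall_eq_or_imp, forall_eq]
    · exact ⟨hcap, hc⟩
    · exact ⟨⟨hlt.le, show T.top ≤ T.cap + 2 by omega⟩, hT.size_le, hT.top_le⟩
  | .merging m =>
    obtain ⟨e₁, D, n, hm⟩ := hph
    refine ⟨by simp [rehash, Phase.rehash, Phase.structs], ?_, ?_, fun m hm' => ?_⟩
    rotate_right
    · cases hm'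
      exact ⟨hm.age, hm.cap⟩
    all_goals
      simp only [rehash, Phase.rehash, Phase.structs, List.mem_cons, List.not_mem_nil, or_false,
        forall_eq_or_imp, forall_eq]
    · exact ⟨hcap, hm.old_cap, hm.young_cap, hm.dest_cap⟩
    · exact ⟨⟨hlt.le, show T.top ≤ T.cap + 2 by omega⟩, ⟨hm.old.size_le, hm.old.top_le⟩,
        ⟨hm.size_le, hm.top_le⟩, hm.inv.dest.2⟩

/-- The command costs `5 * A + 25` and five rounds of the merge `5 * (6 * A + 27)`, together `35 * A
+ 160`; a replacement is paid from the potential. The new state is the same for all outcomes, and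
only the attached hash functions and the search times vary, so the next step starts again from
deterministic contents. -/
theorem Ready.step {h : Hist V} {l e : ℕ} {S : State V} (hS : S.Ready h l e) {c : Cmd V}
    (hc : h.Allowed c) (hl : #(h.step c).act ≤ l) {Ω : Type*} [MeasurableSpace Ω] (P : Measure Ω)
    [IsProbabilityMeasure P] (H : Ω → Hashing) (hH : IsUniversal P H) (g : Ω → ℕ → ℕ)
    (hh : Ω → Slot → ℕ → ℕ) (hu : S.Hashed P g hh) :
    ∃ (S' : State V) (e' : ℕ) (g' : Ω → ℕ → ℕ) (hh' : Ω → Slot → ℕ → ℕ) (τ : Ω → ℕ) (κ : ℕ),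
      (∀ ω ct tt, (S.rehash (g ω) (hh ω) ct tt).step mergeProg instrPerCmd (H ω) c =
        some (S'.rehash (g' ω) (hh' ω) (ct + τ ω) (tt + κ), h.answer c)) ∧
      S'.Ready (h.step c) l e' ∧ S'.Hashed P g' hh' ∧
      ∀ A, 2 * l + 1 < ack (A - 1) 1 →
        Avg P (fun ω => τ ω + κ + S'.pot A) (S.pot A + (35 * A + 160)) := by
  obtain ⟨hI, hlt, hage⟩ := hS
  obtain ⟨S₁, τ, h₁⟩ := hI.process hc
  obtain ⟨p, hup⟩ := h₁.upd
  have hage₁ : ∀ m, S₁.phase = .merging m → S₁.active.size ≤ m.age + 1 := by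
    intro m hm
    rw [hm] at hup
    have hsz := h₁.size
    generalize hq : S.phase = q at hup
    match q, hup with
    | .merging m', hup =>
      have := hage m' hq
      have := hup.age
      omega
  obtain ⟨q, κ₁, e₁, hI₁, ha₁, hh₁, hc₁⟩ := h₁.inv.contribute hage₁
  have hsz := h₁.size
  have hcap := h₁.cap
  obtain ⟨S₂, e', κ₂, g', hh', e₂, hI₂, hh₂, hc₂⟩ := hI₁.rollover
    (show 0 < S₁.active.cap by omega) (show S₁.active.size ≤ S₁.active.cap by omega)
    (fun h' => by
      replace h' : S₁.active.size = S₁.active.cap := h'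
      rcases hsz with h'' | h''
      · omega
      · exact h''.2) ha₁ hl
  refine ⟨S₂, e', fun ω => g' (H ω) (g ω) (hh ω), fun ω => hh' (H ω) (g ω) (hh ω),
    fun ω => τ (g ω) (hh ω), κ₁ + κ₂, fun ω ct tt => ?_, hI₂, hh₂ P H g hh hH ⟨?_, ?_⟩,
    fun A hA => ?_⟩
  · rw [State.step, h₁.eq]
    simp only [e₁, e₂, Option.bind_eq_bind, Option.bind_some, Nat.add_assoc]
    rfl
  · show UnivHash P g S₁.active.cap
    rw [hcap]; exact hu.active
  · exact hh₁ P hh (hup.hashed hu.phase)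
  · refine ((h₁.avg P g hh A hu hlt hA).add_const (5 * (6 * A + 27))).mono (fun ω => ?_)
      (by omega)
    have b1 := hc₁ A hA
    have b2 := hc₂ A
    simp only [State.pot] at *
    omega

/-- Expectations are merely added, so the hash functions of different structures need not be
independent. -/
theorem Ready.runFrom {h : Hist V} {l e : ℕ} {S : State V} (hS : S.Ready h l e) (cs : List (Cmd V))
    (hv : h.Valid cs) (hl : h.maxActive cs ≤ l) {Ω : Type*} [MeasurableSpace Ω] (P : Measure Ω)
    [IsProbabilityMeasure P] (H : Ω → Hashing) (hH : IsUniversal P H) (g : Ω → ℕ → ℕ)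
    (hh : Ω → Slot → ℕ → ℕ) (hu : S.Hashed P g hh) :
    ∃ (h' : Hist V) (S' : State V) (e' : ℕ) (g' : Ω → ℕ → ℕ) (hh' : Ω → Slot → ℕ → ℕ)
      (τ κ : Ω → ℕ),
      (∀ ω ct tt, runFrom mergeProg instrPerCmd (H ω) (S.rehash (g ω) (hh ω) ct tt) cs =
        some (S'.rehash (g' ω) (hh' ω) (ct + τ ω) (tt + κ ω), h.answers cs)) ∧
      S'.Ready h' l e' ∧
      ∀ A, 2 * l + 1 < ack (A - 1) 1 →
        Avg P (fun ω => τ ω + κ ω + S'.pot A) (S.pot A + cs.length * (35 * A + 160)) := by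
  induction cs generalizing h S e g hh with
  | nil =>
    exact ⟨h, S, e, g, hh, fun _ => 0, fun _ => 0, fun ω ct tt => rfl, hS, fun A _ =>
      (Avg.const (S.pot A)).mono (fun ω => by simp) (by simp)⟩
  | cons c cs ih =>
    have hl' := (le_max_right _ _).trans hl
    obtain ⟨S₁, e₁, g₁, hh₁, τ₁, κ₁, r₁, hS₁, hu₁, hc₁⟩ :=
      hS.step hv.1 (((h.step c).card_act_le_maxActive cs).trans hl') P H hH g hh hu
    obtain ⟨h₂, S₂, e₂, g₂, hh₂, τ₂, κ₂, r₂, hS₂, hc₂⟩ := ih hS₁ hv.2 hl' g₁ hh₁ hu₁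
    refine ⟨h₂, S₂, e₂, g₂, hh₂, fun ω => τ₁ ω + τ₂ ω, fun ω => κ₁ + κ₂ ω, fun ω ct tt => ?_, hS₂,
      fun A hA => ?_⟩
    · simp only [State.runFrom, r₁, r₂, Option.bind_eq_bind, Option.bind_some, Nat.add_assoc,
        Hist.answers_cons]
      rfl
    · have h3 := (hc₁ A hA).add (hc₂ A hA)
      -- The potential of the state after the first command telescopes.
      refine Avg.of_add_const (c := S₁.pot A) (h3.mono (fun ω => ?_) ?_)
      · dsimp only
        omega
      · rw [List.length_cons, Nat.succ_mul cs.length]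
        omega

/-- The state at the beginning. -/
def start (V : Type*) (a : ℕ) : State V where
  active := Struct.blank V a
  phase := .single
  pos := 0
  cur := ⊤
  created := 1
  cmdTime := 0
  transferTime := 0

omit [LinearOrder V] in
theorem init_eq (H : Hashing) (a : ℕ) :
    init H a = (start V a).rehash (H 0 (buckets a)) (fun _ _ => 0) 0 (Struct.freshTime a) := rfl

theorem start_ready {l a : ℕ} (ha : 1 ≤ a) (hal : a ≤ 2 * l) :
    (start V a).Ready (Hist.init V) l 0 where
  inv := ⟨blank_active (Hist.init V) a, rfl, rfl, fun h => absurd h (lt_irrefl 0),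
    fun h => absurd h (lt_irrefl 0), fun x hx => absurd hx (notMem_empty x), hal, .inl rfl⟩
  size_lt := ha
  age m hm := by cases hm

end State

/-- Since `ack (k + 2) 1 = ack (k + 1) (ack (k + 1) 1)`, two more rows dominate `ack k k` at
argument `1`. A third row applies at least `ack 2 n = 2 * n + 3`, which absorbs the factor `2` in
the sizes up to `2 * l`. -/
theorem lt_ack_invAck (l : ℕ) : 1 ≤ invAck l ∧ 2 * l + 1 < ack (invAck l + 3) 1 := by
  have hne : {k : ℕ | 1 ≤ k ∧ l ≤ ack k k}.Nonempty :=
    ⟨l + 1, Nat.le_add_left 1 l, (Nat.le_succ l).trans (lt_ack_left (l + 1) (l + 1)).le⟩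
  obtain ⟨h1, h2⟩ := Nat.sInf_mem hne
  change 1 ≤ invAck l at h1
  change l ≤ ack (invAck l) (invAck l) at h2
  refine ⟨h1, ?_⟩
  generalize invAck l = k at *
  have h3 : ack k k ≤ ack (k + 2) 1 := by
    rw [ack_succ_succ, ack_succ_zero]
    have := add_lt_ack (k + 1) 1
    exact ack_le_ack (Nat.le_succ k) (by omega)
  have h4 : ack 2 (ack (k + 2) 1) ≤ ack (k + 3) 1 := by
    rw [show ack (k + 3) 1 = ack (k + 2) (ack (k + 2) 1) by
      rw [show k + 3 = (k + 2) + 1 from rfl, ack_succ_succ, ack_succ_zero]]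
    exact ack_mono_left _ (Nat.le_add_left 2 k)
  rw [ack_two] at h4
  omega

end Run

end RMQ

open RMQ MeasureTheory in
theorem mainTheorem6 :
    ∃ (prog : List Instr) (K C : ℕ),
      ∀ (V : Type*) [LinearOrder V] (cs : List (Cmd V)) (l a : ℕ),
        (Hist.init V).Valid cs →
        l = (Hist.init V).maxActive cs →
        1 ≤ a → a ≤ 2 * l →
        ∀ (Ω : Type*) [MeasurableSpace Ω] (P : Measure Ω) [IsProbabilityMeasure P]
          (H : Ω → Hashing), IsUniversal P H →
          (∀ ω, ∃ S, run prog K (H ω) a cs = some (S, (Hist.init V).answers cs)) ∧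
          (∀ ω cs', cs' <+: cs →
            ∃ S out, run prog K (H ω) a cs' = some (S, out) ∧ S.Within l) ∧
          ∫⁻ ω, (transferTime prog K (H ω) a cs : ENNReal) ∂P ≤
            (C * invAck l * cs.length : ℕ) ∧
          ∫⁻ ω, (commandTime prog K (H ω) a cs : ENNReal) ∂P ≤
            (C * invAck l * cs.length : ℕ) := by
  -- Put `k = invAck l` and `n = cs.length`, both at least `1`. The initial potential is `6 * k +
  -- 44`, the commands cost `n * (35 * k + 300)`, and the first structure costs `2 * a + 2 ≤ 4 * n +
  -- 2`; the sum is at most `391 * k * n`.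
  refine ⟨mergeProg, instrPerCmd, 400, ?_⟩
  intro V _ cs l a hv hl ha hal Ω _ P _ H hH
  have hready := State.start_ready (V := V) ha hal
  have hhash : (State.start V a).Hashed P (fun ω => H ω 0 (buckets a)) fun _ _ _ => 0 :=
    ⟨hH.univHash 0 a, trivial⟩
  obtain ⟨h', S, e, g, hh, τ, κ, hr, -, hc⟩ := hready.runFrom cs hv hl.ge P H hH _ _ hhash
  have hrun : ∀ ω, run mergeProg instrPerCmd (H ω) a cs =
      some (S.rehash (g ω) (hh ω) (0 + τ ω) (Struct.freshTime a + κ ω), (Hist.init V).answers cs) :=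
    fun ω => by rw [run, State.init_eq, hr]
  obtain ⟨hk, hack⟩ := lt_ack_invAck l
  have havg := (hc (invAck l + 4) hack).add_const (Struct.freshTime a)
  have hn : l ≤ cs.length := by
    have := (Hist.init V).maxActive_le cs
    rw [← hl] at this
    exact this.trans (Nat.zero_add _).le
  have hbound : (State.start V a).pot (invAck l + 4) +
      cs.length * (35 * (invAck l + 4) + 160) + Struct.freshTime a ≤
        400 * invAck l * cs.length := by
    have h1 : (State.start V a).pot (invAck l + 4) = (3 * (invAck l + 4) + 10) * 2 := by
      simp only [State.pot, State.start, Struct.blank_pot, Struct.blank_size, Phase.pot,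
        show (Struct.blank V a).top = 2 from rfl]
      omega
    rw [h1, Struct.freshTime, buckets]
    nlinarith [Nat.mul_le_mul hk (show 1 ≤ cs.length by omega),
      Nat.mul_le_mul_left (invAck l) (show 1 ≤ cs.length by omega),
      Nat.mul_le_mul_right cs.length hk]
  refine ⟨fun ω => ⟨_, hrun ω⟩, fun ω cs' hcs' => ?_, ?_, ?_⟩
  -- A prefix is itself a valid sequence, with no larger maximum, so the state after each command is
  -- the final state of a run to which the induction applies.
  · obtain ⟨cs'', rfl⟩ := hcs'
    obtain ⟨_, S', _, g', hh', τ', κ', hr', hS', -⟩ := hready.runFrom cs' (Hist.valid_append hv)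
      (((Hist.init V).maxActive_append_le cs' cs'').trans hl.ge) P H hH _ _ hhash
    exact ⟨_, _, by rw [run, State.init_eq, hr'], hS'.within _ _ _ _⟩
  -- Each of the two times is at most the total that `havg` bounds.
  · refine (havg.mono (fun ω => ?_) hbound).lintegral_le
    simp only [transferTime, hrun, State.rehash]
    omega
  · refine (havg.mono (fun ω => ?_) hbound).lintegral_le
    simp only [commandTime, hrun, State.rehash]
    omega
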